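/- Let $P_n=\mathbb F_2[x_1,\dots,x_n]$ with $\deg x_i=1$, with the usual action of the Steenrod squares $Sq^k$ (so $Sq^0=\mathrm{id}$, $Sq^1x_i=x_i^2$, $Sq^kx_i=0$ for $k>1$, and the Cartan formula holds). A polynomial is hit if it lies in $\mathcal A^+P_n$, i.e. is a finite sum $\sum_{j>0}Sq^j(g_j)$ with $g_j\in P_n$. For an integer $a\ge 0$ let $\alpha_i(a)\in\{0,1\}$ be its $i$-th binary digit, $i\ge 0$. For a monomial $x=x_1^{a_1}\cdots x_n^{a_n}$ put $\nu_j(x)=a_j$, $\sigma(x)=(a_1,\dots,a_n)$, and let $\omega(x)=(\omega_1(x),\omega_2(x),\dots)$ with $\omega_i(x)=\sum_j\alpha_{i-1}(a_j)$ be its weight vector. A weight vector is a sequence $\omega=(\omega_1,\omega_2,\dots)$ of non-negative integers with $\omega_i=0$ for $i\gg0$; its degree is $\deg\omega=\sum_{i\ge1}2^{i-1}\omega_i$. Order weight vectors and exponent vectors left lexicographically, and for monomials of the same degree put $y<x$ if $\omega(y)<\omega(x)$, or $\omega(y)=\omega(x)$ and $\sigma(y)<\sigma(x)$. A monomial $x$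 is inadmissible if there are $m\ge0$ and monomials $y_1,\dots,y_m<x$ of the same degree with $x-\sum_ty_t$ hit, and admissible otherwise. Let $B_n(d)$ be the set of admissible monomials of degree $d$ in $P_n$, and $B_n(\omega)$ the set of admissible monomials in $P_n$ with weight vector exactly $\omega$. For $1\le i\le n$ let $f_i:P_{n-1}\to P_n$ be the algebra homomorphism with $f_i(x_j)=x_j$ for $j<i$ and $f_i(x_j)=x_{j+1}$ for $j\ge i$. Let $1\le i<i_1<\dots<i_r\le n$ with $r\ge1$ and $I=(i_1,\dots,i_r)$. A monomial $x\in P_{n-1}$ is $u$-compatible with $(i;I)$, where $1\le u\le r$, if $\nu_{i_t-1}(x)=2^r-1$ for $1\le t<u$; $\nu_{i_u-1}(x)>2^r-1$; $\alpha_{r-t}(\nu_{i_u-1}(x))=1$ for $1\le t\le u$; and $\alpha_{r-t}(\nu_{i_t-1}(x))=1$ for $u<t\le r$. There is at most one such $u$. If $u$ exists, put $$\phi_{(i;I)}(x)=\frac{x_i^{2^r-1}f_i(x)}{x_{i_u}^{2^{r-1}+\dots+2^{r-u}}\prod_{u<t\le r}x_{i_t}^{2^{r-t}}},$$ which is a monomial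 of $P_n$; otherwise put $\phi_{(i;I)}(x)=0$. For a set $S$ of monomials of $P_{n-1}$ let $\Phi^0(S)=\bigcup_{i=1}^nf_i(S)$, let $\Phi^+(S)$ be the set of all monomials $\phi_{(i;I)}(x)\ne0$ ($x\in S$, $(i;I)$ as above with $\ell(I)=r\geq 1$) in which every variable $x_1,\dots,x_n$ occurs, and let $\Phi(S)=\Phi^0(S)\cup\Phi^+(S)$. Then the following hold. (a) For every integer $s\ge0$ and every weight vector $\omega$ of degree $15\cdot2^s-5$, $\Phi(B_4(\omega))\subseteq B_5(\omega)$. The same inclusion holds if, on both sides, $B_n(\omega)$ is replaced by the set of all admissible monomials $x\in P_n$ with $\deg x=\deg\omega$ and $\omega(x)\le\omega$. (b) (The case $s=1$, degree $25$.) $|\Phi^+(B_4(3,3,2,1))|=361$, $|\Phi(B_4(3,3,2,1))|=881$, and $\Phi(B_4(3,3,2,1))\subseteq B_5(3,3,2,1)$. If $\omega$ is a weight vector of degree $25$ with $\omega\ne(3,3,2,1)$, then $B_4(\omega)=\emptyset$. (c) For every integer $s>1$, $B_4(15\cdot2^s-5)=\emptyset$; hence $B_4(\omega)=\emptyset$ for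 every weight vector $\omega$ of degree $15\cdot2^s-5$. -/

import Mathlib

namespace HitProblem

/-- The polynomial algebra `P_n = 𝔽₂[x_1, …, x_n]` (variables indexed from `0`). -/
abbrev P (n : ℕ) : Type := MvPolynomial (Fin n) (ZMod 2)

/-- A monomial of `P_n`, given by its exponent vector `σ(x) = (ν_1(x), …, ν_n(x))`. -/
abbrev Mon (n : ℕ) : Type := Fin n →₀ ℕ

/-- The monomial, as an element of `P_n`. -/
noncomputable def Mon.toP {n : ℕ} (x : Mon n) : P n := MvPolynomial.monomial x 1

/-- The total Steenrod square `∑_k Sq^k T^k` on `P_n`: the algebra homomorphism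
`x_i ↦ x_i + x_i² T`. Its multiplicativity is the Cartan formula, and its values on the
generators are `Sq^0 x_i = x_i`, `Sq^1 x_i = x_i²`, `Sq^k x_i = 0` for `k > 1`. -/
noncomputable def totalSq (n : ℕ) : P n →ₐ[ZMod 2] Polynomial (P n) :=
  MvPolynomial.aeval fun i =>
    Polynomial.C (MvPolynomial.X i) + Polynomial.C (MvPolynomial.X i ^ 2) * Polynomial.X

/-- The Steenrod square `Sq^k : P_n → P_n`. -/
noncomputable def Sq {n : ℕ} (k : ℕ) (f : P n) : P n := (totalSq n f).coeff k

/-- The space `𝒜⁺P_n` of hit polynomials: finite sums `∑_{j > 0} Sq^j(g_j)`. -/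
noncomputable def hit (n : ℕ) : Submodule (ZMod 2) (P n) :=
  Submodule.span (ZMod 2) {f | ∃ k : ℕ, 0 < k ∧ ∃ g : P n, f = Sq k g}

/-- The weight vector of a monomial. The entry at `i` (counting from `0`) is the number of
exponents whose `i`-th binary digit is `1`; it is `ω_{i+1}(x)` when counting from `1`. -/
noncomputable def weight {n : ℕ} (x : Mon n) : ℕ →₀ ℕ :=
  Finsupp.onFinset (Finset.range (∑ j, x j))
    (fun i => (Finset.univ.filter fun j : Fin n => (x j).testBit i = true).card)
    (by
      intro i hi
      obtain ⟨j, hj⟩ := Finset.card_pos.1 (Nat.pos_of_ne_zero hi)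
      have h1 : 2 ^ i ≤ x j := Nat.ge_two_pow_of_testBit (Finset.mem_filter.1 hj).2
      have h2 : x j ≤ ∑ j, x j :=
        Finset.single_le_sum (f := fun j => x j) (fun _ _ => Nat.zero_le _) (Finset.mem_univ j)
      exact Finset.mem_range.2 (lt_of_lt_of_le Nat.lt_two_pow_self (h1.trans h2)))

/-- The degree `∑_{i ≥ 1} 2^{i-1} ω_i` of a weight vector (entries indexed from `0` here). -/
def weightDegree (ω : ℕ →₀ ℕ) : ℕ := ω.sum fun i c => 2 ^ i * c

/-- The order on monomials (of the same degree): compare weight vectors, then exponent vectors,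
both in the left lexicographical order. -/
def Mon.Less {n : ℕ} (x y : Mon n) : Prop :=
  toLex (weight x) < toLex (weight y) ∨ (weight x = weight y ∧ toLex x < toLex y)

/-- `x` is inadmissible: modulo hit polynomials it is a (possibly empty) sum of smaller
monomials of the same degree. -/
def Inadmissible {n : ℕ} (x : Mon n) : Prop :=
  ∃ (m : ℕ) (y : Fin m → Mon n),
    (∀ t, (y t).degree = x.degree ∧ (y t).Less x) ∧ x.toP - ∑ t, (y t).toP ∈ hit n

/-- `x` is admissible. -/
def Admissible {n : ℕ} (x : Mon n) : Prop := ¬ Inadmissible x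

/-- `B_n(d)`: the admissible monomials of degree `d` in `P_n`. -/
def BDeg (n d : ℕ) : Set (Mon n) := {x | Admissible x ∧ x.degree = d}

/-- `B_n(ω)`: the admissible monomials in `P_n` whose weight vector is `ω`. -/
def B (n : ℕ) (ω : ℕ →₀ ℕ) : Set (Mon n) := {x | Admissible x ∧ weight x = ω}

/-- The admissible monomials in `P_n` of degree `deg ω` whose weight vector is at most `ω`. -/
def BLe (n : ℕ) (ω : ℕ →₀ ℕ) : Set (Mon n) :=
  {x | x ∈ BDeg n (weightDegree ω) ∧ toLex (weight x) ≤ toLex ω}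

/-- `f_i : P_{n-1} → P_n` on monomials, with `n = m + 1`: `x_j ↦ x_j` for `j < i` and
`x_j ↦ x_{j+1}` for `j ≥ i`. -/
noncomputable def face {m : ℕ} (i : Fin (m + 1)) (x : Mon m) : Mon (m + 1) :=
  Finsupp.mapDomain i.succAbove x

/-- The set `𝒩_n` of pairs `(i; I)` with `I = (i_1, …, i_r)` and `i < i_1 < ⋯ < i_r`
(here `i_t` is `I (t - 1)`). -/
structure Pair (n : ℕ) where
  /-- the index `i` -/
  i : Fin n
  /-- the length `r = ℓ(I)` -/
  r : ℕ
  /-- the sequence `I` -/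
  I : Fin r → Fin n
  strictMono : StrictMono I
  lt : ∀ t, i < I t

/-- `x ∈ P_{n-1}` is `(u+1)`-compatible with `(i; I)`, for `r = ℓ(I) > 0` (positions in `I` are
counted from `0`). As `i < i_t`, the exponent of `x_{i_t}` in `f_i(x)` is `ν_{i_t - 1}(x)`. -/
def Compatible {m : ℕ} (N : Pair (m + 1)) (u : Fin N.r) (x : Mon m) : Prop :=
  (∀ t, t < u → face N.i x (N.I t) = 2 ^ N.r - 1) ∧
  2 ^ N.r - 1 < face N.i x (N.I u) ∧
  (∀ t, t ≤ u → (face N.i x (N.I u)).testBit (N.r - (t.val + 1)) = true) ∧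
  (∀ t, u < t → (face N.i x (N.I t)).testBit (N.r - (t.val + 1)) = true)

/-- The monomial `x_{(I,u+1)}` (positions in `I` are counted from `0`). -/
noncomputable def divisor {n : ℕ} (N : Pair n) (u : Fin N.r) : Mon n :=
  Finsupp.single (N.I u) (∑ t ∈ Finset.Iic u, 2 ^ (N.r - (t.val + 1))) +
    ∑ t ∈ Finset.Ioi u, Finsupp.single (N.I t) (2 ^ (N.r - (t.val + 1)))

/-- For `r = ℓ(I) > 0`: `y` is the nonzero monomial
`φ_{(i;I)}(x) = x_i^{2^r - 1} f_i(x) / x_{(I,u)}`, where `x` is `u`-compatible with `(i; I)`.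
There is at most one such `u`, the division is then exact, and `φ_{(i;I)}(x) = 0` if there
is no such `u`. -/
def IsPhi {m : ℕ} (N : Pair (m + 1)) (x : Mon m) (y : Mon (m + 1)) : Prop :=
  ∃ u : Fin N.r, Compatible N u x ∧
    y = (Finsupp.single N.i (2 ^ N.r - 1) + face N.i x) - divisor N u

/-- `Φ⁰(S) = ⋃_i φ_{(i;∅)}(S) = ⋃_i f_i(S)`. -/
def PhiZero {m : ℕ} (S : Set (Mon m)) : Set (Mon (m + 1)) :=
  {y | ∃ i : Fin (m + 1), ∃ x ∈ S, y = face i x}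

/-- `Φ⁺(S)`: the union of the `φ_{(i;I)}(S)` with `ℓ(I) > 0`, minus `P_n^0`; what remains are
the monomials in which every variable occurs. -/
def PhiPlus {m : ℕ} (S : Set (Mon m)) : Set (Mon (m + 1)) :=
  {y | (∃ N : Pair (m + 1), 0 < N.r ∧ ∃ x ∈ S, IsPhi N x y) ∧ ∀ j, 0 < y j}

/-- `Φ(S) = Φ⁰(S) ∪ Φ⁺(S)`. -/
def Phi {m : ℕ} (S : Set (Mon m)) : Set (Mon (m + 1)) := PhiZero S ∪ PhiPlus S

/-- The weight vector `(3, 3, 2, 1)`. -/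
def omega3321 : ℕ →₀ ℕ := [3, 3, 2, 1].toFinsupp

end HitProblem

/-! The proof plays explicit hit equations against linear functionals that vanish on all hit
polynomials.

Inadmissibility rests on two criteria. Wood's criterion (`toP_mem_hit`): write a monomial as `u v^2`
with `u` squarefree of degree `e`. As `v^2 = Sq^k v` with `k = deg v`, the χ-trick gives `u v^2 ≡
χ(Sq^k)(u) v` modulo hits, and `χ(Sq^k)(u) = 0` unless `k` is a sum of `e` numbers `2^j - 1`.
Kameko's criterion (`inadmissible_of_window`): if a block of consecutive binary digits of the
exponents forms a monomial that reduces to smaller ones by squares of small order, then the whole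
monomial is inadmissible.

For `s > 1`, Wood's criterion makes every monomial of degree `15 * 2^s - 5` in four variables hit:
otherwise a number `15 * 2^t` would have too short a binary expansion. This is (c), and it makes (a)
vacuous there. In degree 25 Wood's criterion and Kameko windows eliminate everything outside a
finite table.

Admissibility is certified by functionals (`admissible_of_functional`). A linear substitution of the
variables commutes with the Steenrod squares, and a spike (all exponents `2^j - 1`) never occurs in
`Sq^k f` for `k > 0`. Hence "substitute, then take the coefficient of a spike" kills hit
polynomials. If the spike has weight vector `ks`, this functional also kills monomials of smaller
weight, and on a monomial of weight `ks` it is a product of minors of the substitution matrix, one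
for each digit position. A sum of such functionals whose least nonvanishing monomial of weight `ks`
is `y` proves that `y` is admissible. The tables list such sums of matrices; `certCheck` tests each
one on all monomials of the weight at once, by arithmetic on long bit vectors.

For the inclusion, `f_i` preserves and reflects admissibility, which settles `Φ⁰`. Elements of `Φ⁺`
are enumerated and matched against the tables in degrees 10 and 25. The count 881 is 520 for `Φ⁰`
plus 361 for `Φ⁺`, which are disjoint. -/

namespace HitProblem

open Finset

/-! ### Steenrod squares: Cartan formula, Frobenius powers, substitutions -/

section Steenrod

variable {n : ℕ}

theorem totalSq_X (i : Fin n) : totalSq n (MvPolynomial.X i) =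
    Polynomial.C (MvPolynomial.X i) + Polynomial.C (MvPolynomial.X i ^ 2) * Polynomial.X := by
  simp [totalSq]

/-- `Sq^k` as a linear map. -/
noncomputable def sqLin (n k : ℕ) : P n →ₗ[ZMod 2] P n where
  toFun := Sq k
  map_add' f g := by simp [Sq]
  map_smul' c f := by simp [Sq]

@[simp] theorem sqLin_apply (k : ℕ) (f : P n) : sqLin n k f = Sq k f := rfl

theorem Sq_mul (k : ℕ) (f g : P n) :
    Sq k (f * g) = ∑ p ∈ antidiagonal k, Sq p.1 f * Sq p.2 g := by
  simp [Sq, Polynomial.coeff_mul]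

theorem Mon.toP_add (x y : Mon n) : (x + y).toP = x.toP * y.toP := by
  simp [Mon.toP, MvPolynomial.monomial_mul]

theorem Mon.toP_nsmul (k : ℕ) (x : Mon n) : (k • x).toP = x.toP ^ k := by
  simp [Mon.toP, MvPolynomial.monomial_pow]

@[simp] theorem Mon.toP_zero : (0 : Mon n).toP = 1 := rfl

theorem Mon.toP_eq_prod (x : Mon n) : x.toP = ∏ i, MvPolynomial.X i ^ x i := by
  rw [Mon.toP, MvPolynomial.monomial_eq, Finsupp.prod_fintype _ _ (by simp)]
  simp

theorem coeff_toP (x y : Mon n) : MvPolynomial.coeff y x.toP = if x = y then 1 else 0 := by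
  simp [Mon.toP, MvPolynomial.coeff_monomial]

theorem eq_sum_toP (f : P n) : f = ∑ x ∈ f.support, Mon.toP x := by
  conv_lhs => rw [f.as_sum]
  refine sum_congr rfl fun x hx => ?_
  have : f.coeff x = 1 := by
    have h := MvPolynomial.mem_support_iff.1 hx
    generalize f.coeff x = c at h
    revert c; decide
  rw [this]; rfl

theorem totalSq_X_pow (i : Fin n) (a : ℕ) : totalSq n (MvPolynomial.X i ^ a) =
    ∑ m ∈ range (a + 1),
      Polynomial.monomial m ((a.choose m : P n) * MvPolynomial.X i ^ (a + m)) := by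
  rw [map_pow, totalSq_X, add_comm, add_pow]
  refine sum_congr rfl fun m hm => ?_
  have hm' : m ≤ a := Nat.lt_succ_iff.1 (mem_range.1 hm)
  rw [← Polynomial.C_mul_X_pow_eq_monomial, mul_pow, ← map_pow, ← map_pow, map_mul,
    ← pow_mul, map_natCast]
  have : a + m = 2 * m + (a - m) := by omega
  rw [this, pow_add, map_mul]
  ring

theorem totalSq_toP (x : Mon n) : totalSq n x.toP =
    ∑ b ∈ Fintype.piFinset fun i => range (x i + 1),
      Polynomial.monomial (∑ i, b i)
        (((∏ i, (x i).choose (b i) : ℕ) : P n) * (x + Finsupp.equivFunOnFinite.symm b).toP) := by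
  rw [Mon.toP_eq_prod, map_prod]
  simp_rw [totalSq_X_pow]
  rw [prod_univ_sum]
  refine sum_congr rfl fun b _ => ?_
  have h2 : ∀ s : Finset (Fin n), ∏ i ∈ s, Polynomial.monomial (b i)
      (((x i).choose (b i) : P n) * MvPolynomial.X i ^ (x i + b i)) =
      Polynomial.monomial (∑ i ∈ s, b i) (((∏ i ∈ s, (x i).choose (b i) : ℕ) : P n) *
        ∏ i ∈ s, MvPolynomial.X i ^ (x i + b i)) := by
    intro s
    induction s using Finset.induction_on with
    | empty => simp
    | insert a s ha ih =>
      rw [prod_insert ha, ih, Polynomial.monomial_mul_monomial, sum_insert ha, prod_insert ha,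
        prod_insert ha]
      congr 1
      push_cast
      ring
  rw [h2, Mon.toP_eq_prod]
  simp

theorem Sq_toP (k : ℕ) (x : Mon n) : Sq k x.toP =
    ∑ b ∈ (Fintype.piFinset fun i => range (x i + 1)).filter fun b => ∑ i, b i = k,
      ((∏ i, (x i).choose (b i) : ℕ) : P n) * (x + Finsupp.equivFunOnFinite.symm b).toP := by
  rw [Sq, totalSq_toP, Polynomial.finsetSum_coeff, sum_filter]
  refine sum_congr rfl fun b _ => ?_
  rw [Polynomial.coeff_monomial]

theorem Sq_X_pow (k a : ℕ) (i : Fin n) : Sq k (MvPolynomial.X i ^ a : P n) =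
    (a.choose k : P n) * MvPolynomial.X i ^ (a + k) := by
  rw [Sq, totalSq_X_pow, Polynomial.finsetSum_coeff]
  simp only [Polynomial.coeff_monomial]
  rw [sum_ite_eq' (range (a + 1)) k]
  split_ifs with h
  · rfl
  · rw [Nat.choose_eq_zero_of_lt (by simpa using h), Nat.cast_zero, zero_mul]

/-- By linearity of `Sq^k`, monomial arguments suffice; for these the terms of `Sq^k` are
homogeneous and controlled by binary digits. -/
theorem hit_eq_span : hit n =
    Submodule.span (ZMod 2) {f | ∃ k : ℕ, 0 < k ∧ ∃ x : Mon n, f = Sq k x.toP} := by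
  apply le_antisymm
  · refine Submodule.span_le.2 ?_
    rintro _ ⟨k, hk, g, rfl⟩
    rw [eq_sum_toP g, ← sqLin_apply, map_sum]
    exact Submodule.sum_mem _ fun x _ => Submodule.subset_span ⟨k, hk, x, rfl⟩
  · refine Submodule.span_mono ?_
    rintro _ ⟨k, hk, x, rfl⟩
    exact ⟨k, hk, _, rfl⟩

theorem Sq_mem_hit {k : ℕ} (hk : 0 < k) (f : P n) : Sq k f ∈ hit n :=
  Submodule.subset_span ⟨k, hk, f, rfl⟩

theorem Sq_zero (f : P n) : Sq 0 f = f := by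
  have : (Polynomial.constantCoeff.comp (totalSq n).toRingHom) = RingHom.id (P n) := by
    apply MvPolynomial.ringHom_ext
    · intro r; simp
    · intro i; simp [totalSq_X]
  exact congrArg (fun φ : P n →+* P n => φ f) this

theorem natCast_eq_zero_or_one (c : ℕ) : (c : P n) = 0 ∨ (c : P n) = 1 := by
  have : ((c : ZMod 2) = 0 ∨ (c : ZMod 2) = 1) := by
    generalize (c : ZMod 2) = d; revert d; decide
  have h : (c : P n) = MvPolynomial.C (c : ZMod 2) := by simp
  rcases this with h' | h' <;> rw [h, h'] <;> simp

theorem natCast_eq_zero_of_even {c : ℕ} (h : c % 2 = 0) : (c : P n) = 0 := by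
  have : (c : P n) = MvPolynomial.C (c : ZMod 2) := by simp
  rw [this, (ZMod.natCast_eq_zero_iff c 2).2 (Nat.dvd_of_mod_eq_zero h), map_zero]

/-- `Sq^k x` is a sum of monomials `x + b`, where the binary digits of each `b_i` are among those
of `x_i`. -/
theorem Sq_toP_induction {k : ℕ} (x : Mon n) (p : Submodule (ZMod 2) (P n))
    (h : ∀ b : Mon n, b.degree = k → (∀ i, b i ≤ x i) → (∀ i, (x i).choose (b i) % 2 = 1) →
      (x + b).toP ∈ p) : Sq k x.toP ∈ p := by
  rw [Sq_toP]
  refine Submodule.sum_mem _ fun b hb => ?_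
  rw [mem_filter, Fintype.mem_piFinset] at hb
  by_cases hodd : ∀ i, (x i).choose (b i) % 2 = 1
  · have := h (Finsupp.equivFunOnFinite.symm b)
      (by rw [Finsupp.degree_eq_sum]; simpa using hb.2)
      (fun i => Nat.lt_succ_iff.1 (mem_range.1 (hb.1 i))) hodd
    rcases natCast_eq_zero_or_one (n := n) (∏ i, (x i).choose (b i)) with h0 | h0 <;> rw [h0]
    · simp
    · simpa using this
  · push Not at hodd
    obtain ⟨i, hi⟩ := hodd
    rw [natCast_eq_zero_of_even]
    · simp
    · exact Nat.mod_eq_zero_of_dvd ((Nat.dvd_of_mod_eq_zero (by omega)).trans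
        (dvd_prod_of_mem _ (mem_univ i)))

/-- In characteristic 2, the `2^r`-th power of a polynomial in `T` arises by raising its
coefficients to that power and replacing `T` by `T^(2^r)`. So on `2^r`-th powers only squares of
order divisible by `2^r` survive. -/
theorem totalSq_pow_two_pow (r : ℕ) (f : P n) : totalSq n (f ^ 2 ^ r) =
    Polynomial.expand (P n) (2 ^ r) ((totalSq n f).map (iterateFrobenius (P n) 2 r)) := by
  rw [map_pow, ← Polynomial.map_expand, Polynomial.map_iterateFrobenius_expand]

theorem Sq_mul_pow_two_pow (r k : ℕ) (f : P n) : Sq (2 ^ r * k) (f ^ 2 ^ r) = Sq k f ^ 2 ^ r := by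
  rw [Sq, totalSq_pow_two_pow, mul_comm, Polynomial.coeff_expand_mul (by positivity),
    Polynomial.coeff_map]
  rfl

theorem Sq_pow_two_pow_of_not_dvd {r k : ℕ} (h : ¬ 2 ^ r ∣ k) (f : P n) :
    Sq k (f ^ 2 ^ r) = 0 := by
  rw [Sq, totalSq_pow_two_pow, Polynomial.coeff_expand (by positivity), if_neg h]

/-- In the Cartan formula the factor `g^(2^s)` only admits squares of order divisible by `2^s`, and
below `2^s` this leaves `Sq^0`. -/
theorem Sq_mul_pow_of_lt {s k : ℕ} (h : k < 2 ^ s) (f g : P n) :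
    Sq k (f * g ^ 2 ^ s) = Sq k f * g ^ 2 ^ s := by
  rw [Sq_mul, sum_eq_single (k, 0)]
  · rw [Sq_zero]
  · rintro ⟨a, b⟩ hab hne
    rw [HasAntidiagonal.mem_antidiagonal] at hab
    have hb : ¬ 2 ^ s ∣ b := by
      intro hd
      rcases Nat.eq_zero_or_pos b with rfl | hb
      · exact hne (by simp at hab; simp [hab])
      · have := Nat.le_of_dvd hb hd
        simp only at hab
        omega
    rw [Sq_pow_two_pow_of_not_dvd hb, mul_zero]
  · intro h; simp at h

/-- Algebra homomorphisms that send each variable to a sum of variables commute with `Sq^k`. -/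
theorem map_Sq {m : ℕ} (ρ : P n →ₐ[ZMod 2] P m)
    (hρ : ∀ i, totalSq m (ρ (MvPolynomial.X i)) =
      Polynomial.C (ρ (MvPolynomial.X i)) + Polynomial.C (ρ (MvPolynomial.X i) ^ 2) * Polynomial.X)
    (k : ℕ) (f : P n) : ρ (Sq k f) = Sq k (ρ f) := by
  have h : (totalSq m).comp ρ = (Polynomial.mapAlgHom ρ).comp (totalSq n) := by
    apply MvPolynomial.algHom_ext
    intro i
    simp [hρ, totalSq_X]
  have := congrArg (fun φ : P n →ₐ[ZMod 2] Polynomial (P m) => (φ f).coeff k) h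
  simpa [Sq] using this.symm

theorem map_mem_hit {m : ℕ} (ρ : P n →ₐ[ZMod 2] P m)
    (hρ : ∀ i, totalSq m (ρ (MvPolynomial.X i)) =
      Polynomial.C (ρ (MvPolynomial.X i)) + Polynomial.C (ρ (MvPolynomial.X i) ^ 2) * Polynomial.X)
    {f : P n} (hf : f ∈ hit n) : ρ f ∈ hit m := by
  have : hit n ≤ (hit m).comap ρ.toLinearMap := by
    refine Submodule.span_le.2 ?_
    rintro _ ⟨k, hk, g, rfl⟩
    simp only [Submodule.comap_coe, Set.mem_preimage, AlgHom.toLinearMap_apply, SetLike.mem_coe]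
    rw [map_Sq ρ hρ]
    exact Sq_mem_hit hk _
  exact this hf

/-- Squaring is additive, so a linear form behaves like a variable. This is what allows arbitrary
linear substitutions. -/
theorem totalSq_linearForm {ι : Type*} (s : Finset ι) (v : ι → Fin n) :
    totalSq n (∑ a ∈ s, MvPolynomial.X (v a)) =
      Polynomial.C (∑ a ∈ s, MvPolynomial.X (v a)) +
        Polynomial.C ((∑ a ∈ s, MvPolynomial.X (v a)) ^ 2) * Polynomial.X := by
  rw [sum_pow_char 2, map_sum, map_sum, map_sum, sum_mul, ← sum_add_distrib]
  exact sum_congr rfl fun a _ => totalSq_X _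

end Steenrod

/-! ### Weight vectors, the monomial order and binary digits -/

section Weights

variable {n : ℕ}

theorem weight_apply (x : Mon n) (d : ℕ) :
    weight x d = (univ.filter fun j : Fin n => (x j).testBit d = true).card := rfl

theorem weight_congr {x y : Mon n} {d : ℕ} (h : ∀ i, (x i).testBit d = (y i).testBit d) :
    weight x d = weight y d := by
  simp only [weight_apply, h]

/-- `y` has a smaller weight vector than `x`, with the first difference at the position `j`. -/
def WeightDrop (j : ℕ) (y x : Mon n) : Prop :=
  (∀ d < j, weight y d = weight x d) ∧ weight y j < weight x j

theorem less_iff {x y : Mon n} : x.Less y ↔ (∃ j, WeightDrop j x y) ∨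
    weight x = weight y ∧ ∃ i, (∀ d < i, x d = y d) ∧ x i < y i := Iff.rfl

theorem testBit_add_two_pow_mul {r d : ℕ} (h : d < r) (a c : ℕ) :
    (a + 2 ^ r * c).testBit d = a.testBit d := by
  obtain ⟨e, rfl⟩ := Nat.exists_eq_add_of_lt h
  rw [Nat.testBit_eq_decide_div_mod_eq, Nat.testBit_eq_decide_div_mod_eq]
  have : 2 ^ (d + e + 1) * c = 2 ^ d * (2 * (2 ^ e * c)) := by ring
  rw [this, Nat.add_mul_div_left _ _ (by positivity), Nat.add_mul_mod_self_left]

theorem testBit_add_two_pow_mul_of_lt {r : ℕ} {a : ℕ} (ha : a < 2 ^ r) (c d : ℕ) :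
    (a + 2 ^ r * c).testBit d = if d < r then a.testBit d else c.testBit (d - r) := by
  rw [add_comm, Nat.testBit_two_pow_mul_add c ha]

theorem weight_add_two_pow {r d : ℕ} (h : d < r) (u v : Mon n) :
    weight (u + 2 ^ r • v) d = weight u d :=
  weight_congr fun i => by simpa using testBit_add_two_pow_mul h (u i) (v i)

theorem weight_add_two_pow_of_lt {r : ℕ} {u : Mon n} (hu : ∀ i, u i < 2 ^ r) (v : Mon n) (d : ℕ) :
    weight (u + 2 ^ r • v) d = if d < r then weight u d else weight v (d - r) := by
  split_ifs with h
  · exact weight_add_two_pow h u v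
  · simp only [weight_apply, Finsupp.add_apply, Finsupp.smul_apply, smul_eq_mul,
      testBit_add_two_pow_mul_of_lt (hu _), if_neg h]

theorem lt_of_weight_pos {x : Mon n} {s : ℕ} (hx : ∀ i, x i < 2 ^ s) {d : ℕ}
    (h : 0 < weight x d) : d < s := by
  rw [weight_apply] at h
  obtain ⟨j, hj⟩ := card_pos.1 h
  by_contra hd
  have := Nat.testBit_lt_two_pow ((hx j).trans_le (Nat.pow_le_pow_right (by omega) (not_lt.1 hd)))
  simp [this] at hj

theorem lt_two_pow_of_weight_eq {x y : Mon n} {s : ℕ} (hy : ∀ i, y i < 2 ^ s)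
    (h : weight x = weight y) (i : Fin n) : x i < 2 ^ s := by
  refine Nat.lt_pow_two_of_testBit _ fun d hd => ?_
  by_contra hb
  have : 0 < weight x d := by
    rw [weight_apply]
    exact card_pos.2 ⟨i, by simpa using hb⟩
  rw [h] at this
  exact absurd (lt_of_weight_pos hy this) (by omega)

/-- A weight drop occurs at a position below `s`, where `w` still has digits, so `2^s z` does not
disturb it. If the weights agree, `y` inherits the bound `2^s` from `w`, and the digits of `z` are
simply appended to both. -/
theorem Mon.Less.add_two_pow {y w : Mon n} {s : ℕ} (hw : ∀ i, w i < 2 ^ s) (z : Mon n)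
    (h : y.Less w) : (y + 2 ^ s • z).Less (w + 2 ^ s • z) := by
  rw [less_iff] at h ⊢
  rcases h with ⟨j, hj, hlt⟩ | ⟨he, i, hi, hlt⟩
  · have hjs : j < s := lt_of_weight_pos hw (by omega)
    refine Or.inl ⟨j, fun d hd => ?_, ?_⟩
    · rw [weight_add_two_pow (hd.trans hjs), weight_add_two_pow (hd.trans hjs), hj d hd]
    · rwa [weight_add_two_pow hjs, weight_add_two_pow hjs]
  · refine Or.inr ⟨?_, i, fun d hd => by simp [hi d hd], by simpa using hlt⟩
    ext d
    rw [weight_add_two_pow_of_lt (lt_two_pow_of_weight_eq hw he), weight_add_two_pow_of_lt hw, he]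

theorem Mon.Less.prefix_two_pow {u y w : Mon n} {r : ℕ} (hu : ∀ i, u i < 2 ^ r)
    (h : y.Less w) : (u + 2 ^ r • y).Less (u + 2 ^ r • w) := by
  rw [less_iff] at h ⊢
  rcases h with ⟨j, hj, hlt⟩ | ⟨he, i, hi, hlt⟩
  · refine Or.inl ⟨r + j, fun d hd => ?_, ?_⟩
    · rw [weight_add_two_pow_of_lt hu, weight_add_two_pow_of_lt hu]
      split_ifs with hdr
      · rfl
      · exact hj _ (by omega)
    · rw [weight_add_two_pow_of_lt hu, weight_add_two_pow_of_lt hu]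
      simpa using hlt
  · refine Or.inr ⟨?_, i, fun d hd => by simp [hi d hd], by simpa using hlt⟩
    ext d
    rw [weight_add_two_pow_of_lt hu, weight_add_two_pow_of_lt hu, he]

/-- Lucas' theorem modulo 2. -/
theorem testBit_of_choose_odd {a b : ℕ} (h : a.choose b % 2 = 1) {j : ℕ}
    (hb : b.testBit j = true) : a.testBit j = true := by
  have : Fact (Nat.Prime 2) := ⟨Nat.prime_two⟩
  induction j generalizing a b with
  | zero =>
    have := Choose.choose_modEq_choose_mod_mul_choose_div_nat (n := a) (k := b) (p := 2)
    rw [Nat.ModEq, h, Nat.mul_mod] at this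
    rw [Nat.testBit_zero, decide_eq_true_eq] at hb ⊢
    rw [hb] at this
    rcases Nat.mod_two_eq_zero_or_one a with ha | ha
    · simp [ha] at this
    · exact ha
  | succ j ih =>
    rw [Nat.testBit_succ] at hb ⊢
    refine ih ?_ hb
    have := Choose.choose_modEq_choose_mod_mul_choose_div_nat (n := a) (k := b) (p := 2)
    rw [Nat.ModEq, h, Nat.mul_mod] at this
    rcases Nat.mod_two_eq_zero_or_one ((a / 2).choose (b / 2)) with h0 | h0
    · simp [h0] at this
    · exact h0

/-- Take the lowest digit position `j` occurring in `b`. Below `j`, adding `b` changes nothing. At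
`j`, every exponent where `b` has a digit also has one in `x` by Lucas, so the sum has digit 0
there, while the other exponents keep their digit. Thus every term of `Sq^k x` with `k > 0` has
smaller weight than `x`. -/
theorem exists_weightDrop {x b : Mon n} (hb : b ≠ 0)
    (hodd : ∀ i, (x i).choose (b i) % 2 = 1) :
    ∃ j, (∃ i, (b i).testBit j = true) ∧ WeightDrop j (x + b) x := by
  classical
  have hex : ∃ j, ∃ i, (b i).testBit j = true := by
    obtain ⟨i, hi⟩ := Finsupp.ne_iff.1 hb
    obtain ⟨j, hj⟩ := Nat.exists_testBit_of_ne_zero hi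
    exact ⟨j, i, hj⟩
  set j := Nat.find hex with hjdef
  obtain ⟨i₀, hi₀⟩ := Nat.find_spec hex
  have hmin : ∀ i, ∀ d < j, (b i).testBit d = false := fun i d hd => by
    by_contra h
    exact Nat.find_min hex hd ⟨i, by simpa using h⟩
  have hdvd : ∀ i, ∃ c, b i = 2 ^ j * c := fun i => by
    refine ⟨b i / 2 ^ j, ?_⟩
    have h0 : b i % 2 ^ j = 0 := by
      apply Nat.eq_of_testBit_eq
      intro d
      rw [Nat.testBit_mod_two_pow]
      by_cases hd : d < j
      · simp [hmin i d hd]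
      · simp [hd]
    have := Nat.div_add_mod (b i) (2 ^ j)
    omega
  choose c hc using hdvd
  have hbit : ∀ i, (b i).testBit j = decide (c i % 2 = 1) := fun i => by
    rw [hc, Nat.testBit_eq_decide_div_mod_eq, Nat.mul_div_cancel_left _ (by positivity)]
  have hsum : ∀ i, ((x + b) i).testBit j = true →
      (x i).testBit j = true ∧ (b i).testBit j = false := by
    intro i hi
    rw [Finsupp.add_apply, hc, Nat.testBit_eq_decide_div_mod_eq,
      Nat.add_mul_div_left _ _ (by positivity), decide_eq_true_eq] at hi
    by_cases hbi : (b i).testBit j = true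
    · have hx := testBit_of_choose_odd (hodd i) hbi
      rw [hbit, decide_eq_true_eq] at hbi
      rw [Nat.testBit_eq_decide_div_mod_eq, decide_eq_true_eq] at hx
      omega
    · refine ⟨?_, by simpa using hbi⟩
      rw [hbit, decide_eq_true_eq] at hbi
      rw [Nat.testBit_eq_decide_div_mod_eq, decide_eq_true_eq]
      omega
  refine ⟨j, ⟨i₀, hi₀⟩, fun d hd => weight_congr fun i => ?_, ?_⟩
  · rw [Finsupp.add_apply, hc, testBit_add_two_pow_mul hd]
  · rw [weight_apply, weight_apply]
    refine card_lt_card ⟨fun i hi => ?_, fun h => ?_⟩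
    · simp only [mem_filter, mem_univ, true_and] at hi ⊢
      exact (hsum i hi).1
    · have := mem_filter.1 (h (mem_filter.2 ⟨mem_univ i₀, testBit_of_choose_odd (hodd i₀) hi₀⟩))
      have := (hsum i₀ this.2).2
      rw [hi₀] at this; exact absurd this (by decide)

end Weights

/-! ### Linear reformulation of inadmissibility and Kameko's criterion -/

section Inadmissibility

variable {n : ℕ}

/-- The span of a set of monomials. -/
noncomputable def monSpan (S : Set (Mon n)) : Submodule (ZMod 2) (P n) :=
  Submodule.span (ZMod 2) (Mon.toP '' S)

theorem toP_mem_monSpan {S : Set (Mon n)} {x : Mon n} (h : x ∈ S) : x.toP ∈ monSpan S :=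
  Submodule.subset_span ⟨x, h, rfl⟩

theorem monSpan_mono {S T : Set (Mon n)} (h : S ⊆ T) : monSpan S ≤ monSpan T :=
  Submodule.span_mono (Set.image_mono h)

theorem mem_of_mem_support {S : Set (Mon n)} {f : P n} (hf : f ∈ monSpan S) {y : Mon n}
    (hy : y ∈ f.support) : y ∈ S := by
  rw [MvPolynomial.mem_support_iff] at hy
  by_contra hS
  refine hy ?_
  clear hy
  induction hf using Submodule.span_induction with
  | mem f hf =>
    obtain ⟨x, hx, rfl⟩ := hf
    rw [coeff_toP, if_neg]
    rintro rfl
    exact hS hx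
  | zero => simp
  | add f g _ _ hf hg => simp [hf, hg]
  | smul c f _ hf => simp [hf]

theorem Sq_toP_isHomogeneous (k : ℕ) (x : Mon n) :
    (Sq k x.toP).IsHomogeneous (x.degree + k) := by
  rw [← MvPolynomial.mem_homogeneousSubmodule]
  refine Sq_toP_induction x _ fun b hb _ _ => ?_
  rw [MvPolynomial.mem_homogeneousSubmodule]
  refine MvPolynomial.isHomogeneous_monomial _ ?_
  rw [map_add, hb]

theorem homogeneousComponent_toP (d : ℕ) (x : Mon n) :
    MvPolynomial.homogeneousComponent d x.toP = if d = x.degree then x.toP else 0 :=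
  (MvPolynomial.homogeneousComponent_of_mem (m := d) (n := x.degree)
    ((MvPolynomial.mem_homogeneousSubmodule _ _).2 (MvPolynomial.isHomogeneous_monomial _ rfl)))

theorem homogeneousComponent_mem_hit (d : ℕ) {f : P n} (hf : f ∈ hit n) :
    MvPolynomial.homogeneousComponent d f ∈ hit n := by
  have : hit n ≤ (hit n).comap (MvPolynomial.homogeneousComponent d) := by
    conv_lhs => rw [hit_eq_span]
    refine Submodule.span_le.2 ?_
    rintro _ ⟨k, hk, x, rfl⟩
    simp only [Submodule.comap_coe, Set.mem_preimage, SetLike.mem_coe]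
    rw [MvPolynomial.homogeneousComponent_of_mem
      ((MvPolynomial.mem_homogeneousSubmodule _ _).2 (Sq_toP_isHomogeneous k x))]
    split_ifs
    · exact Sq_mem_hit hk _
    · exact zero_mem _
  exact this hf

/-- The order also compares monomials of different degrees, whereas the definition asks for equal
degree. Passing to the homogeneous component of degree `deg x` repairs this, since it preserves hit
polynomials. The coefficients are 0 or 1, so the smaller part is a plain sum over its support. -/
theorem inadmissible_of_mem {x : Mon n} (h : x.toP ∈ hit n ⊔ monSpan {y | y.Less x}) :
    Inadmissible x := by
  obtain ⟨a, ha, l, hl, hal⟩ := Submodule.mem_sup.1 h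
  let d := x.degree
  let a' := MvPolynomial.homogeneousComponent d a
  let l' := MvPolynomial.homogeneousComponent d l
  have hx : x.toP = a' + l' := by
    have := congrArg (MvPolynomial.homogeneousComponent d) hal
    rw [map_add, homogeneousComponent_toP, if_pos rfl] at this
    exact this.symm
  have hl' : l' ∈ monSpan {y | y.degree = x.degree ∧ y.Less x} := by
    have : monSpan {y | y.Less x} ≤ (monSpan {y | y.degree = x.degree ∧ y.Less x}).comap
        (MvPolynomial.homogeneousComponent d) := by
      refine Submodule.span_le.2 ?_
      rintro _ ⟨y, hy, rfl⟩
      simp only [Submodule.comap_coe, Set.mem_preimage, SetLike.mem_coe]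
      rw [homogeneousComponent_toP]
      split_ifs with hd
      · exact toP_mem_monSpan ⟨hd.symm, hy⟩
      · exact zero_mem _
    exact this hl
  let e := l'.support.equivFin
  refine ⟨_, fun t => (e.symm t).1, fun t => mem_of_mem_support hl' (e.symm t).2, ?_⟩
  have hsum : ∑ t, Mon.toP (e.symm t).1 = l' := by
    rw [Equiv.sum_comp e.symm (fun y : l'.support => Mon.toP y.1),
      sum_coe_sort l'.support Mon.toP]
    exact (eq_sum_toP l').symm
  rw [hsum, hx, add_sub_cancel_right]
  exact homogeneousComponent_mem_hit d ha

/-- A functional that kills the hit polynomials and the monomials below `y`, but not `y`. -/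
theorem admissible_of_functional {y : Mon n} (θ : P n →ₗ[ZMod 2] ZMod 2)
    (hit_zero : ∀ f ∈ hit n, θ f = 0) (hy : θ y.toP ≠ 0)
    (hz : ∀ z : Mon n, z.Less y → θ z.toP = 0) : Admissible y := by
  rintro ⟨m, z, hlt, hmem⟩
  have := hit_zero _ hmem
  rw [map_sub, map_sum, sum_eq_zero fun t _ => hz _ (hlt t).2, sub_zero] at this
  exact hy this

/-- Expand the hit polynomial `Sq^K(u h^(2^r))` by Cartan. The term with `Sq^0 u` is the polynomial
in question. Every other term has a factor `Sq^a u` with `a > 0`, which lowers the weight of `u` at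
a position below `r`, and a second factor that is again a `2^r`-th power or zero, hence invisible at
these positions. -/
theorem toP_mul_Sq_pow_mem {r K : ℕ} {u : Mon n} (hu : ∀ i, u i < 2 ^ r) (hK : 0 < K) (h : P n) :
    u.toP * Sq K (h ^ 2 ^ r) ∈ hit n ⊔ monSpan {v | ∃ j < r, WeightDrop j v u} := by
  have hc := Sq_mul K u.toP (h ^ 2 ^ r)
  rw [← add_sum_erase _ _ (show (0, K) ∈ antidiagonal K by simp), Sq_zero] at hc
  rw [eq_sub_of_add_eq hc.symm]
  refine Submodule.sub_mem _ (Submodule.mem_sup_left (Sq_mem_hit hK _))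
    (Submodule.mem_sup_right (Submodule.sum_mem _ ?_))
  rintro ⟨a, b⟩ hab
  rw [mem_erase, HasAntidiagonal.mem_antidiagonal] at hab
  have ha : a ≠ 0 := by
    rintro rfl
    exact hab.1 (by have := hab.2; simp at this; simp [this])
  by_cases hb : 2 ^ r ∣ b
  · obtain ⟨b', rfl⟩ := hb
    simp only
    rw [Sq_mul_pow_two_pow, eq_sum_toP (Sq b' h), sum_pow_char_pow 2, mul_sum]
    refine Submodule.sum_mem _ fun y _ => ?_
    rw [← Mon.toP_nsmul]
    refine Sq_toP_induction u
      ((monSpan _).comap (LinearMap.mulRight (ZMod 2) (Mon.toP (2 ^ r • y)))) ?_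
    intro c hc hle hodd
    rw [Submodule.mem_comap, LinearMap.mulRight_apply, ← Mon.toP_add]
    refine toP_mem_monSpan ?_
    obtain ⟨j, ⟨i, hi⟩, hj, hlt⟩ := exists_weightDrop (x := u) (b := c)
      (by rintro rfl; simp at hc; exact ha hc.symm) hodd
    have hjr : j < r := by
      have h1 := Nat.ge_two_pow_of_testBit hi
      exact (Nat.pow_lt_pow_iff_right (by omega)).1 (h1.trans_lt ((hle i).trans_lt (hu i)))
    refine ⟨j, hjr, fun d hd => ?_, ?_⟩
    · rw [weight_add_two_pow (hd.trans hjr), hj d hd]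
    · rwa [weight_add_two_pow hjr]
  · simp only
    rw [Sq_pow_two_pow_of_not_dvd hb, mul_zero]
    exact zero_mem _

/-- The polynomials `Sq^k g` with `0 < k`, and `k < 2^s` if `z ≠ 0`. -/
def boundedSq (s : ℕ) (z : Mon n) : Set (P n) :=
  {f | ∃ k : ℕ, 0 < k ∧ (k < 2 ^ s ∨ z = 0) ∧ ∃ g : P n, f = Sq k g}

/-- Kameko's criterion: if `w` is inadmissible (by means of squares of order less than `2^s`,
unless `z = 1`), then so is `u w^{2^r} z^{2^{r+s}}`. -/
theorem inadmissible_of_window {r s : ℕ} {u w z : Mon n} (hu : ∀ i, u i < 2 ^ r)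
    (hw : ∀ i, w i < 2 ^ s)
    (h : w.toP ∈ Submodule.span (ZMod 2) (boundedSq s z ∪ Mon.toP '' {y | y.Less w})) :
    Inadmissible (u + 2 ^ r • (w + 2 ^ s • z)) := by
  apply inadmissible_of_mem
  set x := u + 2 ^ r • (w + 2 ^ s • z) with hx
  have key : ∀ f ∈ Submodule.span (ZMod 2) (boundedSq s z ∪ Mon.toP '' {y | y.Less w}),
      u.toP * (f * Mon.toP (2 ^ s • z)) ^ 2 ^ r ∈ hit n ⊔ monSpan {y | y.Less x} := by
    intro f hf
    induction hf using Submodule.span_induction with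
    | zero => simp
    | add f g _ _ hf hg =>
      rw [add_mul, add_pow_char_pow, mul_add]
      exact add_mem hf hg
    | smul c f _ hf =>
      rw [smul_mul_assoc, smul_pow, mul_smul_comm]
      exact Submodule.smul_mem _ _ hf
    | mem f hf =>
      rcases hf with ⟨k, hk, hks, g, rfl⟩ | ⟨y, hy, rfl⟩
      -- The factor `z^(2^s)` can be pulled inside the square: the order is below `2^s`, or `z` is
      -- trivial. The Frobenius then turns `Sq^k` into `Sq^(2^r k)`.
      · have : Sq k g * Mon.toP (2 ^ s • z) = Sq k (g * Mon.toP (2 ^ s • z)) := by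
          rcases hks with hks | rfl
          · rw [Mon.toP_nsmul, Sq_mul_pow_of_lt hks]
          · simp
        rw [this, ← Sq_mul_pow_two_pow]
        refine sup_le_sup_left (monSpan_mono ?_) _ (toP_mul_Sq_pow_mem hu (by positivity) _)
        rintro v ⟨j, hj, hv, hlt⟩
        refine less_iff.2 (Or.inl ⟨j, fun d hd => ?_, ?_⟩)
        · rw [weight_add_two_pow (hd.trans hj), hv d hd]
        · rwa [weight_add_two_pow hj]
      · refine Submodule.mem_sup_right ?_
        rw [← Mon.toP_add, ← Mon.toP_nsmul, ← Mon.toP_add]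
        exact toP_mem_monSpan ((hy.add_two_pow hw z).prefix_two_pow hu)
  have := key _ h
  rwa [← Mon.toP_add, ← Mon.toP_nsmul, ← Mon.toP_add] at this

/-- If `w` is hit, then `u w^{2^r}` is inadmissible. -/
theorem inadmissible_of_hit {r : ℕ} {u w : Mon n} (hu : ∀ i, u i < 2 ^ r)
    (h : w.toP ∈ hit n) : Inadmissible (u + 2 ^ r • w) := by
  -- Any window length exceeding all digits of `w` works. With `z` trivial the order of the squares
  -- is unrestricted.
  have hw : ∀ i, w i < 2 ^ w.degree := fun i =>
    Nat.lt_two_pow_self.trans_le (Nat.pow_le_pow_right (by omega) (Finsupp.le_degree i w))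
  have := inadmissible_of_window (s := w.degree) (z := 0) hu hw
    (Submodule.span_mono (Set.subset_union_left.trans' ?_) h)
  · simpa using this
  · rintro _ ⟨k, hk, g, rfl⟩
    exact ⟨k, hk, Or.inr rfl, g, rfl⟩

end Inadmissibility

/-! ### Conjugate squares, the χ-trick and Wood's criterion -/

section Conjugation

variable {n : ℕ}

open Classical in
/-- The series `∑_j x_i^{2^j} T^{2^j - 1}`. -/
noncomputable def conjVar (i : Fin n) : PowerSeries (P n) :=
  PowerSeries.mk fun m => if ∃ j, m + 1 = 2 ^ j then MvPolynomial.X i ^ (m + 1) else 0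

/-- The total conjugate Steenrod square `∑_k χ(Sq^k) T^k`. -/
noncomputable def totalConj (n : ℕ) : P n →ₐ[ZMod 2] PowerSeries (P n) :=
  MvPolynomial.aeval conjVar

/-- Squaring the series and multiplying by `T` shifts the index `j` by one, so modulo 2 the sum
telescopes to the term `j = 0`. This says that the total conjugate square inverts the total square
on variables. -/
theorem conjVar_add (i : Fin n) :
    conjVar i + conjVar i ^ 2 * PowerSeries.X = PowerSeries.C (MvPolynomial.X i) := by
  classical
  ext1 m
  have hsq : PowerSeries.map (frobenius (P n) 2) (PowerSeries.expand 2 two_ne_zero (conjVar i)) =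
      conjVar i ^ 2 := MvPowerSeries.map_frobenius_expand 2 two_ne_zero
  rw [map_add, ← hsq]
  cases m with
  | zero =>
    simp only [conjVar, PowerSeries.coeff_zero_mul_X, PowerSeries.coeff_mk,
      PowerSeries.coeff_zero_C]
    rw [if_pos ⟨0, rfl⟩, add_zero, zero_add, pow_one]
  | succ m =>
    rw [PowerSeries.coeff_succ_mul_X, PowerSeries.coeff_map, PowerSeries.coeff_expand,
      PowerSeries.coeff_C, if_neg (Nat.succ_ne_zero m), conjVar, PowerSeries.coeff_mk]
    by_cases hm : 2 ∣ m
    · obtain ⟨q, rfl⟩ := hm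
      -- At the odd exponent `2 q + 1` both summands contribute under the same condition, and they
      -- contribute the same power of the variable, so they cancel.
      have hiff : (∃ j, 2 * q + 1 + 1 = 2 ^ j) ↔ ∃ j, q + 1 = 2 ^ j := by
        constructor
        · rintro ⟨j, hj⟩
          cases j with
          | zero => omega
          | succ j => exact ⟨j, by rw [pow_succ] at hj; omega⟩
        · rintro ⟨j, hj⟩
          exact ⟨j + 1, by rw [pow_succ]; omega⟩
      rw [if_pos (dvd_mul_right 2 q), Nat.mul_div_cancel_left _ two_pos, PowerSeries.coeff_mk]
      by_cases hq : ∃ j, q + 1 = 2 ^ j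
      · rw [if_pos hq, if_pos (hiff.2 hq), frobenius_def, ← pow_mul,
          show (q + 1) * 2 = 2 * q + 1 + 1 by ring]
        exact CharTwo.add_self_eq_zero _
      · rw [if_neg hq, if_neg (mt hiff.1 hq)]
        simp
    · rw [if_neg hm, if_neg]
      · simp
      · rintro ⟨j, hj⟩
        cases j with
        | zero => omega
        | succ j => rw [pow_succ] at hj; omega

theorem coeff_eval₂_totalConj (k : ℕ) (p : Polynomial (P n)) :
    PowerSeries.coeff k (p.eval₂ (totalConj n : P n →+* PowerSeries (P n)) PowerSeries.X) =
      ∑ q ∈ antidiagonal k, PowerSeries.coeff q.2 (totalConj n (p.coeff q.1)) := by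
  induction p using Polynomial.induction_on' with
  | add p q hp hq => simp [Polynomial.eval₂_add, hp, hq, sum_add_distrib]
  | monomial m c =>
    rw [Polynomial.eval₂_monomial, PowerSeries.coeff_mul_X_pow']
    split_ifs with h
    · rw [sum_eq_single (m, k - m)]
      · simp
      · rintro ⟨a, b⟩ hab hne
        rw [HasAntidiagonal.mem_antidiagonal] at hab
        rw [Polynomial.coeff_monomial, if_neg, map_zero, map_zero]
        rintro rfl
        exact hne (by simp at hab; simp; omega)
      · intro h'
        exact absurd (HasAntidiagonal.mem_antidiagonal.2 (by simp; omega)) h'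
    · symm
      refine sum_eq_zero ?_
      rintro ⟨a, b⟩ hab
      rw [HasAntidiagonal.mem_antidiagonal] at hab
      rw [Polynomial.coeff_monomial, if_neg, map_zero, map_zero]
      rintro rfl
      simp at hab; omega

/-- The antipode identity. The total square followed by the total conjugate square, with the same
parameter `T`, is a ring homomorphism; it is the inclusion of constants because it is so on each
variable, by `conjVar_add`. -/
theorem sum_conj_Sq (k : ℕ) (f : P n) :
    ∑ q ∈ antidiagonal k, PowerSeries.coeff q.2 (totalConj n (Sq q.1 f)) =
      if k = 0 then f else 0 := by
  have h : (Polynomial.eval₂RingHom (totalConj n : P n →+* PowerSeries (P n)) PowerSeries.X).comp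
      (totalSq n).toRingHom = PowerSeries.C := by
    apply MvPolynomial.ringHom_ext
    · intro r
      have h1 : totalSq n (MvPolynomial.C r) = Polynomial.C (MvPolynomial.C r) :=
        (totalSq n).commutes r
      have h2 : totalConj n (MvPolynomial.C r) = PowerSeries.C (MvPolynomial.C r) :=
        by
        simp [totalConj, PowerSeries.algebraMap_apply]
      simp [h1, h2]
    · intro i
      simp [totalSq_X, Polynomial.eval₂_add, totalConj, ← conjVar_add, Polynomial.eval₂_pow]
  have := congrArg (fun φ : P n →+* PowerSeries (P n) => PowerSeries.coeff k (φ f)) h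
  simp only [RingHom.comp_apply, Polynomial.coe_eval₂RingHom, coeff_eval₂_totalConj,
    PowerSeries.coeff_C] at this
  exact this

/-- The `χ`-trick. -/
theorem mul_Sq_sub_conj_mul_mem_hit (k : ℕ) (u v : P n) :
    u * Sq k v - PowerSeries.coeff k (totalConj n u) * v ∈ hit n := by
  induction k using Nat.strong_induction_on generalizing u with
  | _ k ih =>
    rcases Nat.eq_zero_or_pos k with rfl | hk
    · have := sum_conj_Sq 0 u
      simp only [Nat.antidiagonal_zero, sum_singleton, Sq_zero, if_true] at this
      rw [Sq_zero, this, sub_self]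
      exact zero_mem _
    -- The first parts add up to the hit polynomial `Sq^k(u v)`, and the second parts to zero by the
    -- antipode identity. The terms with `q.1 > 0` are hit by induction, applied to `Sq q.1 u` and
    -- the smaller order `q.2`; the term with `q.1 = 0` is the claim.
    · have hsum : ∑ q ∈ antidiagonal k, (Sq q.1 u * Sq q.2 v -
          PowerSeries.coeff q.2 (totalConj n (Sq q.1 u)) * v) ∈ hit n := by
        rw [sum_sub_distrib, ← Sq_mul, ← sum_mul, sum_conj_Sq, if_neg hk.ne', zero_mul, sub_zero]
        exact Sq_mem_hit hk _
      rw [← add_sum_erase _ _ (show (0, k) ∈ antidiagonal k by simp)] at hsum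
      simp only [Sq_zero] at hsum
      refine (Submodule.add_mem_iff_left _ (Submodule.sum_mem _ ?_)).1 hsum
      rintro ⟨a, b⟩ hab
      rw [mem_erase, HasAntidiagonal.mem_antidiagonal] at hab
      refine ih b ?_ _
      have h1 := hab.2
      have h2 : a ≠ 0 := by
        rintro rfl
        exact hab.1 (by simp at h1; simp [h1])
      simp at h1
      omega

/-- `k` is a sum of `e` numbers of the form `2^j - 1`. -/
def IsSumOfSpikes : ℕ → ℕ → Prop
  | 0, k => k = 0
  | e + 1, k => ∃ j m, k = 2 ^ j - 1 + m ∧ IsSumOfSpikes e m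

/-- For squarefree `u` the total conjugate is a product of `deg u` series in which `T` occurs only
with exponents `2^j - 1`. -/
theorem coeff_totalConj_eq_zero {u : Mon n} (hu : ∀ i, u i ≤ 1) {k : ℕ}
    (h : ¬ IsSumOfSpikes u.degree k) : PowerSeries.coeff k (totalConj n u.toP) = 0 := by
  classical
  have key : ∀ (s : Finset (Fin n)) (k : ℕ),
      PowerSeries.coeff k (∏ i ∈ s, conjVar i ^ u i) ≠ 0 → IsSumOfSpikes (∑ i ∈ s, u i) k := by
    intro s
    induction s using Finset.induction_on with
    | empty =>
      intro k hk
      rw [prod_empty, PowerSeries.coeff_one] at hk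
      simpa [IsSumOfSpikes] using hk
    | insert a s ha ih =>
      intro k hk
      rw [prod_insert ha] at hk
      rw [sum_insert ha]
      rcases Nat.le_one_iff_eq_zero_or_eq_one.1 (hu a) with h0 | h0
      · rw [h0, pow_zero, one_mul] at hk
        rw [h0, zero_add]
        exact ih k hk
      · rw [h0, pow_one, PowerSeries.coeff_mul] at hk
        obtain ⟨⟨i, m⟩, him, hne⟩ := exists_ne_zero_of_sum_ne_zero hk
        rw [HasAntidiagonal.mem_antidiagonal] at him
        have h1 := left_ne_zero_of_mul hne
        rw [conjVar, PowerSeries.coeff_mk] at h1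
        obtain ⟨j, hj⟩ : ∃ j, i + 1 = 2 ^ j := by
          by_contra hcon
          exact h1 (if_neg hcon)
        rw [h0, add_comm]
        refine ⟨j, m, ?_, ih m (right_ne_zero_of_mul hne)⟩
        simp at him
        omega
  by_contra hk
  refine h ?_
  rw [Finsupp.degree_eq_sum]
  refine key univ k ?_
  simpa [Mon.toP_eq_prod, totalConj] using hk

/-- The only `b ≤ v` with the same total as `v` is `v` itself. -/
theorem Sq_degree_toP (v : Mon n) : Sq v.degree v.toP = v.toP ^ 2 := by
  rw [Sq_toP, sum_eq_single (v : Fin n → ℕ)]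
  · simp [← Mon.toP_nsmul, two_nsmul]
  · intro b hb hne
    rw [mem_filter, Fintype.mem_piFinset] at hb
    refine absurd ?_ hne
    have hle : ∀ i ∈ univ, b i ≤ v i := fun i _ => Nat.lt_succ_iff.1 (mem_range.1 (hb.1 i))
    have := hb.2
    rw [Finsupp.degree_eq_sum] at this
    funext i
    exact (sum_eq_sum_iff_of_le hle).1 this i (mem_univ i)
  · intro h
    refine absurd ?_ h
    rw [mem_filter, Fintype.mem_piFinset]
    exact ⟨fun i => by simp, (Finsupp.degree_eq_sum v).symm⟩

/-- Wood's criterion. -/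
theorem toP_mem_hit {u v : Mon n} (hu : ∀ i, u i ≤ 1) (h : ¬ IsSumOfSpikes u.degree v.degree) :
    (u + 2 • v).toP ∈ hit n := by
  have := mul_Sq_sub_conj_mul_mem_hit v.degree u.toP v.toP
  rwa [coeff_totalConj_eq_zero hu h, zero_mul, sub_zero, Sq_degree_toP, ← Mon.toP_nsmul,
    ← Mon.toP_add] at this

end Conjugation

/-! ### Digit decompositions, and vanishing in degree `15 * 2^s - 5` for `s > 1` -/

section Vanishing

variable {n : ℕ}

/-- The monomial of the lowest `r` binary digits of the exponents. -/
noncomputable def lowDigits (r : ℕ) (x : Mon n) : Mon n := x.mapRange (· % 2 ^ r) (by simp)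

/-- The monomial of the remaining binary digits of the exponents. -/
noncomputable def highDigits (r : ℕ) (x : Mon n) : Mon n := x.mapRange (· / 2 ^ r) (by simp)

@[simp] theorem lowDigits_apply (r : ℕ) (x : Mon n) (i : Fin n) :
    lowDigits r x i = x i % 2 ^ r := rfl

@[simp] theorem highDigits_apply (r : ℕ) (x : Mon n) (i : Fin n) :
    highDigits r x i = x i / 2 ^ r := rfl

theorem lowDigits_add (r : ℕ) (x : Mon n) : lowDigits r x + 2 ^ r • highDigits r x = x := by
  ext i
  simp [Nat.mod_add_div]

theorem lowDigits_lt (r : ℕ) (x : Mon n) (i : Fin n) : lowDigits r x i < 2 ^ r :=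
  Nat.mod_lt _ (by positivity)

theorem degree_lowDigits_add (r : ℕ) (x : Mon n) :
    (lowDigits r x).degree + 2 ^ r * (highDigits r x).degree = x.degree := by
  conv_rhs => rw [← lowDigits_add r x]
  simp

theorem weight_zero_eq (x : Mon n) : weight x 0 = (lowDigits 1 x).degree := by
  rw [weight_apply, card_filter, Finsupp.degree_eq_sum]
  refine sum_congr rfl fun i _ => ?_
  rw [lowDigits_apply, Nat.testBit_zero, pow_one]
  rcases Nat.mod_two_eq_zero_or_one (x i) with h | h <;> simp [h]

theorem weight_add_highDigits (r d : ℕ) (x : Mon n) :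
    weight (highDigits r x) d = weight x (r + d) := by
  conv_rhs => rw [← lowDigits_add r x, weight_add_two_pow_of_lt (lowDigits_lt r x)]
  simp

theorem weight_le (x : Mon n) (d : ℕ) : weight x d ≤ n := by
  rw [weight_apply]
  exact (card_le_univ _).trans (by simp)

/-- The degree is determined by the weight vector. -/
theorem degree_eq_weight_zero_add (x : Mon n) :
    x.degree = weight x 0 + 2 * (highDigits 1 x).degree := by
  rw [weight_zero_eq, ← degree_lowDigits_add 1 x, pow_one]

theorem toP_mem_hit_of_not_isSumOfSpikes {x : Mon n}
    (h : ¬ IsSumOfSpikes (weight x 0) (highDigits 1 x).degree) : x.toP ∈ hit n := by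
  rw [weight_zero_eq] at h
  have := toP_mem_hit (fun i => Nat.le_of_lt_succ (lowDigits_lt 1 x i)) h
  have hx : lowDigits 1 x + 2 • highDigits 1 x = x := lowDigits_add 1 x
  rwa [hx] at this

theorem weightDegree_weight (x : Mon n) : weightDegree (weight x) = x.degree := by
  have key : ∀ a : ℕ, ∀ N, a < 2 ^ N → ∑ d ∈ range N, 2 ^ d * (a.testBit d).toNat = a := by
    intro a N
    induction N generalizing a with
    | zero => intro h; simp at h; simp [h]
    | succ N ih =>
      intro h
      rw [sum_range_succ']
      have h2 := ih (a / 2) (by rw [pow_succ] at h; omega)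
      have h3 : ∑ d ∈ range N, 2 ^ (d + 1) * (a.testBit (d + 1)).toNat =
          2 * ∑ d ∈ range N, 2 ^ d * ((a / 2).testBit d).toNat := by
        rw [mul_sum]
        refine sum_congr rfl fun d _ => ?_
        rw [Nat.testBit_succ, pow_succ]
        ring
      rw [h3, h2, Nat.testBit_zero]
      rcases Nat.mod_two_eq_zero_or_one a with h | h <;> simp [h] <;> omega
  have hlt : ∀ i, x i < 2 ^ x.degree := fun i =>
    Nat.lt_two_pow_self.trans_le (Nat.pow_le_pow_right (by omega) (Finsupp.le_degree i x))
  rw [weightDegree, Finsupp.sum_of_support_subset (s := range x.degree)]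
  · have hdeg : x.degree = ∑ i, ∑ d ∈ range x.degree, 2 ^ d * ((x i).testBit d).toNat := by
      rw [sum_congr rfl fun i _ => key (x i) x.degree (hlt i), ← Finsupp.degree_eq_sum]
    conv_rhs => rw [hdeg]
    rw [sum_comm]
    refine sum_congr rfl fun d _ => ?_
    rw [weight_apply, card_filter, mul_sum]
    refine sum_congr rfl fun i _ => ?_
    cases (x i).testBit d <;> rfl
  · intro d hd
    rw [mem_range]
    exact lt_of_weight_pos hlt (Nat.pos_of_ne_zero (Finsupp.mem_support_iff.1 hd))
  · simp

theorem two_pow_eq_one_or_even (a : ℕ) : a = 0 ∨ ∃ b, a = b + 1 ∧ 2 ^ a = 2 * 2 ^ b := by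
  cases a with
  | zero => exact Or.inl rfl
  | succ b => exact Or.inr ⟨b, rfl, by ring⟩

/-- This and the next two lemmas count binary ones: `15 * 2^s` has four, so it is not a sum of two
or three powers of 2. As a sum of four powers these must be distinct, and a summand 1 forces the
number to be odd. Hence the third lemma needs `s > 0`, the exception being `15 = 8 + 4 + 2 + 1`. The
proofs descend by parity. -/
theorem not_two_pow_of_fifteen (s j : ℕ) : 15 * 2 ^ s ≠ 2 ^ j + 1 := by
  rcases two_pow_eq_one_or_even s with rfl | ⟨t, rfl, ht⟩
  · rcases two_pow_eq_one_or_even j with rfl | ⟨i, rfl, hi⟩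
    · norm_num
    · intro h
      rcases two_pow_eq_one_or_even i with rfl | ⟨l, rfl, hl⟩ <;> (simp at *; try omega)
  · rcases two_pow_eq_one_or_even j with rfl | ⟨i, rfl, hi⟩
    · have := Nat.one_le_two_pow (n := t)
      rw [ht]; simp; omega
    · omega

theorem not_two_pow_add_of_fifteen (s j i : ℕ) : 15 * 2 ^ s ≠ 2 ^ j + 2 ^ i + 1 := by
  intro h
  rcases two_pow_eq_one_or_even s with rfl | ⟨t, rfl, ht⟩
  · have h1 := Nat.one_le_two_pow (n := i)
    have h2 := Nat.one_le_two_pow (n := j)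
    have hj : j < 4 := by
      by_contra hj
      have := Nat.pow_le_pow_right (n := 2) (by omega) (not_lt.1 hj)
      simp at h; omega
    have hi : i < 4 := by
      by_contra hi
      have := Nat.pow_le_pow_right (n := 2) (by omega) (not_lt.1 hi)
      simp at h; omega
    interval_cases j <;> interval_cases i <;> omega
  · rcases two_pow_eq_one_or_even j with rfl | ⟨j, rfl, hj⟩ <;>
    rcases two_pow_eq_one_or_even i with rfl | ⟨i, rfl, hi⟩
    · omega
    · exact not_two_pow_of_fifteen t i (by simp at h; omega)
    · exact not_two_pow_of_fifteen t j (by simp at h; omega)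
    · omega

theorem not_two_pow_add_add_of_fifteen (s j i l : ℕ) (hs : 0 < s) :
    15 * 2 ^ s ≠ 2 ^ j + 2 ^ i + 2 ^ l + 1 := by
  intro h
  rcases two_pow_eq_one_or_even s with rfl | ⟨t, rfl, ht⟩
  · omega
  · have := Nat.one_le_two_pow (n := t)
    rcases two_pow_eq_one_or_even j with rfl | ⟨j, rfl, hj⟩ <;>
    rcases two_pow_eq_one_or_even i with rfl | ⟨i, rfl, hi⟩ <;>
    rcases two_pow_eq_one_or_even l with rfl | ⟨l, rfl, hl⟩
    · omega
    · simp at h; omega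
    · simp at h; omega
    · exact not_two_pow_add_of_fifteen t i l (by simp at h; omega)
    · simp at h; omega
    · exact not_two_pow_add_of_fifteen t j l (by simp at h; omega)
    · exact not_two_pow_add_of_fifteen t j i (by simp at h; omega)
    · omega

/-- The degree is odd, so `e` is 1 or 3. A decomposition of `k` then gives `2^j + 1 = 15 * 2^(s-2)`
or `2^j + 2^i + 2^l + 1 = 15 * 2^(s-1)`, both impossible. -/
theorem not_isSumOfSpikes_of_degree {s e k : ℕ} (hs : 1 < s) (he : e ≤ 4)
    (h : e + 2 * k = 15 * 2 ^ s - 5) : ¬ IsSumOfSpikes e k := by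
  obtain ⟨s, rfl⟩ := Nat.exists_eq_add_of_lt hs
  have h1 : 15 * 2 ^ (1 + s + 1) = 4 * (15 * 2 ^ s) := by ring
  have h2 : 15 * 2 ^ (s + 1) = 2 * (15 * 2 ^ s) := by ring
  have h3 := Nat.one_le_two_pow (n := s)
  intro hk
  interval_cases e
  · omega
  · obtain ⟨j, m, rfl, rfl⟩ := hk
    have := Nat.one_le_two_pow (n := j)
    rcases two_pow_eq_one_or_even j with rfl | ⟨j, rfl, hj⟩
    · simp at h; omega
    · exact not_two_pow_of_fifteen s j (by omega)
  · omega
  · obtain ⟨j, _, rfl, i, _, rfl, l, _, rfl, rfl⟩ := hk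
    have := Nat.one_le_two_pow (n := j)
    have := Nat.one_le_two_pow (n := i)
    have := Nat.one_le_two_pow (n := l)
    -- The original exponent has become `s + 2`, and one factor 2 has been divided out.
    exact not_two_pow_add_add_of_fifteen (s + 1) j i l (by omega) (by omega)
  · omega

theorem inadmissible_of_degree {s : ℕ} (hs : 1 < s) {x : Mon 4} (h : x.degree = 15 * 2 ^ s - 5) :
    Inadmissible x := by
  apply inadmissible_of_mem
  refine Submodule.mem_sup_left (toP_mem_hit_of_not_isSumOfSpikes ?_)
  rw [degree_eq_weight_zero_add] at h
  exact not_isSumOfSpikes_of_degree hs (weight_le x 0) h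

theorem BDeg_eq_empty {s : ℕ} (hs : 1 < s) : BDeg 4 (15 * 2 ^ s - 5) = ∅ :=
  Set.eq_empty_of_forall_notMem fun _ hx => hx.1 (inadmissible_of_degree hs hx.2)

/-- A monomial whose exponents, after removal of the lowest `r` digits, satisfy Wood's criterion. -/
theorem inadmissible_of_not_isSumOfSpikes (r : ℕ) {x : Mon n} {e k : ℕ} (he : weight x r = e)
    (hk : (highDigits r x).degree = e + 2 * k) (h : ¬ IsSumOfSpikes e k) : Inadmissible x := by
  rw [← lowDigits_add r x]
  refine inadmissible_of_hit (lowDigits_lt r x) (toP_mem_hit_of_not_isSumOfSpikes ?_)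
  have h1 := degree_eq_weight_zero_add (highDigits r x)
  have h2 : weight (highDigits r x) 0 = e := by rw [weight_add_highDigits, add_zero, he]
  rw [h2] at h1 ⊢
  rwa [show (highDigits 1 (highDigits r x)).degree = k by omega]

end Vanishing

/-! ### Spike functionals and their values as products of minors -/

section Spikes

variable {n : ℕ}

/-- A lowest digit 1 in `b` would also be one in `a`, making the sum even. So `b` is even, `a` is
odd, and both can be halved. Together with Lucas this says that a nontrivial square never produces a
spike. -/
theorem eq_zero_of_add_eq_spike {j a b : ℕ} (h : a + b = 2 ^ j - 1)
    (hb : ∀ d, b.testBit d = true → a.testBit d = true) : b = 0 := by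
  induction j generalizing a b with
  | zero => simp at h; exact h.2
  | succ j ih =>
    have h1 := Nat.one_le_two_pow (n := j)
    rw [pow_succ] at h
    have h0 := hb 0
    simp only [Nat.testBit_zero, decide_eq_true_eq] at h0
    have := ih (a := a / 2) (b := b / 2) (by omega) fun d hd => by
      rw [← Nat.testBit_succ] at hd ⊢
      exact hb _ hd
    omega

/-- Spikes do not occur in hit polynomials. -/
theorem coeff_eq_zero_of_mem_hit {s : Mon n} (hs : ∀ i, ∃ j, s i = 2 ^ j - 1) {f : P n}
    (hf : f ∈ hit n) : f.coeff s = 0 := by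
  have : hit n ≤ LinearMap.ker (MvPolynomial.lcoeff (ZMod 2) s) := by
    rw [hit_eq_span, Submodule.span_le]
    rintro _ ⟨k, hk, x, rfl⟩
    refine Sq_toP_induction x _ fun b hb _ hodd => ?_
    rw [LinearMap.mem_ker, MvPolynomial.lcoeff_apply, coeff_toP, if_neg]
    intro h
    have hb0 : b = 0 := by
      ext i
      obtain ⟨j, hj⟩ := hs i
      exact eq_zero_of_add_eq_spike (a := x i) (by rw [← hj, ← h]; rfl)
        fun d => testBit_of_choose_odd (hodd i)
    simp [hb0] at hb
    omega
  exact this hf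

variable {r : ℕ}

/-- The linear form with the coefficients in the `j`-th column of the matrix with the rows `c`
(as bit masks). -/
noncomputable def linForm (c : ℕ → ℕ) (r : ℕ) (j : Fin n) : P r :=
  ∑ a ∈ univ.filter fun a : Fin r => (c a).testBit j = true, MvPolynomial.X a

/-- The linear substitution with the matrix `c`. -/
noncomputable def subst (n : ℕ) (c : ℕ → ℕ) (r : ℕ) : P n →ₐ[ZMod 2] P r :=
  MvPolynomial.aeval (linForm c r)

theorem subst_mem_hit (c : ℕ → ℕ) {f : P n} (hf : f ∈ hit n) : subst n c r f ∈ hit r := by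
  refine map_mem_hit _ (fun i => ?_) hf
  simp only [subst, MvPolynomial.aeval_X, linForm]
  exact totalSq_linearForm _ _

theorem subst_toP (c : ℕ → ℕ) (z : Mon n) :
    subst n c r z.toP = ∏ j, linForm c r j ^ z j := by
  rw [Mon.toP_eq_prod, map_prod]
  simp [subst]

/-- The monomial `x_1 ⋯ x_k`. -/
noncomputable def initMon (r k : ℕ) : Mon r :=
  Finsupp.equivFunOnFinite.symm fun a => if a.val < k then 1 else 0

theorem initMon_apply (k : ℕ) (a : Fin r) : initMon r k a = if a.val < k then 1 else 0 := rfl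

theorem initMon_succ (k : ℕ) (hk : k < r) :
    initMon r (k + 1) = initMon r k + Finsupp.single ⟨k, hk⟩ 1 := by
  classical
  ext a
  rw [Finsupp.add_apply, initMon_apply, initMon_apply, Finsupp.single_apply]
  have : (⟨k, hk⟩ : Fin r) = a ↔ a.val = k := by rw [Fin.ext_iff, eq_comm]
  simp only [this]
  split_ifs <;> omega

theorem degree_initMon {k : ℕ} (hk : k ≤ r) : (initMon r k).degree = k := by
  induction k with
  | zero =>
    rw [Finsupp.degree_eq_sum]
    exact sum_eq_zero fun a _ => rfl
  | succ k ih => rw [initMon_succ k hk, map_add, ih (by omega)]; simp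

/-- The minor of the first `k` rows of the matrix `c` and the columns in `S`. -/
def minor (c : ℕ → ℕ) : ℕ → Finset (Fin n) → ZMod 2
  | 0, S => if S = ∅ then 1 else 0
  | k + 1, S => ∑ j : Fin n, if (c k).testBit j = true ∧ j ∈ S then minor c k (S.erase j) else 0

theorem linForm_isHomogeneous (c : ℕ → ℕ) (j : Fin n) : (linForm c r j).IsHomogeneous 1 :=
  MvPolynomial.IsHomogeneous.sum _ _ _ fun a _ => MvPolynomial.isHomogeneous_X _ a

theorem prod_linForm_isHomogeneous (c : ℕ → ℕ) (S : Finset (Fin n)) :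
    (∏ j ∈ S, linForm c r j).IsHomogeneous S.card := by
  have := MvPolynomial.IsHomogeneous.prod S (linForm c r) (fun _ => 1)
    fun j _ => linForm_isHomogeneous c j
  simpa using this

theorem pderiv_linForm (c : ℕ → ℕ) (j : Fin n) (a : Fin r) :
    MvPolynomial.pderiv a (linForm c r j) = if (c a).testBit j = true then 1 else 0 := by
  classical
  rw [linForm, map_sum]
  simp only [MvPolynomial.pderiv_X, Pi.single_apply]
  rw [sum_ite_eq']
  simp

theorem pderiv_prod (a : Fin r) (S : Finset (Fin n)) (f : Fin n → P r) :
    MvPolynomial.pderiv a (∏ j ∈ S, f j) =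
      ∑ j ∈ S, MvPolynomial.pderiv a (f j) * ∏ i ∈ S.erase j, f i := by
  induction S using Finset.induction_on with
  | empty => simp
  | insert b S hb ih =>
    rw [prod_insert hb, Derivation.leibniz, ih, sum_insert hb, erase_insert hb, smul_eq_mul,
      smul_eq_mul, mul_sum, add_comm, mul_comm]
    congr 1
    refine sum_congr rfl fun j hj => ?_
    have hjb : j ≠ b := by rintro rfl; exact hb hj
    rw [erase_insert_of_ne hjb.symm, prod_insert (by simp [hb])]
    ring

/-- The coefficient of `x_1 ⋯ x_k` in a product of linear forms is a permanent, which modulo 2 is a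
determinant. Differentiating with respect to the last of these variables reproduces the Laplace
expansion along the last row. -/
theorem coeff_initMon_prod_linForm (c : ℕ → ℕ) {k : ℕ} (hk : k ≤ r) (S : Finset (Fin n)) :
    (∏ j ∈ S, linForm c r j).coeff (initMon r k) = minor c k S := by
  induction k generalizing S with
  | zero =>
    have h0 : initMon r 0 = 0 := by ext a; rfl
    rw [h0, minor]
    split_ifs with hS
    · simp [hS]
    · refine (prod_linForm_isHomogeneous c S).coeff_eq_zero ?_
      rw [map_zero, ne_eq, eq_comm, card_eq_zero]
      exact hS
  | succ k ih =>
    have h1 := MvPolynomial.coeff_pderiv (i := (⟨k, hk⟩ : Fin r))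
      (∏ j ∈ S, linForm c r j) (initMon r k)
    rw [← initMon_succ k hk, initMon_apply, if_neg (lt_irrefl k)] at h1
    simp only [Nat.cast_zero, zero_add, mul_one] at h1
    rw [← h1, pderiv_prod, MvPolynomial.coeff_sum, minor]
    simp only [pderiv_linForm]
    rw [← sum_filter_add_sum_filter_not univ (fun j => j ∈ S)]
    rw [sum_eq_zero (s := univ.filter fun j => ¬ j ∈ S), add_zero]
    · refine sum_congr (by ext; simp) fun j hj => ?_
      rw [← ih (by omega)]
      split_ifs <;> simp_all
    · intro j hj
      rw [if_neg]
      simp_all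

/-- `Q^2` is the sum of the squares `y^2` over the support of `Q`. If `y^2` contributes, then `y ≤
s` since the exponents of `s₀` are at most 1, and the cofactor in `q` has degree `deg s₀ + 2 deg(s -
y)`. As `e ≤ deg s₀`, only `y = s` and `e = deg s₀` remain. -/
theorem coeff_mul_sq {q Q : P r} {e : ℕ} (hq : q.IsHomogeneous e) {s₀ s : Mon r}
    (hs₀ : ∀ a, s₀ a ≤ 1) (he : e ≤ s₀.degree) :
    (q * Q ^ 2).coeff (s₀ + 2 • s) =
      if e = s₀.degree then q.coeff s₀ * Q.coeff s else 0 := by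
  have hQ : Q ^ 2 = ∑ y ∈ Q.support, MvPolynomial.monomial (2 • y) (1 : ZMod 2) := by
    conv_lhs => rw [eq_sum_toP Q, sum_pow_char 2]
    refine sum_congr rfl fun y _ => ?_
    rw [← Mon.toP_nsmul]; rfl
  have hle : ∀ y : Mon r, 2 • y ≤ s₀ + 2 • s → y ≤ s := fun y hy a => by
    have h1 := hy a
    have h2 := hs₀ a
    simp at h1
    omega
  have hterm : ∀ y : Mon r, y ≠ s →
      (q * MvPolynomial.monomial (2 • y) (1 : ZMod 2)).coeff (s₀ + 2 • s) = 0 := by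
    intro y hy
    rw [MvPolynomial.coeff_mul_monomial']
    split_ifs with hys
    · obtain ⟨t, rfl⟩ := exists_add_of_le (hle y hys)
      have : s₀ + 2 • (y + t) - 2 • y = s₀ + 2 • t := by
        ext a; simp; omega
      rw [this, mul_one]
      refine hq.coeff_eq_zero ?_
      have ht : t.degree ≠ 0 := by
        rw [ne_eq, Finsupp.degree_eq_zero_iff]
        rintro rfl
        exact hy (by simp)
      simp
      omega
    · rfl
  rw [hQ, mul_sum, MvPolynomial.coeff_sum]
  have hself : (q * MvPolynomial.monomial (2 • s) (1 : ZMod 2)).coeff (s₀ + 2 • s) =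
      q.coeff s₀ := by
    rw [MvPolynomial.coeff_mul_monomial, mul_one]
  have hsum : ∑ y ∈ Q.support, (q * MvPolynomial.monomial (2 • y) (1 : ZMod 2)).coeff (s₀ + 2 • s) =
      q.coeff s₀ * Q.coeff s := by
    by_cases hs : s ∈ Q.support
    · rw [sum_eq_single_of_mem s hs fun y _ hy => hterm y hy, hself]
      have : Q.coeff s = 1 := by
        have h := MvPolynomial.mem_support_iff.1 hs
        generalize Q.coeff s = c at h
        revert c; decide
      rw [this, mul_one]
    · rw [sum_eq_zero fun y hy => hterm y (by rintro rfl; exact hs hy),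
        MvPolynomial.notMem_support_iff.1 hs, mul_zero]
  rw [hsum]
  split_ifs with h
  · rfl
  · rw [hq.coeff_eq_zero (fun h' => h h'.symm), zero_mul]

/-- The spike whose weight vector is the (decreasing) list `ks`. -/
noncomputable def spikeMon (r : ℕ) : List ℕ → Mon r
  | [] => 0
  | k :: ks => initMon r k + 2 • spikeMon r ks

theorem spikeMon_apply_eq_zero {ks : List ℕ} {a : Fin r} (h : ∀ k ∈ ks, k ≤ a.val) :
    spikeMon r ks a = 0 := by
  induction ks with
  | nil => rfl
  | cons k ks ih =>
    rw [spikeMon, Finsupp.add_apply, initMon_apply, Finsupp.smul_apply,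
      ih fun l hl => h l (List.mem_cons_of_mem _ hl), if_neg]
    · rfl
    · exact not_lt.2 (h k List.mem_cons_self)

theorem spikeMon_isSpike {ks : List ℕ} (h : ks.Pairwise (· ≥ ·)) (a : Fin r) :
    ∃ j, spikeMon r ks a = 2 ^ j - 1 := by
  induction ks with
  | nil => exact ⟨0, rfl⟩
  | cons k ks ih =>
    rw [List.pairwise_cons] at h
    by_cases hk : a.val < k
    · obtain ⟨j, hj⟩ := ih h.2
      refine ⟨j + 1, ?_⟩
      rw [spikeMon, Finsupp.add_apply, initMon_apply, if_pos hk, Finsupp.smul_apply, hj, pow_succ,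
        smul_eq_mul]
      have := Nat.one_le_two_pow (n := j)
      omega
    · refine ⟨0, spikeMon_apply_eq_zero fun l hl => ?_⟩
      rcases List.mem_cons.1 hl with rfl | hl
      · omega
      · have := h.1 l hl; omega

/-- The coefficient of the spike with the weight vector `ks` after the substitution `c`. -/
noncomputable def spikeFunctional (n : ℕ) (c : ℕ → ℕ) (r : ℕ) (ks : List ℕ) :
    P n →ₗ[ZMod 2] ZMod 2 :=
  (MvPolynomial.lcoeff (ZMod 2) (spikeMon r ks)).comp (subst n c r).toLinearMap

theorem spikeFunctional_apply (c : ℕ → ℕ) (ks : List ℕ) (f : P n) :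
    spikeFunctional n c r ks f = (subst n c r f).coeff (spikeMon r ks) := rfl

theorem spikeFunctional_hit (c : ℕ → ℕ) {ks : List ℕ} (h : ks.Pairwise (· ≥ ·)) {f : P n}
    (hf : f ∈ hit n) : spikeFunctional n c r ks f = 0 :=
  coeff_eq_zero_of_mem_hit (spikeMon_isSpike h) (subst_mem_hit c hf)

/-- The set of variables whose exponent has the `d`-th binary digit `1`. -/
def slice (z : Mon n) (d : ℕ) : Finset (Fin n) := univ.filter fun j => (z j).testBit d = true

theorem slice_succ (z : Mon n) (d : ℕ) : slice z (d + 1) = slice (highDigits 1 z) d := by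
  ext j
  simp [slice, Nat.testBit_succ]

/-- Splitting off the lowest digits writes the substituted monomial as (product of linear forms)
times (square), to which `coeff_mul_sq` applies. The functional is thus multiplicative along digit
positions as long as the weight does not exceed that of the spike. -/
theorem spikeFunctional_cons (c : ℕ → ℕ) {k : ℕ} (hk : k ≤ r) (ks : List ℕ) {z : Mon n}
    (hz : weight z 0 ≤ k) : spikeFunctional n c r (k :: ks) z.toP =
      if weight z 0 = k then
        minor c k (slice z 0) * spikeFunctional n c r ks (highDigits 1 z).toP else 0 := by
  have h1 : subst n c r z.toP =
      (∏ j ∈ slice z 0, linForm c r j) * (subst n c r (highDigits 1 z).toP) ^ 2 := by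
    rw [subst_toP, subst_toP, ← prod_pow, slice, prod_filter, ← prod_mul_distrib]
    refine prod_congr rfl fun j _ => ?_
    rw [← pow_mul, highDigits_apply, Nat.testBit_zero]
    have h2 := Nat.mod_add_div (z j) 2
    rcases Nat.mod_two_eq_zero_or_one (z j) with h | h
    · rw [h] at h2 ⊢
      simp
      congr 1
      omega
    · rw [h] at h2 ⊢
      simp
      rw [← pow_succ']
      congr 1
      omega
  rw [spikeFunctional_apply, h1, spikeMon, coeff_mul_sq (prod_linForm_isHomogeneous c _),
    degree_initMon hk, coeff_initMon_prod_linForm c hk]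
  · rfl
  · intro a
    rw [initMon_apply]
    split_ifs <;> omega
  · rwa [degree_initMon hk]

/-- At the first position where the weight of `z` is too small, there are too few linear forms to
produce the required squarefree monomial. -/
theorem spikeFunctional_eq_zero (c : ℕ → ℕ) {ks : List ℕ} (hks : ∀ k ∈ ks, k ≤ r) {z : Mon n}
    {j : ℕ} (h1 : ∀ d < j, weight z d = ks.getD d 0) (h2 : weight z j < ks.getD j 0) :
    spikeFunctional n c r ks z.toP = 0 := by
  induction ks generalizing z j with
  | nil => simp at h2
  | cons k ks ih =>
    have hk := hks k List.mem_cons_self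
    cases j with
    | zero =>
      simp only [List.getD_cons_zero] at h2
      rw [spikeFunctional_cons c hk ks h2.le, if_neg h2.ne]
    | succ j =>
      have h0 := h1 0 (by omega)
      simp only [List.getD_cons_zero] at h0
      rw [spikeFunctional_cons c hk ks h0.le, if_pos h0,
        ih (fun l hl => hks l (List.mem_cons_of_mem _ hl)) (j := j), mul_zero]
      · intro d hd
        rw [weight_add_highDigits, add_comm, h1 (d + 1) (by omega), List.getD_cons_succ]
      · rwa [weight_add_highDigits, add_comm, ← List.getD_cons_succ (x := k)]

/-- The product of the minors of the first `k_d` rows and the columns in the `d`-th slice. -/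
def minorProd (c : ℕ → ℕ) : List ℕ → List (Finset (Fin n)) → ZMod 2
  | k :: ks, S :: l => minor c k S * minorProd c ks l
  | _, _ => 1

/-- The first `m` slices. -/
def slices (z : Mon n) (m : ℕ) : List (Finset (Fin n)) := (List.range m).map (slice z)

theorem slices_succ (z : Mon n) (m : ℕ) :
    slices z (m + 1) = slice z 0 :: slices (highDigits 1 z) m := by
  simp only [slices, List.range_succ_eq_map, List.map_cons, List.map_map]
  congr 1
  exact List.map_congr_left fun d _ => slice_succ z d

theorem spikeFunctional_eq_minorProd (c : ℕ → ℕ) {ks : List ℕ} (hks : ∀ k ∈ ks, k ≤ r) {z : Mon n}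
    (h : ∀ d, weight z d = ks.getD d 0) :
    spikeFunctional n c r ks z.toP = minorProd c ks (slices z ks.length) := by
  induction ks generalizing z with
  | nil =>
    have hz : z = 0 := by
      ext i
      refine Nat.eq_of_testBit_eq fun d => ?_
      have := h d
      rw [List.getD_nil, weight_apply, card_eq_zero, filter_eq_empty_iff] at this
      simpa using this (mem_univ i)
    subst hz
    simp [spikeFunctional_apply, spikeMon, minorProd]
  | cons k ks ih =>
    have h0 := h 0
    simp only [List.getD_cons_zero] at h0
    rw [spikeFunctional_cons c (hks k List.mem_cons_self) ks h0.le, if_pos h0, List.length_cons,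
      slices_succ, minorProd, ih fun l hl => hks l (List.mem_cons_of_mem _ hl)]
    intro d
    rw [weight_add_highDigits, add_comm, h, List.getD_cons_succ]

end Spikes

/-! ### Predicates on products of finite lists as binary numbers -/

section BitVectors

/-- The product of the lengths. -/
def width : List (List ℕ) → ℕ
  | [] => 1
  | C :: Cs => C.length * width Cs

/-- A predicate on the lists `l` with `l_i ∈ C_i`, as a vector of bits. -/
def encode : List (List ℕ) → (List ℕ → Bool) → ℕ
  | [], p => (p []).toNat
  | C :: Cs, p => C.foldr (fun a acc => encode Cs (fun l => p (a :: l)) + 2 ^ width Cs * acc) 0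

theorem foldr_lt {α : Type*} {w : ℕ} (f : α → ℕ) (hf : ∀ a, f a < 2 ^ w) (C : List α) :
    C.foldr (fun a acc => f a + 2 ^ w * acc) 0 < 2 ^ (C.length * w) := by
  induction C with
  | nil => simp
  | cons a C ih =>
    rw [List.foldr_cons, List.length_cons, Nat.succ_mul, pow_add]
    have := hf a
    calc _ < 2 ^ w + 2 ^ w * C.foldr (fun a acc => f a + 2 ^ w * acc) 0 := by omega
      _ = 2 ^ w * (C.foldr (fun a acc => f a + 2 ^ w * acc) 0 + 1) := by ring
      _ ≤ 2 ^ w * 2 ^ (C.length * w) := Nat.mul_le_mul_left _ ih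
      _ = _ := mul_comm _ _

theorem encode_lt (Cs : List (List ℕ)) (p : List ℕ → Bool) : encode Cs p < 2 ^ width Cs := by
  induction Cs generalizing p with
  | nil => simp only [encode, width]; cases p [] <;> simp
  | cons C Cs ih => exact foldr_lt _ (fun a => ih _) C

theorem bitwise_add_two_pow {f : Bool → Bool → Bool} (hf : f false false = false) {w x x' : ℕ}
    (hx : x < 2 ^ w) (hx' : x' < 2 ^ w) (y y' : ℕ) :
    Nat.bitwise f (x + 2 ^ w * y) (x' + 2 ^ w * y') =
      Nat.bitwise f x x' + 2 ^ w * Nat.bitwise f y y' := by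
  have hlt : Nat.bitwise f x x' < 2 ^ w := Nat.bitwise_lt_two_pow hx hx'
  refine Nat.eq_of_testBit_eq fun d => ?_
  rw [Nat.testBit_bitwise hf, testBit_add_two_pow_mul_of_lt hx, testBit_add_two_pow_mul_of_lt hx',
    testBit_add_two_pow_mul_of_lt hlt]
  split_ifs <;> rw [Nat.testBit_bitwise hf]

/-- One bitwise operation on numbers replaces a loop over all lists; `hf` keeps the digits outside
the encoded range zero. -/
theorem bitwise_encode {f : Bool → Bool → Bool} (hf : f false false = false) (Cs : List (List ℕ))
    (p q : List ℕ → Bool) :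
    Nat.bitwise f (encode Cs p) (encode Cs q) = encode Cs fun l => f (p l) (q l) := by
  induction Cs generalizing p q with
  | nil =>
    simp only [encode]
    refine Nat.eq_of_testBit_eq fun d => ?_
    rw [Nat.testBit_bitwise hf]
    have h : ∀ b : Bool, b.toNat.testBit d = (b && decide (d = 0)) := by
      intro b
      cases b
      · simp
      · cases d with
        | zero => rfl
        | succ d => simp [Nat.testBit_succ]
    rw [h, h, h]
    by_cases hd : d = 0 <;> simp [hd, hf]
  | cons C Cs ih =>
    simp only [encode]
    induction C with
    | nil => simp
    | cons a C ihC =>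
      simp only [List.foldr_cons]
      rw [bitwise_add_two_pow hf (encode_lt _ _) (encode_lt _ _), ih, ihC]

theorem land_encode (Cs : List (List ℕ)) (p q : List ℕ → Bool) :
    Nat.land (encode Cs p) (encode Cs q) = encode Cs fun l => p l && q l :=
  bitwise_encode rfl Cs p q

theorem lor_encode (Cs : List (List ℕ)) (p q : List ℕ → Bool) :
    Nat.lor (encode Cs p) (encode Cs q) = encode Cs fun l => p l || q l :=
  bitwise_encode rfl Cs p q

theorem xor_encode (Cs : List (List ℕ)) (p q : List ℕ → Bool) :
    Nat.xor (encode Cs p) (encode Cs q) = encode Cs fun l => xor (p l) (q l) :=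
  bitwise_encode rfl Cs p q

theorem foldr_eq_zero {α : Type*} {w : ℕ} (f : α → ℕ) (C : List α) :
    C.foldr (fun a acc => f a + 2 ^ w * acc) 0 = 0 ↔ ∀ a ∈ C, f a = 0 := by
  induction C with
  | nil => simp
  | cons a C ih => simp [ih]

theorem encode_eq_zero (Cs : List (List ℕ)) (p : List ℕ → Bool) :
    encode Cs p = 0 ↔ ∀ l, List.Forall₂ (· ∈ ·) l Cs → p l = false := by
  induction Cs generalizing p with
  | nil => simp [encode]
  | cons C Cs ih =>
    simp only [encode, foldr_eq_zero, ih, List.forall₂_cons_right_iff]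
    constructor
    · rintro h _ ⟨a, l, ha, hl, rfl⟩
      exact h a ha l hl
    · intro h a ha l hl
      exact h _ ⟨a, l, ha, hl, rfl⟩

theorem encode_congr {Cs : List (List ℕ)} {p q : List ℕ → Bool}
    (h : ∀ l, List.Forall₂ (· ∈ ·) l Cs → p l = q l) : encode Cs p = encode Cs q := by
  have h0 : Nat.xor (encode Cs p) (encode Cs q) = 0 := by
    rw [xor_encode, encode_eq_zero]
    intro l hl
    simp [h l hl]
  exact Nat.xor_eq_zero_iff.1 h0

/-- `v_i` has the bit `l_i` for all `i`. -/
def hasBits : List ℕ → List ℕ → Bool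
  | v :: vs, a :: l => v.testBit a && hasBits vs l
  | _, _ => true

/-- The bit vector with the bits `v_a`, `a ∈ C`, at the distance `log w`. -/
def spread (v w : ℕ) : List ℕ → ℕ
  | [] => 0
  | a :: C => Nat.add (Nat.land (Nat.shiftRight v a) 1) (Nat.mul (spread v w C) w)

/-- The bit vector of `hasBits`. -/
def tensor : List ℕ → List (List ℕ) → List ℕ → ℕ
  | v :: vs, C :: Cs, w :: ws => Nat.mul (tensor vs Cs ws) (spread v w C)
  | _, _, _ => 1

/-- The widths for `tensor`. -/
def widths : List (List ℕ) → List ℕ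
  | [] => []
  | _ :: Cs => 2 ^ width Cs :: widths Cs

/-- The bit vector of a product predicate is a product of integers: `spread` has only digits 0 and 1
in the base `2^(width Cs)`, so multiplying it by the smaller number for the remaining factors just
places copies of that number, without carries. -/
theorem tensor_eq_encode {vs : List ℕ} {Cs : List (List ℕ)} (h : vs.length = Cs.length) :
    tensor vs Cs (widths Cs) = encode Cs (hasBits vs) := by
  induction Cs generalizing vs with
  | nil =>
    rw [List.length_nil, List.length_eq_zero_iff] at h
    subst h
    rfl
  | cons C Cs ih =>
    obtain ⟨v, vs, rfl⟩ := List.exists_cons_of_length_eq_add_one h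
    simp only [List.length_cons, Nat.add_right_cancel_iff] at h
    simp only [widths, tensor, encode, hasBits]
    rw [ih h]
    induction C with
    | nil => rfl
    | cons a C ihC =>
      rw [spread, List.foldr_cons, ← ihC]
      have hbit : Nat.land (Nat.shiftRight v a) 1 = (v.testBit a).toNat := by
        change (v >>> a) &&& 1 = _
        rw [Nat.testBit, Nat.and_comm 1, Nat.and_one_is_mod]
        rcases Nat.mod_two_eq_zero_or_one (v >>> a) with h | h <;> rw [h] <;> rfl
      have hz : encode Cs (fun l => v.testBit a && hasBits vs l) =
          (v.testBit a).toNat * encode Cs (hasBits vs) := by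
        cases v.testBit a
        · simp [encode_eq_zero]
        · simp
      rw [hbit, hz]
      simp only [Nat.mul_eq, Nat.add_eq]
      ring

/-- Evaluates a number before it is used. -/
def force {α : Type} (n : ℕ) (k : ℕ → α) : α := Nat.rec (k 0) (fun m _ => k (Nat.succ m)) n

theorem force_eq {α : Type} (n : ℕ) (k : ℕ → α) : force n k = k n := by cases n <;> rfl

/-- Evaluates a list of numbers before it is used. -/
def forceList {α : Type} : List ℕ → (List ℕ → α) → α
  | [], k => k []
  | a :: l, k => force a fun a => forceList l fun l => k (a :: l)

theorem forceList_eq {α : Type} (l : List ℕ) (k : List ℕ → α) : forceList l k = k l := by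
  induction l generalizing k with
  | nil => rfl
  | cons a l ih => rw [forceList, force_eq, ih]

end BitVectors

/-! ### Minors as coordinates in the exterior algebra on five generators -/

section Wedge

/-- A set of variables as a bit mask. -/
def maskOf (S : Finset (Fin 5)) : ℕ := ∑ j ∈ S, 2 ^ j.val

/-- The bit masks of the sets with `k` elements. -/
def subsetMasks : ℕ → List ℕ
  | 0 => [0]
  | 1 => [1, 2, 4, 8, 16]
  | 2 => [3, 5, 6, 9, 10, 12, 17, 18, 20, 24]
  | 3 => [7, 11, 13, 14, 19, 21, 22, 25, 26, 28]
  | 4 => [15, 23, 27, 29, 30]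
  | 5 => [31]
  | _ => []

/-- The number whose bits `T < 32` tell whether `T` does not have the bit `j`. -/
def coMask : ℕ → ℕ
  | 0 => 0x55555555
  | 1 => 0x33333333
  | 2 => 0x0f0f0f0f
  | 3 => 0x00ff00ff
  | 4 => 0x0000ffff
  | _ => 0xffffffff

theorem maskOf_mem (S : Finset (Fin 5)) : maskOf S ∈ subsetMasks S.card := by
  revert S; decide +kernel

theorem lt_of_mem_subsetMasks {k T : ℕ} (h : T ∈ subsetMasks k) : T < 32 := by
  have key : ∀ k < 6, ∀ T ∈ subsetMasks k, T < 32 := by decide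
  by_cases hk : k < 6
  · exact key k hk T h
  · obtain ⟨k, rfl⟩ := Nat.exists_eq_add_of_le (not_lt.1 hk)
    rw [add_comm] at h
    simp [subsetMasks] at h

theorem testBit_maskOf (S : Finset (Fin 5)) (j : Fin 5) :
    (maskOf S).testBit j = decide (j ∈ S) := by
  revert S j; decide +kernel

/-- Subtracting `2^j` from a mask removes `j` from the set. If `j` is absent, either the subtraction
is impossible or the borrow creates the bit `j`, which `coMask j` then rejects. So a masked shift
never moves a coordinate to a wrong place. -/
theorem maskOf_erase (S : Finset (Fin 5)) (j : Fin 5) :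
    (j ∈ S ∧ 2 ^ j.val ≤ maskOf S ∧ maskOf S - 2 ^ j.val = maskOf (S.erase j) ∧
        (coMask j).testBit (maskOf S - 2 ^ j.val) = true) ∨
      (j ∉ S ∧ (maskOf S < 2 ^ j.val ∨ (coMask j).testBit (maskOf S - 2 ^ j.val) = false)) := by
  revert S j; decide +kernel

theorem testBit_coMask {j T : ℕ} (hj : j < 5) (hT : T < 32) :
    (coMask j).testBit T = !T.testBit j := by
  have key : ∀ j < 5, ∀ T < 32, (coMask j).testBit T = !T.testBit j := by decide +kernel
  exact key j hj T hT

theorem testBit_coMask_five {T : ℕ} (hT : T < 32) : (coMask 5).testBit T = true := by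
  have key : ∀ T < 32, (coMask 5).testBit T = true := by decide +kernel
  exact key T hT

/-- A summand of `wedge`. -/
def wedgeTerm (a v p m : ℕ) : ℕ :=
  Nat.shiftLeft (Nat.mul (Nat.land v m) (Nat.mod (Nat.div a p) 2)) p

/-- The product of the linear form `a` and the element `v` of the exterior algebra. -/
def wedge (a v : ℕ) : ℕ :=
  Nat.xor (wedgeTerm a v 1 0x55555555) (Nat.xor (wedgeTerm a v 2 0x33333333)
    (Nat.xor (wedgeTerm a v 4 0x0f0f0f0f) (Nat.xor (wedgeTerm a v 8 0x00ff00ff)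
      (wedgeTerm a v 16 0x0000ffff))))

/-- Multiplication by the `j`-th generator: keep the coordinates without `j`, and shift by `2^j`
positions so that the coordinate of `T` moves to that of `T ∪ {j}`. -/
theorem testBit_wedgeTerm (a v : ℕ) (j : Fin 5) (S : Finset (Fin 5)) :
    (wedgeTerm a v (2 ^ j.val) (coMask j)).testBit (maskOf S) =
      (decide (a.testBit j = true ∧ j ∈ S) && v.testBit (maskOf (S.erase j))) := by
  change (((v &&& coMask j) * (a / 2 ^ j.val % 2)) <<< 2 ^ j.val).testBit (maskOf S) = _
  rw [Nat.testBit_shiftLeft, Nat.testBit_eq_decide_div_mod_eq (x := a)]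
  rcases Nat.mod_two_eq_zero_or_one (a / 2 ^ j.val) with h | h
  · simp [h]
  · rw [h, mul_one, Nat.testBit_and]
    rcases maskOf_erase S j with ⟨h1, h2, h3, h4⟩ | ⟨h1, h2 | h2⟩
    · rw [h3] at h4 ⊢
      simp [h1, h2, h4]
    · simp [h1, h2]
    · simp [h1, h2]

/-- The matrix with the rows coded by the base 32 digits of `code`. -/
def codeRows (code k : ℕ) : ℕ := code / 32 ^ k % 32

/-- The product of the first `k` rows in the exterior algebra. -/
def rowWedge (code : ℕ) : ℕ → ℕ
  | 0 => 1
  | k + 1 => wedge (codeRows code k) (rowWedge code k)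

theorem xor_toZMod (a b : Bool) : (if xor a b = true then (1 : ZMod 2) else 0) =
    (if a = true then 1 else 0) + if b = true then 1 else 0 := by
  revert a b; decide

/-- The coordinates of a wedge product of rows are the minors; wedging with one more row is the
Laplace expansion along it, with no signs modulo 2. -/
theorem minor_eq (code k : ℕ) (S : Finset (Fin 5)) :
    minor (codeRows code) k S = if (rowWedge code k).testBit (maskOf S) = true then 1 else 0 := by
  induction k generalizing S with
  | zero =>
    have key : ∀ S : Finset (Fin 5), (if S = ∅ then (1 : ZMod 2) else 0) =
        if Nat.testBit 1 (maskOf S) = true then 1 else 0 := by decide +kernel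
    exact key S
  | succ k ih =>
    have h := testBit_wedgeTerm (codeRows code k) (rowWedge code k)
    have h' : (rowWedge code (k + 1)).testBit (maskOf S) =
        xor ((wedgeTerm (codeRows code k) (rowWedge code k) (2 ^ (0 : Fin 5).val)
          (coMask (0 : Fin 5))).testBit (maskOf S))
        (xor ((wedgeTerm (codeRows code k) (rowWedge code k) (2 ^ (1 : Fin 5).val)
          (coMask (1 : Fin 5))).testBit (maskOf S))
        (xor ((wedgeTerm (codeRows code k) (rowWedge code k) (2 ^ (2 : Fin 5).val)
          (coMask (2 : Fin 5))).testBit (maskOf S))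
        (xor ((wedgeTerm (codeRows code k) (rowWedge code k) (2 ^ (3 : Fin 5).val)
          (coMask (3 : Fin 5))).testBit (maskOf S))
        ((wedgeTerm (codeRows code k) (rowWedge code k) (2 ^ (4 : Fin 5).val)
          (coMask (4 : Fin 5))).testBit (maskOf S))))) := by
      rw [← Nat.testBit_xor, ← Nat.testBit_xor, ← Nat.testBit_xor, ← Nat.testBit_xor]
      rfl
    rw [h']
    simp only [xor_toZMod, h, minor, Fin.sum_univ_five, ih, Bool.and_eq_true, decide_eq_true_eq,
      ite_and, add_assoc]

theorem minorProd_eq (code : ℕ) (ks : List ℕ) (l : List (Finset (Fin 5))) :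
    minorProd (codeRows code) ks l =
      if hasBits (ks.map (rowWedge code)) (l.map maskOf) = true then 1 else 0 := by
  induction ks generalizing l with
  | nil => simp [minorProd, hasBits]
  | cons k ks ih =>
    cases l with
    | nil => simp [minorProd, hasBits]
    | cons S l =>
      simp only [minorProd, List.map_cons, hasBits, minor_eq, ih, Bool.and_eq_true, ite_and]
      split_ifs <;> simp

end Wedge

/-! ### Monomials as lists of exponents -/

section Lists

variable {n : ℕ}

/-- The list of exponents. -/
def exps (x : Mon n) : List ℕ := List.ofFn x

theorem exps_injective : Function.Injective (exps (n := n)) := fun _ _ h =>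
  DFunLike.coe_injective (List.ofFn_injective h)

theorem length_exps (x : Mon n) : (exps x).length = n := List.length_ofFn

theorem getD_exps (x : Mon n) (i : Fin n) : (exps x).getD i 0 = x i := by
  simp [exps]

theorem sum_map_exps (x : Mon n) (f : ℕ → ℕ) : ((exps x).map f).sum = ∑ i, f (x i) := by
  rw [exps, List.map_ofFn, List.sum_ofFn]
  rfl

/-- Whether `ks` is the weight vector of the monomial with the exponents `l`. -/
def hasWeight (ks l : List ℕ) : Bool :=
  l.all (fun a => Nat.blt a (2 ^ ks.length)) &&
    (List.range ks.length).map (fun d => (l.map fun a => (a.testBit d).toNat).sum) == ks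

theorem weight_of_hasWeight {ks : List ℕ} {x : Mon n} (h : hasWeight ks (exps x) = true) (d : ℕ) :
    weight x d = ks.getD d 0 := by
  simp only [hasWeight, Bool.and_eq_true, List.all_eq_true, beq_iff_eq, Nat.blt_eq] at h
  obtain ⟨h1, h2⟩ := h
  have hw : weight x d = ((exps x).map fun a => (a.testBit d).toNat).sum := by
    rw [sum_map_exps, weight_apply, card_filter]
    refine sum_congr rfl fun i _ => ?_
    cases (x i).testBit d <;> rfl
  by_cases hd : d < ks.length
  · rw [hw]
    conv_rhs => rw [← h2]
    simp [hd]
  · rw [List.getD_eq_default _ _ (not_lt.1 hd)]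
    by_contra h0
    exact hd (lt_of_weight_pos (fun i => h1 _ (List.mem_ofFn.2 ⟨i, rfl⟩)) (Nat.pos_of_ne_zero h0))

end Lists

/-! ### Checking certificates of admissibility -/

section Certificates

/-- The products of the first rows, evaluated before they are used. -/
def forceWedges {α : Type} : ℕ → ℕ → ℕ → (List ℕ → α) → α
  | 0, _, v, k => k [v]
  | r + 1, code, v, k => force (wedge (Nat.mod code 32) v) fun w =>
      forceWedges r (Nat.div code 32) w fun l => k (v :: l)

theorem forceWedges_eq {α : Type} (r code q : ℕ) (k : List ℕ → α) :
    forceWedges r (code / 32 ^ q) (rowWedge code q) k =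
      k ((List.range (r + 1)).map fun i => rowWedge code (q + i)) := by
  induction r generalizing q k with
  | zero => rfl
  | succ r ih =>
    have h1 : Nat.div (code / 32 ^ q) 32 = code / 32 ^ (q + 1) := by
      rw [pow_succ, ← Nat.div_div_eq_div_mul]; rfl
    have h2 : wedge (Nat.mod (code / 32 ^ q) 32) (rowWedge code q) = rowWedge code (q + 1) := rfl
    rw [forceWedges, force_eq, h1, h2, ih, List.range_succ_eq_map (n := r + 1), List.map_cons,
      List.map_map]
    congr 2
    refine List.map_congr_left fun i _ => ?_
    simp only [Function.comp_apply]
    congr 1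
    omega

/-- The values of a spike functional on all monomials with the weight vector `ks`. -/
def flagVec (ks : List ℕ) (Cs : List (List ℕ)) (ws : List ℕ) (r code : ℕ) : ℕ :=
  forceWedges r code 1 fun Ws => forceList (ks.map fun k => Ws.getD k 0) fun vs => tensor vs Cs ws

theorem flagVec_eq {ks : List ℕ} {Cs : List (List ℕ)} (hlen : ks.length = Cs.length) {r : ℕ}
    (hr : ∀ k ∈ ks, k ≤ r) (code : ℕ) :
    flagVec ks Cs (widths Cs) r code = encode Cs (hasBits (ks.map (rowWedge code))) := by
  have h := forceWedges_eq r code 0 fun Ws => forceList (ks.map fun k => Ws.getD k 0) fun vs =>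
    tensor vs Cs (widths Cs)
  rw [pow_zero, Nat.div_one] at h
  have h' : ks.map (fun k => ((List.range (r + 1)).map fun i => rowWedge code (0 + i)).getD k 0) =
      ks.map (rowWedge code) := by
    refine List.map_congr_left fun k hk => ?_
    have := hr k hk
    simp [List.getD, show k < r + 1 by omega]
  rw [flagVec, show (1 : ℕ) = rowWedge code 0 from rfl, h, forceList_eq, h',
    tensor_eq_encode (by simpa using hlen)]

/-- The values of a sum of spike functionals. -/
def flagSum (ks : List ℕ) (Cs : List (List ℕ)) (ws : List ℕ) (r : ℕ) (F : List ℕ) : ℕ :=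
  F.foldr (fun code acc => Nat.xor (flagVec ks Cs ws r code) acc) 0

/-- The values of a sum of spike functionals, on a list of slices. -/
def flagBit (ks F l : List ℕ) : Bool :=
  F.foldr (fun code acc => xor (hasBits (ks.map (rowWedge code)) l) acc) false

theorem flagSum_eq {ks : List ℕ} {Cs : List (List ℕ)} (hlen : ks.length = Cs.length) {r : ℕ}
    (hr : ∀ k ∈ ks, k ≤ r) (F : List ℕ) :
    flagSum ks Cs (widths Cs) r F = encode Cs (flagBit ks F) := by
  induction F with
  | nil =>
    symm
    rw [flagSum, List.foldr_nil, encode_eq_zero]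
    intro l _
    rfl
  | cons code F ih =>
    rw [flagSum, List.foldr_cons, ← flagSum, ih, flagVec_eq hlen hr, xor_encode]
    rfl

/-- Lexicographical comparison of two sequences of bits; `init` is the result if they agree. -/
def bitLess {ι : Type} (f g : ι → Bool) (init : Bool) : List ι → Bool
  | [] => init
  | i :: is => bif g i then !f i || bitLess f g init is else !f i && bitLess f g init is

/-- The bit vector of `bitLess`. -/
def lessVec (init : ℕ) : List ℕ → List Bool → ℕ
  | N :: Ns, b :: bs =>
      bif b then Nat.lor N (lessVec init Ns bs) else Nat.land N (lessVec init Ns bs)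
  | _, _ => init

theorem lessVec_eq {ι : Type} (Cs : List (List ℕ)) (f : ι → List ℕ → Bool) (g : ι → Bool)
    (init : Bool) (is : List ι) :
    lessVec (encode Cs fun _ => init) (is.map fun i => encode Cs fun l => !f i l) (is.map g) =
      encode Cs fun l => bitLess (fun i => f i l) g init is := by
  induction is with
  | nil => rfl
  | cons i is ih =>
    simp only [List.map_cons, lessVec, ih, bitLess]
    cases g i
    · exact land_encode _ _ _
    · exact lor_encode _ _ _

/-- The non-strict comparison is the strict one or agreement at every position. -/
theorem bitLess_true {ι : Type} {f g : ι → Bool} {is : List ι} (h : bitLess f g true is = true) :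
    bitLess f g false is = true ∨ ∀ i ∈ is, f i = g i := by
  induction is with
  | nil => simp
  | cons i is ih =>
    simp only [bitLess] at h ⊢
    cases hg : g i <;> cases hf : f i <;> simp_all

/-- The digits of the exponents, with the most significant ones first. -/
def digitPositions (m : ℕ) : List (ℕ × ℕ) :=
  (List.range 5).flatMap fun j => (List.range m).reverse.map fun d => (j, d)

theorem mod_two_pow_succ (a m : ℕ) :
    a % 2 ^ (m + 1) = a % 2 ^ m + 2 ^ m * (a.testBit m).toNat := by
  rw [Nat.mod_pow_succ, Nat.testBit_eq_decide_div_mod_eq]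
  rcases Nat.mod_two_eq_zero_or_one (a / 2 ^ m) with h | h <;> simp [h]

/-- Reading the lowest `m` digits of one exponent from the top compares the residues modulo `2^m`: a
strict inequality decides, and equality passes on to the later exponents. -/
theorem bitLess_block (x y : List ℕ) (init : Bool) (j m : ℕ) (rest : List (ℕ × ℕ)) :
    let f := fun (i : ℕ × ℕ) => (x.getD i.1 0).testBit i.2
    let g := fun (i : ℕ × ℕ) => (y.getD i.1 0).testBit i.2
    (x.getD j 0 % 2 ^ m = y.getD j 0 % 2 ^ m →
      bitLess f g init ((List.range m).reverse.map (fun d => (j, d)) ++ rest) =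
        bitLess f g init rest) ∧
    (x.getD j 0 % 2 ^ m < y.getD j 0 % 2 ^ m →
      bitLess f g init ((List.range m).reverse.map (fun d => (j, d)) ++ rest) = true) := by
  intro f g
  induction m with
  | zero => simp [Nat.mod_one]
  | succ m ih =>
    rw [List.range_succ, List.reverse_append, List.reverse_singleton, List.singleton_append,
      List.map_cons, List.cons_append, bitLess]
    have hx := mod_two_pow_succ (x.getD j 0) m
    have hy := mod_two_pow_succ (y.getD j 0) m
    have hxl : x.getD j 0 % 2 ^ m < 2 ^ m := Nat.mod_lt _ (by positivity)
    have hyl : y.getD j 0 % 2 ^ m < 2 ^ m := Nat.mod_lt _ (by positivity)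
    change (_ → (bif (y.getD j 0).testBit m then !(x.getD j 0).testBit m || _ else _) = _) ∧
      (_ → (bif (y.getD j 0).testBit m then !(x.getD j 0).testBit m || _ else _) = _)
    rw [hx, hy]
    change (_ → (bif (y.getD j 0).testBit m then !(x.getD j 0).testBit m || _ else
      !(x.getD j 0).testBit m && _) = _) ∧
      (_ → (bif (y.getD j 0).testBit m then !(x.getD j 0).testBit m || _ else
      !(x.getD j 0).testBit m && _) = _)
    cases (x.getD j 0).testBit m <;> cases (y.getD j 0).testBit m <;>
      simp only [Bool.toNat_true, Bool.toNat_false, mul_one, mul_zero, add_zero, cond_true,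
        cond_false, Bool.not_true, Bool.not_false, Bool.true_or, Bool.false_or, Bool.true_and,
        Bool.false_and]
    · exact ⟨fun h => ih.1 (by omega), fun h => ih.2 (by omega)⟩
    · exact ⟨fun h => by omega, fun _ => trivial⟩
    · exact ⟨fun h => by omega, fun h => by omega⟩
    · exact ⟨fun h => ih.1 (by omega), fun h => ih.2 (by omega)⟩

theorem bitLess_of_lex {x y : Mon 5} {m : ℕ} (hx : ∀ i, x i < 2 ^ m) (hy : ∀ i, y i < 2 ^ m)
    {i : Fin 5} (h : ∀ d < i, x d = y d) (hlt : x i < y i) (init : Bool) :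
    bitLess (fun i : ℕ × ℕ => ((exps x).getD i.1 0).testBit i.2)
      (fun i => ((exps y).getD i.1 0).testBit i.2) init (digitPositions m) = true := by
  have heq : ∀ d : Fin 5, d < i → ∀ rest, _ := fun d hd rest =>
    (bitLess_block (exps x) (exps y) init d m rest).1
      (by rw [getD_exps, getD_exps, h d hd])
  have hl := fun rest => (bitLess_block (exps x) (exps y) init i m rest).2
    (by rw [getD_exps, getD_exps, Nat.mod_eq_of_lt (hx i), Nat.mod_eq_of_lt (hy i)]; exact hlt)
  simp only [digitPositions, show List.range 5 = [0, 1, 2, 3, 4] from rfl, List.flatMap_cons]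
  fin_cases i
  · exact hl _
  · exact (heq 0 (by decide) _).trans (hl _)
  · exact ((heq 0 (by decide) _).trans (heq 1 (by decide) _)).trans (hl _)
  · exact (((heq 0 (by decide) _).trans (heq 1 (by decide) _)).trans (heq 2 (by decide) _)).trans
      (hl _)
  · exact ((((heq 0 (by decide) _).trans (heq 1 (by decide) _)).trans
      (heq 2 (by decide) _)).trans (heq 3 (by decide) _)).trans (hl _)

/-- The bit vector of the monomials whose `j`-th exponent has the `d`-th digit `0`. -/
def zeroDigit (Cs : List (List ℕ)) (ws : List ℕ) (m : ℕ) (i : ℕ × ℕ) : ℕ :=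
  tensor ((List.range m).map fun d => bif Nat.beq d i.2 then coMask i.1 else coMask 5) Cs ws

theorem forall₂_getD {l : List ℕ} {Cs : List (List ℕ)} (h : List.Forall₂ (· ∈ ·) l Cs) {d : ℕ}
    (hd : d < Cs.length) : l.getD d 0 ∈ Cs.getD d [] := by
  induction h generalizing d with
  | nil => simp at hd
  | cons h _ ih =>
    cases d with
    | zero => simpa using h
    | succ d => simpa using ih (by simpa using hd)

theorem hasBits_map_range {m : ℕ} {l : List ℕ} (hl : l.length = m) (v : ℕ → ℕ) :
    hasBits ((List.range m).map v) l = (List.range m).all fun d => (v d).testBit (l.getD d 0) := by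
  induction l generalizing m v with
  | nil => subst hl; rfl
  | cons a l ih =>
    subst hl
    rw [List.length_cons, List.range_succ_eq_map, List.map_cons, hasBits, List.map_map, ih rfl]
    simp [List.all_map, Function.comp_def]

/-- A condition on a single digit is a product predicate whose factors at all other digit positions
are trivial (`coMask 5` accepts every mask), so it is available as a `tensor`. -/
theorem zeroDigit_eq {ks : List ℕ} {i : ℕ × ℕ} (hi : i ∈ digitPositions ks.length) :
    zeroDigit (ks.map subsetMasks) (widths (ks.map subsetMasks)) ks.length i =
      encode (ks.map subsetMasks) fun l => !(l.getD i.2 0).testBit i.1 := by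
  simp only [digitPositions, List.mem_flatMap, List.mem_map, List.mem_reverse, List.mem_range] at hi
  obtain ⟨j, hj, e, he, rfl⟩ := hi
  rw [zeroDigit, tensor_eq_encode (by simp)]
  refine encode_congr fun l hl => ?_
  have hlen : l.length = ks.length := by simpa using hl.length_eq
  have hlt : ∀ d < ks.length, l.getD d 0 < 32 := fun d hd => by
    have := forall₂_getD hl (d := d) (by simpa using hd)
    rw [List.getD_eq_getElem _ _ (by simpa using hd), List.getElem_map] at this
    exact lt_of_mem_subsetMasks this
  rw [hasBits_map_range hlen, Bool.eq_iff_iff, List.all_eq_true]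
  rw [← testBit_coMask hj (hlt e he)]
  constructor
  · intro h
    simpa using h e (List.mem_range.2 he)
  · intro h d hd
    rw [List.mem_range] at hd
    by_cases hde : d = e
    · subst hde
      simpa using h
    · have : Nat.beq d e = false := by
        rw [← Bool.not_eq_true, Nat.beq_eq]
        exact hde
      simp only [this, cond_false]
      exact testBit_coMask_five (hlt d hd)

/-- Checks that, for each `(y, F)` in the list, `y` has the weight vector `ks`, and is the least
monomial of that weight vector on which the sum of the spike functionals in `F` does not vanish. -/
def certCheck (ks : List ℕ) (r : ℕ) (L : List (List ℕ × List ℕ)) : Bool :=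
  forceList (widths (ks.map subsetMasks)) fun ws =>
    forceList ((digitPositions ks.length).map
      (zeroDigit (ks.map subsetMasks) ws ks.length)) fun N =>
    force (tensor (ks.map fun _ => coMask 5) (ks.map subsetMasks) ws) fun u =>
    L.all fun p => hasWeight ks p.1 &&
      force (flagSum ks (ks.map subsetMasks) ws r p.2) fun t =>
        let bits := (digitPositions ks.length).map fun i => (p.1.getD i.1 0).testBit i.2
        -- The sum vanishes on everything strictly below `p.1`, but not on everything up to and
        -- including `p.1`. Hence it is nonzero at `p.1` itself.
        Nat.beq (Nat.land t (lessVec 0 N bits)) 0 && !Nat.beq (Nat.land t (lessVec u N bits)) 0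

theorem slices_mem {ks : List ℕ} {z : Mon 5} (h : ∀ d, weight z d = ks.getD d 0) :
    List.Forall₂ (· ∈ ·) ((slices z ks.length).map maskOf) (ks.map subsetMasks) := by
  rw [List.forall₂_iff_get]
  refine ⟨by simp [slices], fun i h1 h2 => ?_⟩
  have hi : i < ks.length := by simpa using h2
  simp only [List.get_eq_getElem, List.getElem_map, slices, List.getElem_range]
  have := maskOf_mem (slice z i)
  rwa [show (slice z i).card = ks[i] by
    have := h i
    rw [weight_apply, List.getD_eq_getElem _ _ hi] at this
    exact this] at this

theorem getD_slices {z : Mon 5} {m d : ℕ} (hd : d < m) :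
    ((slices z m).map maskOf).getD d 0 = maskOf (slice z d) := by
  rw [List.getD_eq_getElem _ _ (by simpa [slices] using hd)]
  simp [slices]

theorem testBit_getD_slices (z : Mon 5) {m : ℕ} {i : ℕ × ℕ} (hi : i ∈ digitPositions m) :
    (((slices z m).map maskOf).getD i.2 0).testBit i.1 = ((exps z).getD i.1 0).testBit i.2 := by
  simp only [digitPositions, List.mem_flatMap, List.mem_map, List.mem_reverse, List.mem_range] at hi
  obtain ⟨j, hj, d, hd, rfl⟩ := hi
  have h1 := testBit_maskOf (slice z d) ⟨j, hj⟩
  have h2 := getD_exps z ⟨j, hj⟩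
  simp only at h1 h2 ⊢
  rw [getD_slices hd, h1, h2]
  simp [slice]

theorem bitLess_congr {ι : Type} {f f' g : ι → Bool} {init : Bool} {is : List ι}
    (h : ∀ i ∈ is, f i = f' i) : bitLess f g init is = bitLess f' g init is := by
  induction is with
  | nil => rfl
  | cons i is ih =>
    rw [bitLess, bitLess, h i List.mem_cons_self, ih fun j hj => h j (List.mem_cons_of_mem _ hj)]

theorem sum_spikeFunctional {ks : List ℕ} {r : ℕ} (hr : ∀ k ∈ ks, k ≤ r) (F : List ℕ) {z : Mon 5}
    (hz : ∀ d, weight z d = ks.getD d 0) :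
    (F.map fun code => spikeFunctional 5 (codeRows code) r ks).sum z.toP =
      if flagBit ks F ((slices z ks.length).map maskOf) = true then 1 else 0 := by
  induction F with
  | nil => simp [flagBit]
  | cons code F ih =>
    rw [List.map_cons, List.sum_cons, LinearMap.add_apply, ih,
      spikeFunctional_eq_minorProd _ hr hz, minorProd_eq, ← xor_toZMod]
    rfl

/-- Decodes the bit-vector test into the hypotheses of `admissible_of_functional`. Only monomials of
weight exactly `ks` need testing, because smaller weights are killed automatically. -/
theorem admissible_of_certCheck {ks : List ℕ} {r : ℕ} {L : List (List ℕ × List ℕ)}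
    (h : certCheck ks r L = true) (hr : ∀ k ∈ ks, k ≤ r) (hks : ks.Pairwise (· ≥ ·))
    {p : List ℕ × List ℕ} (hp : p ∈ L) {y : Mon 5} (hy : exps y = p.1) :
    Admissible y ∧ ∀ d, weight y d = ks.getD d 0 := by
  obtain ⟨l, F⟩ := p
  simp only at hy
  subst hy
  simp only [certCheck, force_eq, forceList_eq, List.all_eq_true] at h
  have hlen : ks.length = (ks.map subsetMasks).length := by simp
  have hN : (digitPositions ks.length).map (zeroDigit (ks.map subsetMasks)
      (widths (ks.map subsetMasks)) ks.length) = (digitPositions ks.length).map fun i =>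
        encode (ks.map subsetMasks) fun l => !(l.getD i.2 0).testBit i.1 :=
    List.map_congr_left fun i hi => zeroDigit_eq hi
  have hu : tensor (ks.map fun _ => coMask 5) (ks.map subsetMasks) (widths (ks.map subsetMasks)) =
      encode (ks.map subsetMasks) fun _ => true := by
    rw [tensor_eq_encode (by simp)]
    refine encode_congr fun l hl => ?_
    have : ∀ {ks l : List ℕ}, List.Forall₂ (· ∈ ·) l (ks.map subsetMasks) →
        hasBits (ks.map fun _ => coMask 5) l = true := by
      intro ks
      induction ks with
      | nil => intro l _; rfl
      | cons k ks ih =>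
        intro l hl
        rw [List.map_cons, List.forall₂_cons_right_iff] at hl
        obtain ⟨a, l, ha, hl, rfl⟩ := hl
        rw [List.map_cons, hasBits, ih hl, testBit_coMask_five (lt_of_mem_subsetMasks ha)]
        rfl
    exact this hl
  have h0 : (0 : ℕ) = encode (ks.map subsetMasks) fun _ => false := by
    symm
    rw [encode_eq_zero]
    exact fun _ _ => rfl
  have h := h _ hp
  rw [hN, hu, flagSum_eq hlen hr] at h
  simp only [Bool.and_eq_true, Bool.not_eq_true', Nat.beq_eq] at h
  obtain ⟨hw, hzero, hne⟩ := h
  have hwt := weight_of_hasWeight hw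
  refine ⟨?_, hwt⟩
  set g : ℕ × ℕ → Bool := fun i => ((exps y).getD i.1 0).testBit i.2 with hg
  have e1 := lessVec_eq (ks.map subsetMasks) (fun (i : ℕ × ℕ) l => (l.getD i.2 0).testBit i.1) g
    false (digitPositions ks.length)
  have e2 := lessVec_eq (ks.map subsetMasks) (fun (i : ℕ × ℕ) l => (l.getD i.2 0).testBit i.1) g
    true (digitPositions ks.length)
  rw [← h0] at e1
  rw [e1, land_encode, encode_eq_zero] at hzero
  rw [e2, land_encode, ← Bool.not_eq_true, Nat.beq_eq, encode_eq_zero] at hne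
  have hylt : ∀ i, y i < 2 ^ ks.length := by
    simp only [hasWeight, Bool.and_eq_true, List.all_eq_true, Nat.blt_eq] at hw
    exact fun i => hw.1 _ (List.mem_ofFn.2 ⟨i, rfl⟩)
  refine admissible_of_functional
    (F.map fun code => spikeFunctional 5 (codeRows code) r ks).sum ?_ ?_ ?_
  · intro f hf
    clear hzero hne hp
    induction F with
    | nil => rfl
    | cons code F ih =>
      rw [List.map_cons, List.sum_cons, LinearMap.add_apply, ih, spikeFunctional_hit _ hks hf,
        add_zero]
  · rw [sum_spikeFunctional hr F hwt]
    push Not at hne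
    obtain ⟨l, hl, hlt⟩ := hne
    simp only [ne_eq, Bool.not_eq_false, Bool.and_eq_true] at hlt
    have hnot := hzero l hl
    rw [hlt.1, Bool.true_and] at hnot
    have hbits := (bitLess_true hlt.2).resolve_left (by rw [hnot]; decide)
    -- The nonvanishing position `l` is at most `y` but not below it, so it has the digits of `y`;
    -- masks are below 32, hence determined by five bits.
    have hly : (slices y ks.length).map maskOf = l := by
      have hly' := slices_mem hwt
      have hl1 : ((slices y ks.length).map maskOf).length = ks.length := by simp [slices]
      have hl2 : l.length = ks.length := by simpa using hl.length_eq
      refine List.ext_getElem (hl1.trans hl2.symm) fun d hd1 hd2 => ?_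
      have hd : d < ks.length := hl1 ▸ hd1
      rw [← List.getD_eq_getElem _ 0 hd1, ← List.getD_eq_getElem _ 0 hd2]
      have b1 := forall₂_getD hly' (hlen ▸ hd)
      have b2 := forall₂_getD hl (hlen ▸ hd)
      rw [List.getD_eq_getElem (l := ks.map subsetMasks) _ (by simpa using hd),
        List.getElem_map] at b1 b2
      have c1 := lt_of_mem_subsetMasks b1
      have c2 := lt_of_mem_subsetMasks b2
      refine Nat.eq_of_testBit_eq fun j => ?_
      by_cases hj : j < 5
      · have hmem : (j, d) ∈ digitPositions ks.length := by
          simp only [digitPositions, List.mem_flatMap, List.mem_map, List.mem_reverse,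
            List.mem_range]
          exact ⟨j, hj, d, hd, rfl⟩
        have := hbits _ hmem
        rw [testBit_getD_slices y hmem, this]
      · have h32 : 32 ≤ 2 ^ j := Nat.pow_le_pow_right (n := 2) (by omega) (not_lt.1 hj)
        rw [Nat.testBit_lt_two_pow (c1.trans_le h32), Nat.testBit_lt_two_pow (c2.trans_le h32)]
    rw [hly, if_pos hlt.1]
    exact one_ne_zero
  · intro z hz
    -- In the case of smaller weight each functional vanishes separately; for equal weight only the
    -- sum does, by the test.
    rcases less_iff.1 hz with ⟨j, hj1, hj2⟩ | ⟨hwz, i, hi, hlt⟩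
    · clear hzero hne hp
      induction F with
      | nil => rfl
      | cons code F ih =>
        rw [List.map_cons, List.sum_cons, LinearMap.add_apply, ih,
          spikeFunctional_eq_zero _ hr (j := j) (fun d hd => by rw [hj1 d hd, hwt])
            (by rwa [← hwt]), add_zero]
    · have hwz' : ∀ d, weight z d = ks.getD d 0 := fun d => by rw [hwz, hwt]
      rw [sum_spikeFunctional hr F hwz', if_neg]
      have := hzero _ (slices_mem hwz')
      rw [bitLess_congr (fun i hi => testBit_getD_slices z hi),
        bitLess_of_lex (lt_two_pow_of_weight_eq hylt hwz) hylt hi hlt, Bool.and_true] at this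
      rw [this]
      decide

end Certificates

/-! ### Certificate tables -/

section Data

/-- The monomials in `Φ⁺(B_4(3,3,2,1))`, with spike functionals that detect them. -/
noncomputable def cert3321 : List (List ℕ × List ℕ) := [
  ([1, 1, 2, 6, 15], [10652, 10685, 21084, 22109]), ([1, 1, 2, 7, 14], [4446, 18111, 18748,
  26941]), ([1, 1, 2, 14, 7], [18093, 18126, 18220, 18223]), ([1, 1, 2, 15, 6], [4617, 4649,
  13834, 29226]), ([1, 1, 3, 6, 14], [4446, 18111, 19166, 20223]), ([1, 1, 3, 14, 6], [4617,
  4649, 4682, 4906]), ([1, 1, 6, 2, 15], [8348, 18236, 19260, 19612]), ([1, 1, 6, 3, 14], [11100,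
  11102, 17629, 18303]), ([1, 1, 6, 6, 11], [8339, 8381, 9362, 10449, 13520, 14173, 17629,
  18237]), ([1, 1, 6, 7, 10], [10384, 10385, 10448, 10449, 11068, 11100, 17629, 18621]), ([1, 1,
  6, 10, 7], [4616, 4617, 12843, 18093, 18126, 18220, 18223, 29226]), ([1, 1, 6, 11, 6], [9933,
  10030, 10031, 10092, 15305, 18377, 19081, 27273]), ([1, 1, 6, 14, 3], [17546, 17547, 17608,
  17609]), ([1, 1, 6, 15, 2], [18568, 18632, 19688, 22696]), ([1, 1, 7, 2, 14], [8348, 12159,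
  17564, 18303]), ([1, 1, 7, 6, 10], [8850, 9874, 10448, 11068, 13520, 18621, 19294, 20351]),
  ([1, 1, 7, 10, 6], [4617, 4649, 4682, 4906, 11054, 18093, 18220, 20207]), ([1, 1, 7, 14, 2],
  [16751, 17775, 18732, 26924]), ([1, 1, 14, 2, 7], [25124, 25125, 26212, 26309]), ([1, 1, 14, 3,
  6], [8709, 8772, 9925, 25124]), ([1, 1, 14, 6, 3], [16806, 17734, 25925, 26053]), ([1, 1, 14,
  7, 2], [16709, 17733, 18726, 26918]), ([1, 1, 15, 2, 6], [8709, 8772, 9828, 25125]), ([1, 1,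
  15, 6, 2], [16709, 17861, 25925, 26053]), ([1, 2, 1, 6, 15], [2325, 2869, 3348, 23317]), ([1,
  2, 1, 7, 14], [2869, 17811, 17842, 23317]), ([1, 2, 1, 14, 7], [2696, 3599, 3720, 13839]), ([1,
  2, 1, 15, 6], [2860, 3599, 13839, 27436]), ([1, 2, 3, 4, 15], [6878, 17726, 25983, 26303]),
  ([1, 2, 3, 5, 14], [6845, 17726, 18175, 18749, 18782, 26303]), ([1, 2, 3, 7, 12], [6463, 17726,
  18748, 26941]), ([1, 2, 3, 12, 7], [4616, 4649, 4682, 4715]), ([1, 2, 3, 13, 6], [7688, 13834,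
  22088, 23081, 29226, 29257]), ([1, 2, 3, 15, 4], [4682, 4906, 5642, 21034]), ([1, 2, 5, 2, 15],
  [8414, 8447, 11102, 12159, 17629, 18269]), ([1, 2, 5, 3, 14], [11100, 17598, 17629, 18303,
  19260, 19612]), ([1, 2, 5, 6, 11], [9403, 10804, 13526, 13559, 17624, 17625, 18585, 19611,
  22712, 25142, 25143, 27188]), ([1, 2, 5, 7, 10], [10426, 10449, 10961, 11225, 17563, 18585,
  19353, 21752, 24722, 25266, 25747, 26291]), ([1, 2, 5, 10, 7], [2604, 4745, 4747, 5646, 5802,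
  11791, 13193, 18120, 18121, 18989, 27180, 27181]), ([1, 2, 5, 11, 6], [3017, 3595, 5806, 9739,
  10796, 10797, 17775, 19245, 20108, 22216, 27182]), ([1, 2, 5, 14, 3], [18605, 18638, 18733,
  18735, 19823, 22702]), ([1, 2, 5, 15, 2], [16520, 17544, 17802, 17803, 25994, 25995]), ([1, 2,
  7, 1, 14], [2200, 2613, 3224, 18996]), ([1, 2, 7, 3, 12], [11102, 18303, 19260, 22717]), ([1,
  2, 7, 5, 10], [2646, 3703, 6075, 8439, 10078, 11068, 20351, 22717, 25142, 25813, 26196,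
  26555]), ([1, 2, 7, 7, 8], [8348, 10384, 10385, 18237, 19294, 20351, 24754, 25779]), ([1, 2, 7,
  9, 6], [6824, 6829, 6861, 7912, 11052, 14251, 15305, 18284, 18315, 19081, 19119, 20335]), ([1,
  2, 7, 11, 4], [4682, 4906, 5642, 9933, 10029, 10061, 18093, 21034]), ([1, 2, 7, 13, 2], [16751,
  17548, 17709, 17775, 18732, 22701]), ([1, 2, 13, 2, 7], [8709, 25124, 26212, 26215, 26279,
  26309]), ([1, 2, 13, 3, 6], [9733, 9735, 9828, 9925, 25124, 25127]), ([1, 2, 13, 6, 3], [16678,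
  16679, 17733, 17734, 17767, 17861]), ([1, 2, 13, 7, 2], [16709, 16806, 17733, 17767, 25926,
  26023]), ([1, 2, 15, 1, 6], [2566, 3940, 18982, 26565]), ([1, 2, 15, 3, 4], [9733, 9797, 9925,
  25125]), ([1, 2, 15, 5, 2], [16709, 17669, 17701, 17733, 18692, 26916]), ([1, 3, 1, 6, 14],
  [2322, 2480, 2961, 17683]), ([1, 3, 1, 14, 6], [2568, 2569, 2733, 2860]), ([1, 3, 2, 4, 15],
  [3347, 10547, 17811, 17843]), ([1, 3, 2, 5, 14], [2398, 9562, 9599, 13789, 18012, 19002]), ([1,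
  3, 2, 7, 12], [2480, 2961, 21942, 26039]), ([1, 3, 2, 12, 7], [2733, 2860, 3720, 10889]), ([1,
  3, 2, 13, 6], [2568, 2569, 2607, 3720, 11145, 13839]), ([1, 3, 2, 15, 4], [2568, 2600, 10889,
  11145]), ([1, 3, 3, 4, 14], [2448, 2480, 2902, 3348, 10548, 17683, 17715, 26038]), ([1, 3, 3,
  6, 12], [2322, 2480, 2961, 9556, 9557, 17683, 21942, 26039]), ([1, 3, 3, 12, 6], [2568, 2569,
  2733, 2860, 3599, 3720, 10889, 13838]), ([1, 3, 3, 14, 4], [2568, 2600, 2607, 2892, 10889,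
  11145, 13839, 26476]), ([1, 3, 4, 2, 15], [8348, 8447, 11100, 12159, 17597, 17598, 17630,
  18269]), ([1, 3, 4, 3, 14], [8414, 8447, 10076, 10077, 17598, 18303, 19612, 22717]), ([1, 3, 4,
  6, 11], [2398, 4411, 4666, 5499, 6713, 7448, 9918, 12602, 12633, 22104]), ([1, 3, 4, 7, 10],
  [3472, 5911, 5973, 7959, 9685, 10038, 12148, 18833, 19254, 19284]), ([1, 3, 4, 10, 7], [5838,
  9933, 10092, 11052, 11053, 17992, 17993, 19119, 19278, 20207]), ([1, 3, 4, 11, 6], [2735, 5802,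
  6058, 7912, 18091, 18377, 19080, 20363, 26479, 27273]), ([1, 3, 4, 14, 3], [17544, 17576,
  17803, 17835, 18633, 18889, 25739, 25771]), ([1, 3, 4, 15, 2], [16524, 16686, 17614, 17708,
  18572, 18734, 21710, 26924]), ([1, 3, 5, 2, 14], [8348, 8414, 12159, 13533, 17564, 17629,
  17630, 18303]), ([1, 3, 5, 6, 10], [8339, 8348, 8401, 9362, 9424, 10449, 11068, 11100, 13520,
  17629, 18237, 18621, 19292, 21725, 24754, 24755]), ([1, 3, 5, 10, 6], [2568, 2569, 2733, 2860,
  3599, 3720, 7688, 10889, 12843, 13099, 13838, 14857, 22088, 22090, 29226, 29257]), ([1, 3, 5,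
  14, 2], [16520, 16522, 17544, 17546, 18889, 19851, 25995, 27081]), ([1, 3, 6, 1, 14], [6333,
  18996, 18997, 27453]), ([1, 3, 6, 3, 12], [11100, 11102, 17629, 18303, 19260, 19262, 19711,
  22717]), ([1, 3, 6, 5, 10], [8401, 8913, 9369, 9875, 9907, 10137, 10393, 11161, 17562, 17594,
  18586, 18618, 25235, 25267, 26833, 27345]), ([1, 3, 6, 7, 8], [8348, 10384, 10385, 10448,
  10449, 11071, 11100, 17629, 18237, 18654, 19294, 20351, 24754, 25235, 25779, 26290]), ([1, 3,
  6, 9, 6], [6670, 7912, 9806, 10764, 13195, 18346, 18377, 19081, 19082, 20104, 20107, 22093,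
  22446, 22477, 23086, 27180]), ([1, 3, 6, 11, 4], [5806, 6862, 11054, 13193, 14250, 18057,
  18222, 18254, 18314, 19082, 19119, 19145, 19150, 20335, 26282, 27593]), ([1, 3, 6, 13, 2],
  [16686, 16717, 17613, 17614, 18734, 21710, 25932, 25964]), ([1, 3, 7, 2, 12], [2226, 6333,
  17587, 27452]), ([1, 3, 7, 4, 10], [3219, 10111, 11102, 12159, 17554, 17564, 18237, 18588,
  19261, 19294]), ([1, 3, 7, 6, 8], [8439, 8758, 8789, 8820, 9433, 10138, 10171, 10454, 10807,
  14266, 17624, 18331, 19417, 19704, 25172, 25813]), ([1, 3, 7, 8, 6], [6827, 6829, 7912, 9902,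
  11052, 13194, 14251, 15305, 18159, 18222, 18253, 18284, 19080, 19081, 19119, 26282]), ([1, 3,
  7, 10, 4], [4617, 4649, 4682, 4906, 5642, 5704, 5736, 5807, 9933, 10029, 10061, 11054, 18093,
  18287, 19150, 21034]), ([1, 3, 7, 12, 2], [16590, 16687, 17613, 17740, 18638, 18735, 18764,
  25805]), ([1, 3, 12, 2, 7], [25124, 25125, 25126, 25127, 26182, 26212, 26279, 26309]), ([1, 3,
  12, 3, 6], [8709, 8772, 9925, 13831, 25124, 26182, 26215, 27174]), ([1, 3, 12, 6, 3], [16679,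
  16807, 17702, 17734, 18693, 19716, 22981, 25956]), ([1, 3, 12, 7, 2], [16646, 16708, 17671,
  17733, 19812, 21766, 21767, 26053]), ([1, 3, 13, 2, 6], [8709, 8772, 9828, 10758, 25125, 26215,
  26279, 27174]), ([1, 3, 13, 6, 2], [16679, 16806, 17671, 17734, 18692, 25925, 26053, 26916]),
  ([1, 3, 14, 1, 6], [2566, 2854, 2855, 5639]), ([1, 3, 14, 3, 4], [9733, 9735, 9797, 9798, 9894,
  9925, 25125, 25127]), ([1, 3, 14, 5, 2], [16644, 16708, 17701, 17861, 18725, 18757, 19716,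
  19812]), ([1, 3, 15, 2, 4], [2566, 2598, 2855, 5895]), ([1, 3, 15, 4, 2], [16677, 16709, 17669,
  17861, 18692, 25925, 26053, 26916]), ([1, 6, 1, 2, 15], [8315, 10043, 20570, 21627]), ([1, 6,
  1, 3, 14], [8315, 10043, 20607, 22463]), ([1, 6, 1, 6, 11], [8315, 10043, 20570, 21627, 24657,
  25169, 25684, 26325]), ([1, 6, 1, 7, 10], [8315, 8886, 9302, 10043, 20607, 22463, 24657,
  25169]), ([1, 6, 1, 10, 7], [2569, 2605, 3599, 9739, 13839, 18985, 18986, 18988]), ([1, 6, 1,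
  11, 6], [2569, 2696, 2730, 9739, 9866, 11145, 18985, 18986]), ([1, 6, 1, 14, 3], [16458, 17706,
  21934, 21935]), ([1, 6, 1, 15, 2], [16458, 17706, 20553, 20584]), ([1, 6, 3, 1, 14], [5235,
  21043, 25694, 26558]), ([1, 6, 3, 3, 12], [5235, 8315, 10043, 17535, 18367, 20570, 20607,
  21043, 21627, 22463, 25694, 26558]), ([1, 6, 3, 5, 10], [8315, 8886, 9302, 10043, 12851, 13427,
  17535, 18367, 20570, 20607, 21627, 22463, 24657, 25169, 25684, 26325]), ([1, 6, 3, 7, 8],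
  [2870, 2871, 3816, 4689, 5589, 6933, 7959, 8282, 8311, 9302, 10039, 10122, 10155, 11062, 11094,
  12368, 12377, 12881, 16488, 17480, 17502, 17519, 17535, 17839, 18196, 18229, 18234, 18262,
  18292, 19222, 19252, 19284, 19285, 20561, 20588, 21337, 22248, 25677, 25692, 25724]), ([1, 6,
  3, 9, 6], [2569, 2605, 2696, 2730, 2892, 3599, 9739, 9866, 11145, 13839, 18985, 18986, 18988,
  22255, 26444, 27438]), ([1, 6, 3, 11, 4], [9902, 10028, 10030, 10061, 10062, 15309, 18028,
  18093, 18126, 18252, 18253, 18607, 19117, 19244, 19276, 19695, 21611, 25967, 26927, 27438,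
  27439, 28971]), ([1, 6, 3, 13, 2], [16458, 17486, 17706, 17838, 20553, 20584, 21934, 21935]),
  ([1, 6, 7, 1, 10], [4182, 5235, 5243, 5814, 21043, 25694, 26558, 29499]), ([1, 6, 7, 3, 8],
  [4182, 4211, 4215, 5202, 8312, 9309, 9340, 10170, 10171, 10393, 10426, 12380, 14301, 14523,
  17496, 17624, 17656, 18362, 18363, 18585, 18586, 19611, 20603, 21594, 21720, 21752]), ([1, 6,
  7, 8, 3], [2573, 2606, 2632, 2697, 2733, 3688, 3724, 5803, 5838, 5965, 6857, 7912, 7919, 9866,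
  10031, 10060, 10095, 11145, 13838, 17994, 18027, 18056, 18057, 18060, 18091, 18221, 18252,
  18253, 18315, 18347, 18988, 19080, 19144, 19245, 19246, 20108, 20335, 20363, 21321, 23211,
  26287, 26479, 26539, 27081, 27593]), ([1, 6, 7, 9, 2], [16456, 16557, 16589, 16590, 16751,
  16845, 17484, 17548, 17583, 17614, 17737, 17740, 18572, 18605, 18607, 18764, 20809, 21576,
  21581, 25805, 25967, 26061]), ([1, 6, 9, 3, 6], [2264, 2265, 4211, 5192, 5202, 5551, 6325,
  8276, 8307, 8308, 8406, 8439, 8757, 8820, 9298, 9327, 9340, 9812, 9814, 9847, 10073, 10139,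
  10201, 10457, 10807, 11162, 11225, 12377, 12412, 12617, 12851, 13145, 13405, 13427, 16458,
  16557, 16590, 16684, 16686, 16716, 16717, 16845, 17484, 17496, 17562, 17563, 17625, 17706,
  18331, 18584, 18586, 18607, 18732, 18764, 18997, 19354, 19608, 19611, 20552, 20556, 20572,
  21743, 22701, 24660, 25141, 25172, 25708, 25716, 25775, 25782, 25783, 25933, 26228, 26927,
  27190, 29001]), ([1, 6, 11, 1, 6], [2566, 2596, 2855, 3847, 3940, 6661, 18982, 26565]), ([1, 6,
  11, 3, 4], [2566, 3940, 5639, 8772, 9733, 9735, 9797, 9798, 9894, 10756, 16806, 17734, 18694,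
  25124, 25127, 26212, 26309, 26565, 26918, 27173]), ([1, 6, 11, 5, 2], [16676, 16679, 16740,
  16743, 17669, 17671, 17767, 17861, 18694, 18726, 19716, 25956, 26053, 26917]), ([1, 6, 15, 1,
  2], [17574, 17575, 24644, 25797]), ([1, 7, 1, 2, 14], [9310, 20570, 20574, 21594]), ([1, 7, 1,
  6, 10], [9296, 9310, 20570, 20574, 21594, 24657, 24692, 26325]), ([1, 7, 1, 10, 6], [2569,
  2600, 2730, 3595, 3720, 9867, 11145, 18986]), ([1, 7, 1, 14, 2], [20553, 21934, 26030, 28745]),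
  ([1, 7, 2, 1, 14], [4176, 5200, 25694, 26559]), ([1, 7, 2, 3, 12], [12370, 12851, 24692,
  26325]), ([1, 7, 2, 5, 10], [8272, 8278, 9302, 9310, 13114, 21627, 22463, 24657, 24692, 25694,
  26325, 26559]), ([1, 7, 2, 7, 8], [8315, 12370, 12851, 18234, 20574, 22463, 24692, 26325]),
  ([1, 7, 2, 9, 6], [2568, 2569, 2570, 2573, 2605, 2607, 2730, 3720, 9739, 9867, 11145, 13839]),
  ([1, 7, 2, 11, 4], [2573, 2605, 2607, 2863, 2892, 13839, 22255, 26476]), ([1, 7, 2, 13, 2],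
  [16845, 17516, 20553, 20588, 26061, 28745]), ([1, 7, 3, 2, 12], [4190, 5200, 20561, 26559]),
  ([1, 7, 3, 4, 10], [5815, 8282, 10043, 10175, 13145, 17494, 17502, 18367, 20574, 21624]), ([1,
  7, 3, 6, 8], [8282, 9296, 9335, 9910, 12382, 12403, 12850, 18235, 18367, 20569, 20574, 21592,
  22463, 24657, 24695, 26294]), ([1, 7, 3, 8, 6], [2862, 3691, 3720, 3723, 9866, 10026, 10889,
  17996, 17997, 17998, 18024, 18249, 18351, 22221, 22255, 26444]), ([1, 7, 3, 10, 4], [2572,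
  2604, 2698, 2730, 2735, 2760, 10027, 10761, 14255, 18027, 18031, 18985, 22248, 22349, 26317,
  26479]), ([1, 7, 3, 12, 2], [16458, 16683, 17486, 17839, 20556, 21611, 25677, 28970]), ([1, 7,
  6, 1, 10], [4176, 4219, 5205, 5243, 17493, 20561, 25694, 26559]), ([1, 7, 6, 3, 8], [4177,
  4180, 5200, 8348, 8414, 9406, 10073, 10076, 10078, 10108, 11071, 12156, 12159, 12415, 13114,
  17492, 17528, 17535, 17599, 18236, 18238, 18268, 19261, 21627, 21759, 22717]), ([1, 7, 6, 8,
  3], [2572, 2633, 2634, 2638, 2760, 2761, 2892, 4744, 4746, 5832, 6059, 6664, 6827, 10122,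
  10155, 13194, 14251, 16460, 16584, 18024, 18027, 18028, 18057, 18059, 18121, 18350, 19081,
  19114, 19145, 20104, 21934, 22222, 25711, 26476, 26506, 27438]), ([1, 7, 6, 9, 2], [16488,
  16684, 16686, 16717, 16751, 16845, 17548, 17583, 17613, 17614, 17737, 17869, 18605, 18735,
  18764, 19695, 19820, 20552, 20553, 25774, 25934, 26925]), ([1, 7, 7, 2, 8], [4182, 4190, 5200,
  5210, 18103, 20561, 26559, 29499]), ([1, 7, 7, 8, 2], [16523, 16585, 16682, 16777, 16779,
  16815, 17486, 17515, 17546, 17576, 17608, 17834, 18568, 20553, 21576, 21736, 25678, 25738,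
  25739, 25995, 26026, 26031, 26761, 27081]), ([1, 7, 8, 3, 6], [4182, 4219, 4922, 4953, 5213,
  5240, 5815, 6109, 8274, 8339, 8371, 8401, 8408, 8440, 8851, 8883, 8913, 9308, 9309, 9324, 9331,
  9332, 9370, 9402, 9677, 9941, 10385, 10394, 10426, 10448, 10457, 10897, 11162, 11225, 13145,
  13552, 14266, 16488, 16521, 16523, 16555, 16584, 16616, 16777, 16778, 16810, 17486, 17512,
  17532, 17561, 17839, 18329, 18397, 18568, 18585, 18600, 18632, 18633, 18826, 19353, 19354,
  19595, 21337, 21704, 21930, 22458, 22699, 24721, 24722, 24754, 25138, 25139, 25233, 25693,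
  25711, 25719, 25724, 26030, 26258, 26290, 26294, 27081]), ([1, 7, 9, 2, 6], [4182, 5235, 8408,
  9310, 10073, 10137, 10175, 10426, 10797, 11053, 11161, 12187, 14271, 16458, 16462, 16684,
  16686, 16718, 16748, 17502, 17528, 17581, 17592, 17595, 17625, 17647, 17707, 17775, 17839,
  18103, 18125, 18362, 18572, 18607, 18616, 18618, 18735, 19417, 19704, 20379, 20554, 21042,
  21307, 21594, 21710, 22458, 22702, 22715, 25711, 25964, 26030, 26573, 26925, 28971]), ([1, 7,
  10, 1, 6], [2598, 2854, 2855, 5639, 6661, 18980, 26468, 26565]), ([1, 7, 10, 3, 4], [2628,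
  2629, 2820, 2821, 2854, 2855, 8964, 8966, 10053, 10054, 11045, 11046, 11076, 12135, 17990,
  18087, 18181, 18183, 18245, 18342, 19236, 19239, 19268, 22439]), ([1, 7, 10, 5, 2], [16646,
  16679, 16709, 16740, 17669, 17700, 17734, 17767, 18726, 18756, 21767, 21927, 22789, 26022,
  26053, 26916]), ([1, 7, 11, 2, 4], [2564, 2566, 2596, 2598, 2855, 2885, 5895, 26565]), ([1, 7,
  11, 4, 2], [16677, 16679, 16709, 16806, 17669, 17671, 17734, 17861, 18692, 18694, 25925, 25926,
  26022, 26053, 26916, 26918]), ([1, 7, 14, 1, 2], [16454, 17575, 25700, 25797]), ([1, 14, 1, 2,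
  7], [8707, 8738, 25218, 25219]), ([1, 14, 1, 3, 6], [12834, 12835, 25218, 25219]), ([1, 14, 1,
  6, 3], [16642, 17667, 20866, 25987]), ([1, 14, 1, 7, 2], [16642, 17667, 20770, 20771]), ([1,
  14, 3, 1, 6], [4739, 6050, 6051, 18082]), ([1, 14, 3, 3, 4], [4739, 6050, 6051, 8707, 8738,
  8866, 9891, 12834, 12835, 18082, 25218, 25219]), ([1, 14, 3, 5, 2], [16642, 16770, 17667,
  17795, 20770, 20771, 20866, 25987]), ([1, 14, 7, 1, 2], [16546, 17571, 24706, 24707]), ([1, 15,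
  1, 2, 6], [8738, 25122, 25219, 26243]), ([1, 15, 1, 6, 2], [16770, 16802, 20738, 20770]), ([1,
  15, 2, 1, 6], [6050, 18050, 18082, 26530]), ([1, 15, 2, 3, 4], [12803, 12835, 25251, 26243]),
  ([1, 15, 2, 5, 2], [16675, 17667, 20738, 20770, 20867, 25987]), ([1, 15, 3, 2, 4], [4610, 4642,
  6051, 26499]), ([1, 15, 3, 4, 2], [16770, 16802, 17667, 17699, 20738, 20770, 21923, 25987]),
  ([1, 15, 6, 1, 2], [16514, 16546, 24707, 25763]), ([3, 1, 1, 6, 14], [1330, 1333, 1843, 2005]),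
  ([3, 1, 1, 14, 6], [1583, 1707, 1931, 1967]), ([3, 1, 2, 4, 15], [1333, 1493, 1813, 2005]),
  ([3, 1, 2, 5, 14], [1330, 1333, 1366, 1813, 1843, 1911]), ([3, 1, 2, 7, 12], [1366, 1392, 1843,
  2005]), ([3, 1, 2, 12, 7], [1549, 1583, 1643, 1865]), ([3, 1, 2, 13, 6], [1583, 1643, 1707,
  1737, 1865, 1967]), ([3, 1, 2, 15, 4], [1547, 1643, 1707, 1931]), ([3, 1, 3, 4, 14], [1330,
  1333, 1366, 1392, 1424, 1493, 1911, 1939]), ([3, 1, 3, 6, 12], [1366, 1392, 1424, 1458, 1813,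
  1843, 1911, 2005]), ([3, 1, 3, 12, 6], [1547, 1549, 1707, 1737, 1865, 1870, 1900, 1967]), ([3,
  1, 3, 14, 4], [1547, 1583, 1643, 1707, 1839, 1870, 1931, 1967]), ([3, 1, 4, 2, 15], [8381,
  10045, 13533, 14173, 17597, 17629, 18237, 18269]), ([3, 1, 4, 3, 14], [10431, 11102, 17598,
  18303, 19262, 19263, 19711, 21726]), ([3, 1, 4, 6, 11], [1328, 1843, 5399, 6421, 6933, 7125,
  8790, 18740, 18741, 19286, 19732, 24789, 26934, 26942, 27593]), ([3, 1, 4, 7, 10], [1593, 1659,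
  4479, 5822, 12668, 14045, 17788, 17791, 18110, 18141]), ([3, 1, 4, 10, 7], [1709, 1903, 4746,
  4747, 6824, 18058, 18059, 19112, 19337, 27529]), ([3, 1, 4, 11, 6], [1706, 1962, 4719, 6062,
  6669, 11788, 26190, 26543, 27180, 27181]), ([3, 1, 4, 14, 3], [16520, 16521, 17576, 17801,
  18632, 18633, 19688, 27081]), ([3, 1, 4, 15, 2], [16520, 16552, 17544, 17576, 18633, 18889,
  26825, 27081]), ([3, 1, 5, 2, 14], [8381, 10045, 10431, 12159, 17597, 17599, 18237, 18303]),
  ([3, 1, 5, 6, 10], [9433, 10201, 10807, 13526, 13559, 17624, 17656, 18649, 19417, 19704, 21720,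
  24789, 25172, 26197, 26228, 27190]), ([3, 1, 5, 10, 6], [1547, 1549, 1707, 1737, 1865, 1870,
  1900, 1967, 4616, 4617, 4648, 4649, 4682, 4715, 4906, 4907]), ([3, 1, 5, 14, 2], [16584, 16841,
  17609, 17640, 18632, 18889, 19688, 26825]), ([3, 1, 6, 1, 14], [1171, 1211, 1233, 1946]), ([3,
  1, 6, 3, 12], [10431, 11102, 17598, 18303, 19260, 19261, 19612, 22717]), ([3, 1, 6, 5, 10],
  [4496, 4497, 4884, 5009, 7664, 7959, 9648, 9680, 10036, 10039, 18197, 18198, 18229, 18230,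
  22993, 23505]), ([3, 1, 6, 7, 8], [10394, 10426, 11408, 14512, 17563, 17595, 18585, 19353,
  19608, 22712, 24722, 24754, 25747, 25779, 26769, 27281]), ([3, 1, 6, 9, 6], [4748, 6856, 6857,
  9902, 10029, 10062, 18093, 18152, 18220, 18377, 19119, 19144, 19145, 20200, 20335, 27593]),
  ([3, 1, 6, 11, 4], [4618, 4650, 4715, 4907, 5642, 5739, 5807, 5838, 11086, 18094, 18287, 19246,
  19247, 20207, 21034, 29483]), ([3, 1, 6, 13, 2], [16522, 16523, 17546, 17547, 18889, 19688,
  21736, 27081]), ([3, 1, 7, 2, 12], [1233, 1240, 1715, 1946]), ([3, 1, 7, 4, 10], [1233, 1715,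
  8348, 10045, 11102, 12159, 17564, 18237, 18270, 18303]), ([3, 1, 7, 6, 8], [8414, 9437, 10047,
  10076, 10806, 11511, 13559, 17630, 18239, 19292, 21725, 24789, 25172, 25813, 26196, 27190]),
  ([3, 1, 7, 8, 6], [4684, 4716, 6827, 7912, 9805, 10189, 10766, 10798, 11791, 15305, 18120,
  18121, 19082, 26251, 26282, 27183]), ([3, 1, 7, 10, 4], [6827, 6862, 9902, 10031, 10062, 13195,
  14250, 18159, 18222, 18314, 18347, 19082, 19119, 20335, 26251, 26282]), ([3, 1, 7, 12, 2],
  [16520, 16521, 16522, 16523, 17544, 17545, 17546, 17547]), ([3, 1, 12, 2, 7], [8708, 8709,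
  25124, 25125, 26182, 26215, 26278, 26279]), ([3, 1, 12, 3, 6], [25156, 25158, 25191, 25285,
  26181, 26212, 26278, 26279]), ([3, 1, 12, 6, 3], [16678, 16679, 17670, 17671, 25924, 25925,
  25956, 26053]), ([3, 1, 12, 7, 2], [16709, 16740, 17733, 17764, 18726, 19719, 21767, 26918]),
  ([3, 1, 13, 2, 6], [8708, 8709, 8772, 8773, 9828, 9925, 25124, 25125]), ([3, 1, 13, 6, 2],
  [16708, 16709, 17764, 17861, 25924, 25925, 25956, 26053]), ([3, 1, 14, 1, 6], [1606, 1636,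
  1958, 1989]), ([3, 1, 14, 3, 4], [8708, 8740, 8772, 8804, 9733, 9797, 9925, 25125]), ([3, 1,
  14, 5, 2], [16709, 16837, 17733, 17861, 18694, 18726, 21766, 26918]), ([3, 1, 15, 2, 4], [1574,
  1606, 1829, 1989]), ([3, 1, 15, 4, 2], [16645, 16677, 16709, 16837, 17669, 17701, 17733,
  17861]), ([3, 3, 1, 4, 14], [1297, 1330, 1392, 1493, 1813, 1843, 1846, 1911]), ([3, 3, 1, 6,
  12], [1297, 1330, 1333, 1334, 1366, 1392, 1843, 2005]), ([3, 3, 1, 12, 6], [1673, 1707, 1709,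
  1737, 1839, 1870, 1900, 1931]), ([3, 3, 1, 14, 4], [1545, 1547, 1643, 1673, 1707, 1737, 1865,
  1931]), ([3, 3, 3, 4, 12], [1300, 1331, 1366, 1809, 1811, 1873, 1908, 1911, 2358, 2836, 2837,
  3860, 10551, 21782, 21783, 23317]), ([3, 3, 3, 12, 4], [1545, 1547, 1549, 1583, 1643, 1673,
  1707, 1865, 2606, 2607, 2696, 2697, 3599, 3720, 10889, 13838]), ([3, 3, 4, 1, 14], [1179, 1241,
  1588, 1621, 2229, 2234, 2613, 3227, 6325, 18997, 25755, 25786]), ([3, 3, 4, 3, 12], [1279,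
  1589, 1591, 1886, 2879, 3327, 5375, 8405, 8789, 8790, 8823, 9812, 9814, 9844, 9847, 10806,
  10807, 24789, 25204, 26196, 26197, 27190, 27191, 27455]), ([3, 3, 4, 5, 10], [1426, 1456, 1493,
  1813, 1814, 1911, 1970, 2001, 4432, 4433, 4464, 4945, 5906, 5907, 6416, 6417, 6448, 6929,
  20755, 20787, 21778, 28978, 29490, 29491]), ([3, 3, 4, 7, 8], [1331, 1366, 1396, 1809, 2326,
  10034, 10035, 10550, 10551, 18194, 18195, 21783]), ([3, 3, 4, 9, 6], [1545, 1547, 1550, 1672,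
  1963, 1967, 2634, 2637, 2697, 2728, 3691, 10026, 10027, 10889, 15309, 17997, 18381, 23208]),
  ([3, 3, 4, 11, 4], [1547, 1548, 1610, 1837, 1903, 1967, 3691, 4620, 4652, 6670, 6702, 7695,
  9740, 9839, 10027, 10159, 16590, 16687, 17710, 18027, 18219, 18223, 18766, 21036, 21070, 22446,
  22702, 25775, 25967]), ([3, 3, 4, 13, 2], [16684, 16685, 16686, 16687, 17708, 17709, 17710,
  17711, 19820, 19823, 21709, 22702, 25774, 25805, 25964, 25967]), ([3, 3, 5, 2, 12], [1169,
  1171, 1208, 1211, 1233, 1240, 1715, 1946]), ([3, 3, 5, 4, 10], [1205, 1238, 1652, 1655, 10076,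
  10077, 10431, 11102, 12159, 14526, 17564, 17597, 18236, 18237, 18654, 19262, 19263, 20348,
  21725, 21759]), ([3, 3, 5, 6, 8], [1169, 1171, 1208, 1211, 1233, 1240, 1297, 1330, 1333, 1334,
  1366, 1392, 1424, 1458, 1488, 1493, 1715, 1813, 1843, 1846, 1911, 1939, 1946, 2005]), ([3, 3,
  5, 8, 6], [1550, 1579, 1613, 1640, 1706, 1710, 1737, 1741, 2574, 2607, 2634, 2696, 2700, 2733,
  2953, 3599, 3691, 3720, 3724, 11145, 17994, 18027, 18990, 23213]), ([3, 3, 5, 10, 4], [1545,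
  1547, 1643, 1673, 1707, 1709, 1737, 1839, 1865, 1870, 1900, 1931, 2574, 2606, 2607, 13839]),
  ([3, 3, 5, 12, 2], [16520, 16521, 16522, 16523, 17544, 17545, 17546, 17547, 18889, 19688,
  19851, 21736, 21930, 25995, 26026, 27081]), ([3, 3, 7, 4, 8], [1271, 1652, 1854, 1916, 2229,
  2612, 2910, 3220, 6334, 18997, 25791, 26495]), ([3, 3, 7, 8, 4], [1197, 1230, 1576, 1612, 1647,
  1673, 1710, 1835, 1837, 1930, 2633, 2733, 2861, 3436, 4620, 4652, 4684, 4716, 4746, 5325, 5709,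
  5803, 5832, 6058, 6059, 6093, 6670, 6702, 6824, 9421, 9580, 9741, 9742, 11081, 16589, 16748,
  17709, 17710, 17740, 17741, 17992, 18024, 18058, 18091, 18093, 18126, 18732, 18733, 19081,
  19112, 19144, 19401, 19596, 22701, 23213, 26538, 26539, 27273, 27437, 27593]), ([3, 3, 12, 1,
  6], [1606, 1636, 1958, 1989, 2566, 2854, 2855, 3847, 5639, 5894, 18982, 18983]), ([3, 3, 12, 3,
  4], [1542, 1573, 1797, 2822, 5894, 8709, 8741, 8742, 9732, 9734, 9796, 9797, 9828, 9925, 16647,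
  17703, 19815, 21927, 25124, 25158, 25254]), ([3, 3, 12, 5, 2], [16646, 16678, 16708, 16740,
  17671, 17703, 17733, 17861, 18693, 18725, 18758, 19716, 19815, 26022, 26023, 26916]), ([3, 3,
  13, 2, 4], [1572, 1574, 1606, 1636, 1829, 1830, 1958, 1989]), ([3, 3, 13, 4, 2], [16646, 16678,
  16709, 16837, 17670, 17702, 17733, 17861, 18692, 18724, 18758, 19716, 21926, 25926, 26022,
  26916]), ([3, 5, 1, 2, 14], [9310, 9343, 20570, 20574, 20603, 20607, 21594, 21627]), ([3, 5, 1,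
  6, 10], [9296, 9310, 9328, 9343, 20570, 20574, 20603, 20607, 21594, 21627, 24657, 24661, 24692,
  25169, 25684, 26325]), ([3, 5, 1, 10, 6], [1549, 1583, 1673, 1707, 1737, 1931, 1967, 1997,
  2574, 2606, 2607, 3720, 10889, 11145, 13839, 23208]), ([3, 5, 1, 14, 2], [20553, 20584, 21608,
  21934, 21935, 26030, 26031, 28745]), ([3, 5, 2, 1, 14], [4180, 4922, 4923, 5205, 17524, 18133,
  29498, 29499]), ([3, 5, 2, 3, 12], [8311, 8886, 9296, 9302, 9328, 9911, 24657, 25169]), ([3, 5,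
  2, 5, 10], [4190, 6078, 8272, 8278, 8785, 8886, 9302, 9310, 9328, 9343, 9910, 13114, 20570,
  21307, 21627, 22462, 22463, 24657, 24661, 24692, 25684, 25694, 26325, 26558]), ([3, 5, 2, 7,
  8], [8311, 8315, 8886, 9296, 9302, 9328, 9911, 10043, 17498, 18234, 20574, 20607, 22462, 22463,
  24657, 25169]), ([3, 5, 2, 9, 6], [2606, 2607, 2636, 2637, 2696, 2728, 2892, 3599, 3948, 3979,
  10123, 10155, 10889, 11145, 13838, 17996, 17997, 22221, 22349, 22443, 26286, 26287, 26446,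
  26479]), ([3, 5, 2, 11, 4], [2574, 2606, 2636, 2735, 3599, 3692, 17996, 18028, 18991, 22221,
  22349, 23214, 26317, 26445, 26446, 26479]), ([3, 5, 2, 13, 2], [16458, 16491, 17706, 17707,
  20552, 20553, 20584, 20809, 21934, 21935, 26030, 26031]), ([3, 5, 3, 2, 12], [4182, 4190, 4223,
  5814, 17527, 18103, 26558, 26559]), ([3, 5, 3, 4, 10], [4208, 4689, 5200, 8282, 9309, 9340,
  10043, 12380, 12412, 13114, 13405, 14301, 17531, 18234, 20561, 20570, 20572, 21307, 21627,
  22493]), ([3, 5, 3, 6, 8], [4188, 4215, 4220, 5558, 5559, 5589, 5815, 5909, 5973, 10037, 10070,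
  10103, 11063, 17494, 18102, 18196, 18228, 18260, 18292, 19222, 19254, 20247, 25693, 26589]),
  ([3, 5, 3, 8, 6], [2572, 2574, 2605, 2607, 2632, 2697, 2698, 2700, 2728, 2733, 3596, 3599,
  3688, 3723, 3724, 9898, 9899, 10026, 10027, 10889, 17993, 18218, 18219, 18249, 18989, 18990,
  23208, 23213, 26286, 26287, 26446, 26479]), ([3, 5, 3, 10, 4], [4620, 4652, 4653, 4684, 4686,
  4716, 4719, 9741, 9805, 10189, 10766, 10798, 11791, 26542, 26543, 27183]), ([3, 5, 3, 12, 2],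
  [16462, 16495, 16814, 16815, 17480, 17481, 17512, 17737, 21578, 21611, 21934, 21935, 25678,
  25711, 28970, 28971]), ([3, 5, 6, 1, 10], [4177, 4180, 4186, 4190, 4219, 4223, 4689, 5205,
  17524, 18133, 20561, 21073, 25694, 25727, 29498, 29499]), ([3, 5, 6, 3, 8], [8282, 8315, 9308,
  9309, 10394, 10426, 12187, 14267, 17563, 17595, 18234, 18235, 18330, 18362, 18585, 18649,
  19353, 19417, 19608, 19704, 20604, 21720, 22493, 22712]), ([3, 5, 6, 8, 3], [16523, 16554,
  16585, 16616, 16814, 16815, 17486, 17519, 17546, 17579, 17608, 17865, 18568, 18825, 18826,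
  20553, 20584, 21576, 21931, 22696, 25995, 26026, 26761, 29001]), ([3, 5, 6, 9, 2], [1230, 1324,
  1356, 1358, 5646, 5806, 16460, 16686, 16687, 16751, 16845, 17485, 17516, 17548, 17581, 17582,
  17614, 17647, 17708, 17709, 17775, 18572, 18605, 18638, 18734, 18735, 19820, 20553, 20584,
  21581, 21608, 21709, 21743, 21965, 25676, 25708, 25805, 25964, 26924, 26925, 28745]), ([3, 5,
  7, 2, 8], [4178, 4186, 4219, 4223, 4659, 4922, 4923, 5235, 5814, 5815, 6079, 17494, 17527,
  21042, 25694, 26558]), ([3, 5, 7, 8, 2], [4616, 4617, 4648, 4649, 4680, 4681, 4682, 4712, 4715,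
  4906, 4907, 4937, 5642, 5643, 5805, 5806, 5807, 5838, 5871, 9933, 10028, 10061, 11055, 18060,
  18221, 18254, 18287, 19246, 19276, 20332, 21034, 21035]), ([3, 5, 8, 3, 6], [1245, 1417, 1852,
  1886, 2188, 2221, 2264, 2265, 2308, 2309, 2341, 2348, 2822, 2854, 2855, 3033, 4170, 4172, 4178,
  4180, 4394, 4658, 4659, 4922, 4923, 5194, 5197, 5235, 5336, 5894, 8308, 8337, 8381, 8400, 8432,
  8447, 8785, 8849, 8963, 9296, 9324, 9328, 9332, 9343, 9360, 9370, 9392, 9406, 9677, 10019,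
  10045, 10046, 10047, 10052, 10175, 10532, 10533, 10540, 10541, 10633, 11071, 12156, 12370,
  12586, 13394, 14247, 14266, 16456, 16457, 16521, 16585, 16616, 16810, 16811, 17492, 17512,
  17544, 17576, 17597, 17609, 17629, 17630, 17640, 17667, 17699, 17737, 17801, 17802, 17803,
  18237, 18268, 18568, 18569, 18570, 18623, 18825, 19260, 19261, 19263, 19612, 19851, 20351,
  20552, 20556, 20570, 20574, 20584, 20588, 20603, 21306, 21307, 21931, 22462, 22696, 22699,
  22717, 24657, 24660, 24661, 24692, 24722, 24723, 24754, 24755, 24785, 25297, 25676, 25708,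
  25738, 25771, 25994, 26026, 26258, 26259, 26290, 26291, 26325, 26841, 27430, 27431, 27609,
  28745, 29001, 29498, 29499]), ([3, 5, 9, 2, 6], [1224, 1286, 2350, 4223, 5210, 5243, 5640,
  5800, 6079, 8274, 8276, 8277, 8308, 8755, 8917, 9331, 9364, 9392, 9398, 9399, 9733, 9814, 9847,
  10421, 10542, 10804, 10806, 11412, 11511, 13394, 13424, 13559, 13827, 16456, 16462, 16495,
  16521, 16523, 16555, 16686, 16713, 16778, 16811, 17481, 17512, 17544, 17546, 17578, 17710,
  17801, 17802, 17835, 17838, 17839, 18568, 18600, 18727, 18756, 18766, 19236, 19688, 19812,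
  19823, 20553, 20584, 21576, 21736, 24662, 24758, 24789, 25138, 25140, 25141, 25172, 25174,
  25270, 25678, 25694, 25711, 25719, 25746, 25770, 25774, 25783, 25813, 25956, 26030, 26031,
  26053, 26196, 26198, 26231, 26295, 26558, 26761, 26919, 27017, 27189, 27190, 29001, 29219,
  29235, 29265, 29498, 29499]), ([3, 5, 10, 1, 6], [2565, 2596, 2598, 2854, 2855, 3847, 3940,
  5638, 5639, 5894, 6661, 7109, 18980, 18983, 26468, 26565]), ([3, 5, 10, 3, 4], [8710, 8742,
  8807, 8871, 9735, 9798, 9894, 10757, 10789, 11780, 25127, 25157, 25188, 26180, 26309, 27172]),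
  ([3, 5, 10, 5, 2], [16676, 16677, 16709, 16710, 16740, 16806, 17668, 17669, 17733, 17764,
  17767, 17831, 18693, 18725, 18726, 18758, 19716, 19719, 19815, 21767, 21926, 21927, 26916,
  26918]), ([3, 5, 11, 2, 4], [1572, 1574, 1606, 1636, 1829, 1830, 1958, 1989, 2566, 2598, 2599,
  3847, 5639, 5894, 27430, 27431]), ([3, 5, 11, 4, 2], [16647, 16679, 16710, 16806, 17670, 17702,
  17767, 17831, 18692, 18724, 18757, 19716, 19719, 19815, 21766, 21926, 22981, 25925, 25926,
  26023, 26053, 26916, 26918, 26919]), ([3, 5, 14, 1, 2], [16454, 16487, 17574, 17575, 25668,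
  25669, 25700, 25797]), ([3, 7, 1, 2, 12], [1113, 1136, 1148, 1719]), ([3, 7, 1, 4, 10], [1136,
  1719, 9310, 10175, 13114, 20574, 20603, 21306, 21627, 22463]), ([3, 7, 1, 6, 8], [8272, 8273,
  8276, 8277, 8282, 9296, 9300, 9301, 9340, 10043, 10205, 17498, 18235, 20604, 22493, 24657]),
  ([3, 7, 1, 8, 6], [2572, 2573, 2604, 2605, 2698, 2730, 3599, 3720, 9867, 9899, 10889, 11145,
  13838, 18990, 18991, 23208]), ([3, 7, 1, 10, 4], [2700, 2733, 2860, 2861, 3599, 3692, 3823,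
  13838, 15309, 17996, 17997, 18990, 18991, 22222, 27438, 27439]), ([3, 7, 1, 12, 2], [16458,
  16683, 17482, 17707, 20556, 21581, 25676, 25677]), ([3, 7, 3, 4, 8], [1104, 1109, 1116, 1144,
  4180, 4186, 4923, 5205, 5210, 17492, 17493, 29499]), ([3, 7, 3, 8, 4], [1548, 1583, 1612, 1647,
  1706, 1736, 1929, 1930, 2572, 2697, 2735, 2892, 2894, 2953, 3723, 9899, 10155, 10551, 10558,
  11145, 14254, 14255, 14861, 16461, 16492, 17997, 17998, 18028, 18031, 20552, 20584, 20770,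
  22349, 23211, 26286, 26317, 26476, 26479]), ([3, 7, 5, 2, 8], [4182, 4211, 4219, 4223, 4658,
  4922, 5235, 5243, 5815, 6078, 17494, 18103, 21042, 25727, 26558, 29498]), ([3, 7, 5, 8, 2],
  [2568, 2569, 2600, 2601, 2636, 2637, 2700, 2733, 2860, 2861, 3599, 3691, 3720, 3823, 3979,
  10026, 10122, 10154, 10889, 11145, 13838, 17994, 18028, 18219, 18381, 18990, 18991, 22222,
  22443, 23208, 27438, 27439]), ([3, 7, 9, 2, 4], [2628, 2629, 2886, 3687, 3940, 5798, 6055,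
  7109, 17990, 18020, 18087, 18117, 26436, 26437, 26471, 26534]), ([3, 7, 9, 4, 2], [16644,
  16647, 16677, 16678, 16708, 16806, 16807, 16837, 17669, 17670, 17700, 17703, 17733, 17734,
  17764, 17767, 18693, 18724, 18726, 18757, 18758, 19716, 21766, 21767, 21926, 22981, 25924,
  25956, 25959, 26023, 26917, 26919]), ([3, 13, 1, 2, 6], [10018, 10019, 10114, 10147, 18210,
  18211, 21378, 22435]), ([3, 13, 1, 6, 2], [16642, 16675, 17666, 17699, 20866, 20867, 25986,
  25987]), ([3, 13, 2, 1, 6], [4642, 4643, 4995, 6051, 21026, 21027, 26498, 26530]), ([3, 13, 2,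
  3, 4], [12802, 12803, 12834, 12835, 25218, 25251, 26243, 26274]), ([3, 13, 2, 5, 2], [16642,
  16675, 16770, 16802, 17666, 17699, 17795, 17827, 20867, 21923, 25986, 26018]), ([3, 13, 3, 2,
  4], [4610, 4642, 5635, 6050, 6051, 21027, 26498, 26499]), ([3, 13, 3, 4, 2], [16642, 16674,
  16770, 16802, 17667, 17699, 17795, 17827, 20738, 20739, 20770, 20771, 20866, 21923, 25987,
  26018]), ([3, 13, 6, 1, 2], [16514, 16546, 17539, 17571, 24706, 24707, 25762, 25763]), ([3, 15,
  1, 2, 4], [1539, 1666, 1794, 1955]), ([3, 15, 1, 4, 2], [16643, 16675, 16770, 16802, 17667,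
  17699, 17794, 17826]), ([7, 1, 1, 2, 14], [10301, 12349, 14399, 22590]), ([7, 1, 1, 6, 10],
  [1330, 1331, 1334, 1335, 1392, 1396, 1873, 2005]), ([7, 1, 1, 10, 6], [1608, 1610, 1643, 1737,
  1768, 1865, 1930, 1931]), ([7, 1, 1, 14, 2], [18473, 18475, 20520, 20523]), ([7, 1, 2, 1, 14],
  [4156, 6199, 6207, 18487]), ([7, 1, 2, 3, 12], [12349, 18494, 20538, 22585]), ([7, 1, 2, 5,
  10], [4144, 4154, 6192, 8246, 10292, 12339, 14385, 18488, 18490, 18492, 18494, 28731]), ([7, 1,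
  2, 7, 8], [1366, 1392, 1396, 1810, 1843, 1873, 1975, 2005]), ([7, 1, 2, 9, 6], [1608, 1610,
  1643, 1674, 1676, 1707, 1709, 1737, 1741, 1768, 1865, 1900]), ([7, 1, 2, 11, 4], [1547, 1578,
  1610, 1643, 1674, 1707, 1930, 1931]), ([7, 1, 2, 13, 2], [16425, 16431, 18475, 18479, 20520,
  20523]), ([7, 1, 3, 2, 12], [6199, 6207, 18485, 26684]), ([7, 1, 3, 4, 10], [6199, 8248, 10298,
  10301, 12347, 12349, 14399, 18485, 22585, 22590]), ([7, 1, 3, 6, 8], [10289, 10292, 10295,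
  10299, 12336, 12338, 12346, 14398, 18488, 18493, 20536, 20540, 22590, 24627, 24629, 26678]),
  ([7, 1, 3, 8, 6], [1608, 1610, 1612, 1643, 1676, 1709, 1711, 1737, 1768, 1865, 1870, 1930,
  1931, 1966, 1967, 1997]), ([7, 1, 3, 10, 4], [1547, 1550, 1578, 1583, 1610, 1643, 1674, 1676,
  1707, 1709, 1741, 1900, 1930, 1931, 1966, 1967]), ([7, 1, 3, 12, 2], [16426, 16428, 18472,
  18478, 20522, 20524, 22568, 22574]), ([7, 1, 6, 1, 10], [1170, 1171, 1208, 1232, 1233, 1240,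
  1241, 1945]), ([7, 1, 6, 3, 8], [4147, 6193, 6198, 10299, 10393, 11161, 11162, 12187, 12346,
  14266, 14267, 14399, 18330, 18331, 18362, 18363, 18486, 18488, 18494, 18584, 18585, 18616,
  19353, 19608, 22585, 22712]), ([7, 1, 6, 8, 3], [1546, 1551, 1579, 1582, 1612, 1672, 1676,
  1709, 1710, 1736, 1834, 1835, 1903, 1929, 1993, 1997, 5646, 5647, 10766, 10798, 10799, 11791,
  20522, 21068, 21100, 22093, 22477, 22568, 26188, 26189, 26220, 26573, 27182, 27183]), ([7, 1,
  6, 9, 2], [16427, 16428, 16520, 16521, 16552, 16777, 17544, 17545, 17576, 17801, 18474, 18479,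
  18632, 18633, 18889, 19688, 20525, 21704, 21736, 26670, 26825, 27081]), ([7, 1, 7, 2, 8],
  [1168, 1169, 1170, 1171, 1240, 1241, 1946, 1979]), ([7, 1, 7, 8, 2], [16424, 16429, 16524,
  16557, 16684, 16685, 17548, 17581, 17708, 17709, 18474, 18479, 18607, 18766, 19823, 20523,
  20524, 22568, 22574, 22702, 25774, 25775, 25934, 25967]), ([7, 1, 8, 3, 6], [1546, 1547, 1550,
  1551, 1644, 1673, 1742, 1835, 1839, 1869, 1900, 1929, 1997, 4136, 4144, 4147, 4154, 4156, 4618,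
  4619, 4650, 4651, 4680, 4681, 4712, 4937, 5642, 5643, 5736, 5864, 6622, 6718, 6719, 7679, 8240,
  8242, 8249, 9693, 9694, 9727, 9820, 9821, 9852, 10026, 10301, 10303, 12330, 12873, 13098,
  16426, 18218, 18489, 18600, 19592, 19596, 19716, 20523, 20524, 20537, 20539, 21034, 21035,
  21084, 21116, 21290, 21981, 22109, 22574, 23102, 23103, 24629, 25924, 25934, 26538, 26679,
  26686, 27017, 27337, 28731, 29482]), ([7, 1, 9, 2, 6], [4137, 4140, 4145, 4147, 6191, 6199,
  8249, 8348, 8381, 9406, 9407, 10044, 10045, 10078, 10111, 12330, 12349, 16427, 16428, 16589,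
  16590, 16623, 16686, 16687, 16716, 16717, 16748, 17564, 17597, 17613, 17614, 17647, 17710,
  17711, 17740, 17741, 17772, 18236, 18237, 18473, 18479, 18485, 18490, 18495, 18623, 19294,
  20351, 20523, 20538, 20541, 22569, 22584, 22591, 22718, 26669, 26671]), ([7, 1, 10, 1, 6],
  [1572, 1573, 1574, 1575, 1860, 1958, 1959, 1989]), ([7, 1, 10, 3, 4], [1606, 1636, 1703, 1733,
  1796, 1797, 1862, 1959, 8964, 8965, 10020, 10021, 10054, 10087, 10150, 10151, 18180, 18181,
  18212, 18213, 19270, 20327, 22438, 22439]), ([7, 1, 10, 5, 2], [16646, 16647, 16678, 16679,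
  16708, 16709, 16740, 16837, 17670, 17671, 17702, 17703, 17732, 17733, 17764, 17861]), ([7, 1,
  11, 2, 4], [1574, 1575, 1606, 1703, 1796, 1829, 1860, 1989]), ([7, 1, 11, 4, 2], [16646, 16647,
  16678, 16679, 17670, 17671, 17702, 17703, 18758, 19815, 21926, 21927, 25926, 25959, 26022,
  26023]), ([7, 1, 14, 1, 2], [18468, 18471, 26660, 26662]), ([7, 3, 1, 2, 12], [2099, 2103,
  2105, 2110]), ([7, 3, 1, 4, 10], [2099, 2101, 8249, 10299, 12349, 14398, 18488, 18490, 18492,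
  18494]), ([7, 3, 1, 6, 8], [1296, 1297, 1330, 1331, 1332, 1333, 1334, 1335, 1366, 1392, 1396,
  1810, 1843, 1873, 1975, 2005]), ([7, 3, 1, 8, 6], [1545, 1547, 1576, 1578, 1608, 1610, 1643,
  1676, 1709, 1711, 1741, 1838, 1839, 1865, 1870, 1900]), ([7, 3, 1, 10, 4], [1545, 1547, 1576,
  1578, 1608, 1610, 1643, 1673, 1674, 1704, 1707, 1737, 1768, 1865, 1930, 1931]), ([7, 3, 1, 12,
  2], [16425, 16426, 16428, 16431, 18473, 18475, 18476, 18479]), ([7, 3, 3, 4, 8], [2099, 2103,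
  2105, 2110, 4148, 4156, 6199, 6207, 18485, 18487, 26684, 26686]), ([7, 3, 3, 8, 4], [1545,
  1547, 1548, 1549, 1576, 1578, 1608, 1610, 1612, 1643, 1672, 1737, 1768, 1865, 1929, 1997, 2572,
  2573, 2604, 2605, 2698, 2730, 3596, 3723, 9866, 9867, 9898, 9899, 14861, 18478, 18988, 18989,
  20522, 22569, 23211]), ([7, 3, 5, 2, 8], [1168, 1169, 1170, 1171, 1208, 1210, 1211, 1232, 1233,
  1240, 1241, 1682, 1715, 1945, 1946, 1979]), ([7, 3, 5, 8, 2], [1546, 1547, 1548, 1549, 1576,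
  1577, 1582, 1583, 1610, 1640, 1644, 1647, 1672, 1673, 1706, 1707, 1709, 1741, 1742, 1768, 1835,
  1836, 1839, 1865, 1868, 1870, 1903, 1930, 1963, 1966, 1993, 1997]), ([7, 3, 9, 2, 4], [1572,
  1573, 1574, 1575, 1606, 1636, 1703, 1733, 1796, 1799, 1829, 1830, 1860, 1958, 1959, 1989]),
  ([7, 3, 9, 4, 2], [16644, 16645, 16676, 16677, 16710, 16743, 16806, 16807, 17668, 17669, 17700,
  17701, 17734, 17767, 17830, 17831, 18694, 18726, 18727, 18756, 18757, 19719, 19812, 21766,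
  21767, 22981, 25924, 25925, 25956, 26053, 26918, 26919]), ([7, 7, 1, 2, 8], [1136, 1148, 1617,
  2013, 2101, 2103, 2105, 2106]), ([7, 7, 1, 8, 2], [16428, 16431, 16460, 16461, 16492, 16845,
  17484, 17485, 17516, 17869, 18476, 18478, 20521, 20522, 20552, 20553, 20584, 20809, 21576,
  21608, 22569, 28715, 28745, 29001]), ([7, 7, 8, 1, 2], [2089, 2090, 2097, 2099, 2108, 2110,
  4141, 4149, 4152, 4154, 4172, 4180, 4186, 4204, 4212, 4219, 4922, 4923, 5197, 5205, 5210, 5243,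
  5581, 5845, 6191, 6199, 6200, 9292, 9293, 9324, 9677, 10284, 10287, 17492, 17493, 17524, 18133,
  18485, 18486, 28731, 29498, 29499]), ([7, 9, 1, 2, 6], [2092, 2097, 2099, 2105, 2106, 4137,
  4138, 4152, 4155, 4186, 4215, 4219, 4922, 4923, 5210, 5243, 5814, 6184, 6191, 6200, 8241, 8243,
  8272, 8273, 8304, 8311, 8785, 8886, 9296, 9328, 9335, 9910, 10287, 10288, 12330, 16430, 16456,
  16457, 16488, 16713, 17480, 17481, 17512, 17527, 17737, 18102, 18478, 20520, 20523, 20525,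
  20558, 20591, 21934, 21935, 21943, 22295, 22569, 24627, 24628, 24631, 24657, 24660, 25169,
  25218, 25678, 25685, 25686, 25711, 26030, 26031, 26274, 26669, 26676, 26679, 28715, 28730,
  29498, 29499]), ([7, 11, 1, 2, 4], [1539, 1570, 1666, 1667, 1794, 1827, 1954, 1955]), ([7, 11,
  1, 4, 2], [16642, 16643, 16674, 16675, 17666, 17667, 17698, 17699, 20866, 20867, 21922, 21923,
  25986, 25987, 26018, 26019]), ([15, 1, 1, 2, 6], [8961, 11073, 13121, 23297]), ([15, 1, 1, 6,
  2], [16769, 18817, 20737, 22785]), ([15, 1, 2, 1, 6], [4737, 19073, 27521, 27585]), ([15, 1, 2,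
  3, 4], [13121, 13185, 19393, 21249]), ([15, 1, 2, 5, 2], [18817, 18881, 20737, 22785, 27009,
  27073]), ([15, 1, 3, 2, 4], [4737, 4993, 19137, 27585]), ([15, 1, 3, 4, 2], [16641, 16769,
  18753, 18881, 20737, 27009, 27073, 28993]), ([15, 1, 6, 1, 2], [16577, 18561, 24705, 26817]),
  ([15, 3, 1, 2, 4], [2561, 2753, 2881, 3009]), ([15, 3, 1, 4, 2], [16769, 16833, 18817, 18881,
  20737, 20801, 22785, 28993])]

/-- The monomials in `B_4(3,3,2,1)`, as monomials in five variables, with spike functionals that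
detect them. -/
noncomputable def cert3321Four : List (List ℕ × List ℕ) := [
  ([0, 3, 7, 15, 0], [5359]), ([0, 3, 15, 7, 0], [3428]), ([0, 7, 3, 15, 0], [4174]), ([0, 7, 7,
  11, 0], [4174, 12587]), ([0, 7, 11, 7, 0], [3428, 9542]), ([0, 7, 15, 3, 0], [8295]), ([0, 15,
  3, 7, 0], [9603]), ([0, 15, 7, 3, 0], [9346]), ([1, 2, 7, 15, 0], [5359, 10543]), ([1, 2, 15,
  7, 0], [3428, 9669]), ([1, 3, 6, 15, 0], [2254, 5359]), ([1, 3, 7, 14, 0], [2254, 2351]), ([1,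
  3, 14, 7, 0], [2372, 9669]), ([1, 3, 15, 6, 0], [5542, 9542]), ([1, 6, 3, 15, 0], [4203,
  12587]), ([1, 6, 7, 11, 0], [4174, 4203, 4207, 12587]), ([1, 6, 11, 7, 0], [2372, 3428, 9542,
  9575]), ([1, 6, 15, 3, 0], [8260, 8389]), ([1, 7, 2, 15, 0], [4170, 12587]), ([1, 7, 3, 14, 0],
  [4207, 9646]), ([1, 7, 6, 11, 0], [4170, 5550, 9646, 12587]), ([1, 7, 7, 10, 0], [4203, 4207,
  4394, 9646]), ([1, 7, 10, 7, 0], [2372, 2374, 9575, 9669]), ([1, 7, 11, 6, 0], [2372, 5542,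
  9542, 9572]), ([1, 7, 14, 3, 0], [8260, 9285]), ([1, 7, 15, 2, 0], [8295, 9319]), ([1, 14, 3,
  7, 0], [4482, 9603]), ([1, 14, 7, 3, 0], [8355, 9346]), ([1, 15, 2, 7, 0], [4483, 9603]), ([1,
  15, 3, 6, 0], [4483, 9635]), ([1, 15, 6, 3, 0], [9346, 9378]), ([1, 15, 7, 2, 0], [8322,
  9346]), ([3, 0, 7, 15, 0], [1160]), ([3, 0, 15, 7, 0], [1286]), ([3, 1, 6, 15, 0], [1160,
  1419]), ([3, 1, 7, 14, 0], [1160, 1194]), ([3, 1, 14, 7, 0], [1286, 1348]), ([3, 1, 15, 6, 0],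
  [1286, 1350]), ([3, 3, 4, 15, 0], [1160, 1419, 5546, 5547, 9642, 9643]), ([3, 3, 5, 14, 0],
  [1160, 1194, 1256, 1419]), ([3, 3, 7, 12, 0], [1224, 1450, 2216, 2441, 3208, 10377]), ([3, 3,
  12, 7, 0], [1348, 1350, 3428, 6597, 9572, 9669]), ([3, 3, 13, 6, 0], [2372, 2373, 9572, 9669]),
  ([3, 3, 15, 4, 0], [1286, 1350, 2373, 3428, 9540, 9669]), ([3, 5, 2, 15, 0], [4170, 4203,
  12586, 12587]), ([3, 5, 3, 14, 0], [4170, 4203, 4394, 4395]), ([3, 5, 6, 11, 0], [4170, 4174,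
  4203, 5550, 9294, 9646, 12586, 12587]), ([3, 5, 7, 10, 0], [4170, 4174, 4203, 4207, 4394, 4395,
  9646, 9647]), ([3, 5, 10, 7, 0], [2372, 2374, 5542, 6597, 9540, 9575, 9639, 9669]), ([3, 5, 11,
  6, 0], [1284, 1286, 1348, 1350, 2372, 2373, 9572, 9669]), ([3, 5, 14, 3, 0], [8262, 8295, 9382,
  9383]), ([3, 5, 15, 2, 0], [8262, 8295, 9286, 9319]), ([3, 7, 0, 15, 0], [1131]), ([3, 7, 1,
  14, 0], [1131, 1454]), ([3, 7, 3, 12, 0], [1131, 1454, 4207, 5550, 9327, 9646]), ([3, 7, 5, 10,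
  0], [4170, 4207, 4395, 5194, 5550, 9327, 9646, 12587]), ([3, 7, 7, 8, 0], [1100, 1128, 1161,
  1194, 1224, 1451, 2186, 2248, 3467, 4395, 5352, 5546, 6315, 10441, 10697, 12586]), ([3, 7, 9,
  6, 0], [2372, 2373, 3431, 5542, 9542, 9572, 9639, 9669]), ([3, 7, 11, 4, 0], [1286, 1317, 1349,
  1350, 2309, 2310, 2341, 5542, 6405, 8295, 9383, 9638, 10533, 10534]), ([3, 7, 13, 2, 0], [8262,
  8359, 9286, 9383]), ([3, 7, 15, 0, 0], [1094]), ([3, 13, 2, 7, 0], [4482, 4483, 9602, 9603]),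
  ([3, 13, 3, 6, 0], [4482, 4483, 9634, 9635]), ([3, 13, 6, 3, 0], [8323, 8355, 9346, 9378]),
  ([3, 13, 7, 2, 0], [8322, 8355, 9346, 9379]), ([3, 15, 0, 7, 0], [1411]), ([3, 15, 1, 6, 0],
  [1314, 1411]), ([3, 15, 3, 4, 0], [1314, 1411, 4483, 5539, 9603, 9635]), ([3, 15, 5, 2, 0],
  [8322, 8354, 9346, 9378]), ([3, 15, 7, 0, 0], [1154]), ([7, 0, 3, 15, 0], [6184]), ([7, 0, 7,
  11, 0], [6184, 6190]), ([7, 0, 11, 7, 0], [1348, 1477]), ([7, 0, 15, 3, 0], [10277]), ([7, 1,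
  2, 15, 0], [6190, 10287]), ([7, 1, 3, 14, 0], [6190, 10285]), ([7, 1, 6, 11, 0], [4139, 6184,
  6190, 10287]), ([7, 1, 7, 10, 0], [6184, 6190, 10285, 12331]), ([7, 1, 10, 7, 0], [1286, 1319,
  1348, 1477]), ([7, 1, 11, 6, 0], [1284, 1317, 1348, 1477]), ([7, 1, 14, 3, 0], [10277, 10279]),
  ([7, 1, 15, 2, 0], [8229, 10277]), ([7, 3, 0, 15, 0], [2095]), ([7, 3, 1, 14, 0], [2089,
  2095]), ([7, 3, 3, 12, 0], [2089, 2095, 4140, 6190, 10285, 10287]), ([7, 3, 5, 10, 0], [4137,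
  4139, 4140, 6184, 6190, 10285, 10287, 12331]), ([7, 3, 7, 8, 0], [1162, 1163, 1419, 1450, 2091,
  2092, 2248, 2249, 2505, 3304, 4137, 4139, 5320, 5352, 10441, 10697]), ([7, 3, 9, 6, 0], [1284,
  1286, 1317, 1319, 1348, 1350, 1383, 1477]), ([7, 3, 11, 4, 0], [1284, 1285, 1348, 1477, 2308,
  2309, 2340, 2341, 3332, 6405, 10278, 10532, 10533]), ([7, 3, 13, 2, 0], [8229, 8231, 10277,
  10279]), ([7, 3, 15, 0, 0], [2085]), ([7, 7, 0, 11, 0], [1135, 1454]), ([7, 7, 1, 10, 0],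
  [1131, 1135, 1322, 1454]), ([7, 7, 3, 8, 0], [2093, 2094, 4137, 4138, 4170, 4203, 4394, 4395,
  5194, 5227, 6185, 12330, 12586, 12587]), ([7, 7, 8, 3, 0], [1316, 1317, 1318, 1319, 1348, 1349,
  1383, 1446, 2308, 2309, 2310, 2340, 2341, 2342, 2343, 3332, 3335, 5382, 5383, 6405, 10532,
  10533, 10534, 10535]), ([7, 7, 9, 2, 0], [8229, 8231, 8262, 8295, 8358, 8359, 9286, 9319, 9382,
  9383, 10276, 10279]), ([7, 7, 11, 0, 0], [2085, 2087]), ([7, 9, 3, 6, 0], [2084, 2087, 2088,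
  2091, 2093, 2094, 4137, 4138, 4140, 4170, 4174, 4203, 4207, 4394, 4395, 5194, 5227, 5550, 5551,
  6185, 6190, 8229, 8231, 8262, 8295, 8358, 8359, 9286, 9294, 9319, 9327, 9382, 9383, 9646, 9647,
  10276, 10279, 10285, 10286, 12330, 12586, 12587]), ([7, 11, 0, 7, 0], [1314, 1315]), ([7, 11,
  1, 6, 0], [1314, 1315, 1411, 1442]), ([7, 11, 3, 4, 0], [1314, 1315, 1411, 1442, 4482, 4483,
  5538, 5539, 9602, 9603, 9634, 9635]), ([7, 11, 5, 2, 0], [8322, 8323, 8354, 8355, 9346, 9347,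
  9378, 9379]), ([7, 11, 7, 0, 0], [1154, 1187]), ([7, 15, 0, 3, 0], [8227]), ([7, 15, 1, 2, 0],
  [8227, 12322]), ([7, 15, 3, 0, 0], [4131]), ([15, 0, 3, 7, 0], [6401]), ([15, 0, 7, 3, 0],
  [10369]), ([15, 1, 2, 7, 0], [4417, 6401]), ([15, 1, 3, 6, 0], [4353, 4417]), ([15, 1, 6, 3,
  0], [8385, 10369]), ([15, 1, 7, 2, 0], [8321, 10369]), ([15, 3, 0, 7, 0], [2369]), ([15, 3, 1,
  6, 0], [2369, 2497]), ([15, 3, 3, 4, 0], [2369, 2497, 4353, 4417, 6401, 12609]), ([15, 3, 5, 2,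
  0], [8321, 8385, 10369, 10433]), ([15, 3, 7, 0, 0], [2177]), ([15, 7, 0, 3, 0], [8257]), ([15,
  7, 1, 2, 0], [8257, 12353]), ([15, 7, 3, 0, 0], [4161])]

/-- Monomials with the weight vector `(2,2,1)`, with spike functionals that detect them. -/
noncomputable def cert221 : List (List ℕ × List ℕ) := [
  ([1, 1, 2, 2, 4], [181, 186, 187, 247, 564, 566, 923, 954]), ([1, 1, 2, 4, 2], [525, 526, 556,
  559, 649, 650, 680, 683]), ([1, 2, 1, 2, 4], [85, 88, 93, 115, 563, 725, 857, 989]), ([1, 2, 1,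
  4, 2], [526, 527, 556, 557, 744, 906, 939, 969]), ([1, 2, 4, 1, 2], [580, 581, 582, 679, 868,
  871, 934, 965])]

/-- Monomials with the weight vector `(4,1,1)`, with spike functionals that detect them. -/
noncomputable def cert411 : List (List ℕ × List ℕ) := [
  ([1, 1, 1, 1, 6], [133171, 133181]), ([1, 1, 1, 2, 5], [133171, 133433, 266328]), ([1, 1, 1, 3,
  4], [141365, 264250, 657468, 804919]), ([1, 1, 1, 6, 1], [149545, 528427]), ([1, 1, 2, 1, 5],
  [264241, 266293, 268342]), ([1, 1, 2, 5, 1], [149548, 526378, 673839]), ([1, 1, 3, 1, 4],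
  [141360, 268469, 281140, 790579]), ([1, 1, 3, 4, 1], [149545, 526509, 528427, 657964]), ([1, 1,
  6, 1, 1], [264741, 532548]), ([1, 2, 1, 1, 5], [264756, 403511, 805429]), ([1, 2, 1, 5, 1],
  [528425, 657962, 674347]), ([1, 2, 5, 1, 1], [264741, 534566, 805412]), ([1, 3, 1, 1, 4],
  [133169, 133171, 133177, 133179]), ([1, 3, 1, 4, 1], [526377, 526378, 657452, 657454]), ([1, 3,
  4, 1, 1], [264741, 264742, 532548, 532647]), ([1, 6, 1, 1, 1], [283170, 532643]), ([3, 1, 1, 1,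
  4], [133170, 133171, 133176, 133177]), ([3, 1, 1, 4, 1], [526376, 526377, 657454, 657455]),
  ([3, 1, 4, 1, 1], [534564, 534565, 804902, 804903])]

/-- Monomials with the weight vector `(4,3)`, with spike functionals that detect them. -/
noncomputable def cert43 : List (List ℕ × List ℕ) := [
  ([1, 1, 2, 3, 3], [45401, 53585]), ([1, 1, 3, 2, 3], [45401, 49353]), ([1, 1, 3, 3, 2], [45401,
  61777]), ([1, 2, 1, 3, 3], [180685, 311373]), ([1, 2, 3, 1, 3], [299865, 585817]), ([1, 2, 3,
  3, 1], [532611, 536649]), ([1, 3, 1, 2, 3], [49481, 61521]), ([1, 3, 1, 3, 2], [41602, 49481]),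
  ([1, 3, 2, 1, 3], [286917, 299865]), ([1, 3, 2, 3, 1], [536649, 561225]), ([1, 3, 3, 1, 2],
  [37721, 53841]), ([1, 3, 3, 2, 1], [532611, 561481]), ([3, 1, 1, 2, 3], [78401, 94529]), ([3,
  1, 1, 3, 2], [78401, 90817]), ([3, 1, 2, 1, 3], [278657, 807489]), ([3, 1, 2, 3, 1], [536897,
  594241]), ([3, 1, 3, 1, 2], [86593, 95041]), ([3, 1, 3, 2, 1], [594241, 598145]), ([3, 3, 1, 1,
  2], [147521, 155713]), ([3, 3, 1, 2, 1], [532545, 667713])]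

/-- The number of rows is the largest entry of the weight vector, as the minors use only the first
`k` rows. Each code packs the rows as base 32 digits, one bit per variable. -/
theorem certCheck_cert3321 : certCheck [3, 3, 2, 1] 3 cert3321 = true := by decide +kernel

theorem certCheck_cert3321Four : certCheck [3, 3, 2, 1] 3 cert3321Four = true := by decide +kernel

theorem certCheck_cert221 : certCheck [2, 2, 1] 2 cert221 = true := by decide +kernel

theorem certCheck_cert411 : certCheck [4, 1, 1] 4 cert411 = true := by decide +kernel

theorem certCheck_cert43 : certCheck [4, 3] 4 cert43 = true := by decide +kernel

end Data

/-! ### Steenrod squares of monomials given by lists -/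

section SquareOfLists

variable {n : ℕ}

/-- The monomials in `Sq^k` of the monomial with the exponents `l`. -/
def sqTerms : ℕ → List ℕ → List (List ℕ)
  | k, [] => if k = 0 then [[]] else []
  | k, a :: l => (List.range (k + 1)).flatMap fun b =>
      if a.choose b % 2 = 1 then (sqTerms (k - b) l).map ((a + b) :: ·) else []

/-- The product of the powers of the variables in a list. -/
noncomputable def powProd : List (Fin n) → List ℕ → P n
  | v :: vs, a :: l => MvPolynomial.X v ^ a * powProd vs l
  | _, _ => 1

theorem sum_map_flatMap_range {M : Type*} [AddCommMonoid M] {α : Type*} (f : α → M)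
    (F : ℕ → List α) (N : ℕ) :
    (((List.range N).flatMap F).map f).sum = ∑ b ∈ range N, ((F b).map f).sum := by
  induction N with
  | zero => simp
  | succ N ih => simp [List.range_succ, sum_range_succ, ih]

theorem Sq_powProd (vs : List (Fin n)) (k : ℕ) (l : List ℕ) (h : vs.length = l.length) :
    Sq k (powProd vs l) = ((sqTerms k l).map (powProd vs)).sum := by
  induction vs generalizing k l with
  | nil =>
    obtain rfl : l = [] := List.length_eq_zero_iff.1 h.symm
    have : Sq k (1 : P n) = if k = 0 then 1 else 0 := by
      rw [Sq, map_one, Polynomial.coeff_one]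
    simp only [sqTerms]
    rw [show powProd [] [] = (1 : P n) from rfl, this]
    split_ifs <;> simp [powProd]
  | cons v vs ih =>
    obtain _ | ⟨a, l⟩ := l
    · simp at h
    simp only [powProd, sqTerms]
    rw [Sq_mul, Finset.Nat.sum_antidiagonal_eq_sum_range_succ
      (fun i j => Sq i (MvPolynomial.X v ^ a : P n) * Sq j (powProd vs l)), sum_map_flatMap_range]
    refine sum_congr rfl fun b _ => ?_
    rw [Sq_X_pow, ih _ _ (by simpa using h)]
    split_ifs with hb
    · rw [← Nat.div_add_mod (a.choose b) 2, hb, Nat.cast_add,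
        natCast_eq_zero_of_even (c := 2 * _) (by simp), Nat.cast_one, zero_add, one_mul,
        ← List.sum_map_mul_left, List.map_map]
      rfl
    · rw [natCast_eq_zero_of_even (by omega)]
      simp

theorem powProd_finRange (x : Mon n) : powProd (List.finRange n) (exps x) = x.toP := by
  have key : ∀ vs : List (Fin n), powProd vs (vs.map x) =
      (vs.map fun i => (MvPolynomial.X i ^ x i : P n)).prod := by
    intro vs
    induction vs with
    | nil => rfl
    | cons v vs ih => simp [powProd, ih]
  rw [exps, List.ofFn_eq_map, key, Mon.toP_eq_prod, ← List.ofFn_eq_map, List.prod_ofFn]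

/-- The monomial with the exponents `l`. -/
noncomputable def ofExps (n : ℕ) (l : List ℕ) : Mon n :=
  Finsupp.equivFunOnFinite.symm fun i => l.getD i 0

theorem exps_ofExps {l : List ℕ} (h : l.length = n) : exps (ofExps n l) = l := by
  subst h
  refine List.ext_getElem (by simp [exps]) fun i hi hi' => ?_
  simp [exps, ofExps]

theorem length_of_mem_sqTerms {k : ℕ} {l t : List ℕ} (h : t ∈ sqTerms k l) :
    t.length = l.length := by
  induction l generalizing k t with
  | nil =>
    rw [sqTerms] at h
    split_ifs at h <;> simp_all
  | cons a l ih =>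
    rw [sqTerms, List.mem_flatMap] at h
    obtain ⟨b, _, h⟩ := h
    split_ifs at h
    · obtain ⟨t', ht', rfl⟩ := List.mem_map.1 h
      simp [ih ht']
    · simp at h

end SquareOfLists

/-! ### A decision procedure for the monomial order -/

section Order

variable {n : ℕ}

/-- The first entries of the weight vector of the monomial with the exponents `l`. -/
def weightList (l : List ℕ) : List ℕ :=
  (List.range 5).map fun d => (l.map fun a => (a.testBit d).toNat).sum

/-- The strict left lexicographical order. -/
def lexLt : List ℕ → List ℕ → Bool
  | a :: l, b :: m => Nat.blt a b || (Nat.beq a b && lexLt l m)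
  | _, _ => false

theorem exists_of_lexLt {l m : List ℕ} (h : lexLt l m = true) :
    ∃ j < l.length, (∀ d < j, l.getD d 0 = m.getD d 0) ∧ l.getD j 0 < m.getD j 0 := by
  induction l generalizing m with
  | nil => simp [lexLt] at h
  | cons a l ih =>
    obtain _ | ⟨b, m⟩ := m
    · simp [lexLt] at h
    simp only [lexLt, Bool.or_eq_true, Nat.blt_eq, Bool.and_eq_true, Nat.beq_eq] at h
    rcases h with h | ⟨rfl, h⟩
    · exact ⟨0, by simp, by simp, by simpa using h⟩
    · obtain ⟨j, hj, h1, h2⟩ := ih h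
      refine ⟨j + 1, by simpa using hj, fun d hd => ?_, by simpa using h2⟩
      cases d with
      | zero => rfl
      | succ d => simpa using h1 d (by omega)

theorem getD_weightList (x : Mon n) {d : ℕ} (hd : d < 5) :
    (weightList (exps x)).getD d 0 = weight x d := by
  have hw : weight x d = ((exps x).map fun a => (a.testBit d).toNat).sum := by
    rw [sum_map_exps, weight_apply, card_filter]
    refine sum_congr rfl fun i _ => ?_
    cases (x i).testBit d <;> rfl
  rw [hw]
  simp [weightList, hd]

theorem length_weightList (l : List ℕ) : (weightList l).length = 5 := by simp [weightList]

/-- A decision procedure for the order on monomials with small exponents. -/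
def lessCheck (l m : List ℕ) : Bool :=
  lexLt (weightList l) (weightList m) ||
    (l.all (fun a => Nat.blt a 32) && m.all (fun a => Nat.blt a 32) &&
      weightList l == weightList m && lexLt l m)

/-- A difference among the first five weights settles the comparison without any bound. If they
agree, exponents below 32 ensure that there are no further weights. -/
theorem less_of_lessCheck {x y : Mon n} (h : lessCheck (exps x) (exps y) = true) : x.Less y := by
  simp only [lessCheck, Bool.or_eq_true, Bool.and_eq_true, List.all_eq_true, Nat.blt_eq,
    beq_iff_eq] at h
  rw [less_iff]
  rcases h with h | ⟨⟨⟨hx, hy⟩, hw⟩, h⟩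
  · obtain ⟨j, hj, h1, h2⟩ := exists_of_lexLt h
    rw [length_weightList] at hj
    rw [getD_weightList x hj, getD_weightList y hj] at h2
    refine Or.inl ⟨j, fun d hd => ?_, h2⟩
    have := h1 d hd
    rwa [getD_weightList x (hd.trans hj), getD_weightList y (hd.trans hj)] at this
  · obtain ⟨j, hj, h1, h2⟩ := exists_of_lexLt h
    rw [length_exps] at hj
    refine Or.inr ⟨?_, ⟨j, hj⟩, fun d hd => ?_, ?_⟩
    · ext d
      by_cases hd : d < 5
      · rw [← getD_weightList x hd, ← getD_weightList y hd, hw]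
      · have h0 : ∀ z : Mon n, (∀ a ∈ exps z, a < 32) → weight z d = 0 := by
          intro z hz
          by_contra h0
          exact hd (lt_of_weight_pos (s := 5) (fun i => hz _ (List.mem_ofFn.2 ⟨i, rfl⟩))
            (Nat.pos_of_ne_zero h0))
        rw [h0 x hx, h0 y hy]
    · have := h1 d hd
      rwa [getD_exps, getD_exps] at this
    · have := h2
      rwa [getD_exps x ⟨j, hj⟩, getD_exps y ⟨j, hj⟩] at this

end Order

/-! ### Strictly inadmissible monomials and digit windows -/

section Windows

/-- Addition of monomials modulo `2`: `t` is removed if it is present. -/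
def toggle (t : List ℕ) (L : List (List ℕ)) : List (List ℕ) :=
  if L.elem t then L.erase t else t :: L

/-- A list `(k, g)` shows that `w + ∑ Sq^k(g)` is a sum of smaller monomials, where `k < 2^s`. -/
def strictCheck (e : ℕ × List ℕ × List (ℕ × List ℕ)) : Bool :=
  e.2.1.length == 4 && e.2.1.all (fun a => Nat.blt a (2 ^ e.1)) &&
  e.2.2.all (fun c => Nat.blt 0 c.1 && Nat.blt c.1 (2 ^ e.1) && c.2.length == 4) &&
  ((e.2.2.flatMap fun c => sqTerms c.1 c.2).foldr toggle [e.2.1]).all fun t =>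
    lessCheck t e.2.1

/-- Strictly inadmissible monomials in four variables. -/
def strictTable : List (ℕ × List ℕ × List (ℕ × List ℕ)) := [

  (2, [0, 0, 2, 1], [(1, [0, 0, 1, 1])]), (2, [0, 2, 0, 1], [(1, [0, 1, 0, 1])]), (2, [0, 2, 1,
  0], [(1, [0, 1, 1, 0])]), (2, [2, 0, 0, 1], [(1, [1, 0, 0, 1])]), (2, [2, 0, 1, 0], [(1, [1,
  0, 1, 0])]), (2, [2, 1, 0, 0], [(1, [1, 1, 0, 0])]), (2, [0, 2, 1, 1], [(1, [0, 1, 1, 1])]),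
  (2, [2, 0, 1, 1], [(1, [1, 0, 1, 1])]), (2, [2, 1, 0, 1], [(1, [1, 1, 0, 1])]), (2, [2, 1, 1,
  0], [(1, [1, 1, 1, 0])]), (2, [1, 2, 2, 1], [(1, [2, 1, 1, 1]), (2, [1, 1, 1, 1])]), (2, [2,
  0, 1, 3], [(1, [1, 0, 1, 3])]), (2, [2, 0, 3, 1], [(1, [1, 0, 3, 1])]), (2, [2, 1, 0, 3], [(1,
  [1, 1, 0, 3])]), (2, [2, 1, 1, 2], [(1, [1, 1, 1, 2])]), (2, [2, 1, 2, 1], [(1, [1, 1, 2,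
  1])]), (2, [2, 1, 3, 0], [(1, [1, 1, 3, 0])]), (2, [2, 2, 1, 1], [(1, [2, 1, 1, 1])]), (2, [2,
  3, 0, 1], [(1, [1, 3, 0, 1])]), (2, [2, 3, 1, 0], [(1, [1, 3, 1, 0])]), (2, [3, 0, 2, 1], [(1,
  [3, 0, 1, 1])]), (2, [3, 2, 0, 1], [(1, [3, 1, 0, 1])]), (2, [3, 2, 1, 0], [(1, [3, 1, 1,
  0])]), (2, [2, 1, 1, 3], [(1, [1, 1, 1, 3])]), (2, [2, 1, 3, 1], [(1, [1, 1, 3, 1])]), (2, [2,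
  3, 1, 1], [(1, [1, 3, 1, 1])]), (2, [3, 2, 1, 1], [(1, [3, 1, 1, 1])]), (2, [2, 1, 3, 3], [(1,
  [1, 1, 3, 3])]), (2, [2, 3, 1, 3], [(1, [1, 3, 1, 3])]), (2, [2, 3, 3, 1], [(1, [1, 3, 3,
  1])]), (2, [3, 2, 1, 3], [(1, [3, 1, 1, 3])]), (2, [3, 2, 3, 1], [(1, [3, 1, 3, 1])]), (2, [3,
  3, 2, 1], [(1, [3, 3, 1, 1])]), (2, [2, 2, 3, 3], [(1, [1, 2, 3, 3])]), (2, [2, 3, 2, 3], [(1,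
  [1, 3, 2, 3])]), (2, [2, 3, 3, 2], [(1, [1, 3, 3, 2])]), (2, [3, 2, 2, 3], [(1, [3, 1, 2,
  3])]), (2, [3, 2, 3, 2], [(1, [3, 1, 3, 2])]), (2, [3, 3, 2, 2], [(1, [3, 3, 1, 2])]), (2, [2,
  3, 3, 3], [(1, [1, 3, 3, 3])]), (2, [3, 2, 3, 3], [(1, [3, 1, 3, 3])]), (2, [3, 3, 2, 3], [(1,
  [3, 3, 1, 3])]), (2, [3, 3, 3, 2], [(1, [3, 3, 3, 1])]), (3, [3, 4, 3, 7], [(1, [3, 3, 3, 7]),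
  (2, [2, 3, 3, 7])]), (3, [3, 4, 7, 3], [(1, [3, 3, 7, 3]), (2, [2, 3, 7, 3])]), (3, [3, 7, 4,
  3], [(1, [3, 7, 3, 3]), (2, [2, 7, 3, 3])]), (3, [7, 3, 4, 3], [(1, [7, 3, 3, 3]), (2, [7, 2,
  3, 3])]), (4, [3, 7, 8, 7], [(1, [3, 7, 7, 7]), (2, [2, 7, 7, 7]), (4, [3, 4, 7, 7])]), (4,
  [7, 3, 8, 7], [(1, [7, 3, 7, 7]), (2, [7, 2, 7, 7]), (4, [4, 3, 7, 7]), (4, [5, 2, 7, 7])]),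
  (4, [7, 8, 3, 7], [(1, [7, 5, 5, 7]), (2, [7, 3, 6, 7]), (2, [7, 6, 3, 7]), (4, [5, 3, 6, 7]),
  (4, [5, 6, 3, 7])]), (4, [7, 8, 7, 3], [(1, [7, 5, 7, 5]), (2, [7, 3, 7, 6]), (2, [7, 6, 7,
  3]), (4, [5, 3, 7, 6]), (4, [5, 6, 7, 3])]), (4, [7, 9, 2, 7], [(1, [7, 7, 3, 7]), (2, [7, 7,
  2, 7]), (4, [4, 7, 3, 7]), (4, [5, 7, 2, 7])]), (4, [7, 9, 6, 3], [(1, [7, 7, 5, 5]), (2, [7,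
  7, 3, 6]), (2, [7, 7, 6, 3]), (4, [5, 7, 3, 6]), (4, [5, 7, 6, 3])]), (4, [7, 9, 7, 2], [(1,
  [7, 7, 7, 3]), (2, [7, 7, 7, 2]), (4, [4, 7, 7, 3]), (4, [5, 7, 7, 2])])]

theorem strictCheck_strictTable : strictTable.all strictCheck = true := by decide +kernel

theorem sum_foldr_toggle {n : ℕ} (vs : List (Fin n)) (L M : List (List ℕ)) :
    ((L.foldr toggle M).map (powProd vs)).sum =
      (L.map (powProd vs)).sum + (M.map (powProd vs)).sum := by
  induction L with
  | nil => simp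
  | cons t L ih =>
    rw [List.foldr_cons, toggle, List.map_cons, List.sum_cons, add_assoc, ← ih]
    split_ifs with h
    · have h' := List.perm_cons_erase (List.elem_iff.1 h)
      have h2 := (h'.map (powProd vs)).sum_eq
      rw [h2, List.map_cons, List.sum_cons, ← add_assoc, CharTwo.add_self_eq_zero, zero_add]
    · rw [List.map_cons, List.sum_cons]

theorem mem_of_mem_foldr_toggle {L M : List (List ℕ)} {t : List ℕ} (h : t ∈ L.foldr toggle M) :
    t ∈ L ∨ t ∈ M := by
  induction L with
  | nil => exact Or.inr h
  | cons a L ih =>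
    rw [List.foldr_cons, toggle] at h
    split_ifs at h
    · rcases ih (List.mem_of_mem_erase h) with h | h
      · exact Or.inl (List.mem_cons_of_mem _ h)
      · exact Or.inr h
    · rcases List.mem_cons.1 h with rfl | h
      · exact Or.inl (List.mem_cons_self)
      · rcases ih h with h | h
        · exact Or.inl (List.mem_cons_of_mem _ h)
        · exact Or.inr h

/-- Start from `w` and add the terms of all the squares modulo 2. The terms that survive are smaller
than `w` (in particular `w` itself has cancelled), so `w` is a sum of allowed squares and smaller
monomials. -/
theorem mem_span_of_strictCheck {e : ℕ × List ℕ × List (ℕ × List ℕ)} (h : strictCheck e = true)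
    {w : Mon 4} (hw : exps w = e.2.1) (z : Mon 4) : (∀ i, w i < 2 ^ e.1) ∧
    w.toP ∈ Submodule.span (ZMod 2) (boundedSq e.1 z ∪ Mon.toP '' {y | y.Less w}) := by
  simp only [strictCheck, Bool.and_eq_true, List.all_eq_true, Nat.blt_eq, beq_iff_eq] at h
  obtain ⟨⟨⟨_, h2⟩, h3⟩, h4⟩ := h
  refine ⟨fun i => h2 _ (hw ▸ List.mem_ofFn.2 ⟨i, rfl⟩), ?_⟩
  have hsum := sum_foldr_toggle (List.finRange 4) (e.2.2.flatMap fun c => sqTerms c.1 c.2) [e.2.1]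
  rw [← hw, List.map_singleton, List.sum_singleton, powProd_finRange, hw] at hsum
  rw [(sub_eq_of_eq_add' hsum).symm]
  refine Submodule.sub_mem _ ?_ ?_
  · refine list_sum_mem fun f hf => ?_
    obtain ⟨t, ht, rfl⟩ := List.mem_map.1 hf
    have hlen : t.length = 4 := by
      rcases mem_of_mem_foldr_toggle ht with h' | h'
      · obtain ⟨c, hc, ht'⟩ := List.mem_flatMap.1 h'
        rw [length_of_mem_sqTerms ht', (h3 c hc).2]
      · rw [List.mem_singleton.1 h', ← hw, length_exps]
    rw [← exps_ofExps hlen, powProd_finRange]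
    refine Submodule.subset_span (Or.inr ⟨_, ?_, rfl⟩)
    refine less_of_lessCheck ?_
    rw [exps_ofExps hlen, hw]
    exact h4 t ht
  · have : ∀ C : List (ℕ × List ℕ), (∀ c ∈ C, (0 < c.1 ∧ c.1 < 2 ^ e.1) ∧ c.2.length = 4) →
        ((C.flatMap fun c => sqTerms c.1 c.2).map (powProd (List.finRange 4))).sum ∈
          Submodule.span (ZMod 2) (boundedSq e.1 z ∪ Mon.toP '' {y | y.Less w}) := by
      intro C hC
      induction C with
      | nil => simp
      | cons c C ih =>
        rw [List.flatMap_cons, List.map_append, List.sum_append]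
        obtain ⟨⟨hc0, hc1⟩, hc⟩ := hC c List.mem_cons_self
        refine Submodule.add_mem _ ?_ (ih fun c' h' => hC c' (List.mem_cons_of_mem _ h'))
        rw [← Sq_powProd _ _ _ (by simp [hc])]
        exact Submodule.subset_span (Or.inl ⟨c.1, hc0, Or.inl hc1, _, rfl⟩)
    exact this _ h3

/-- The code of a list of numbers less than `32`. -/
def encode32 : List ℕ → ℕ
  | [] => 0
  | a :: l => Nat.add a (Nat.mul 32 (encode32 l))

theorem encode32_injective {l m : List ℕ} (hlen : l.length = m.length) (hl : ∀ a ∈ l, a < 32)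
    (hm : ∀ a ∈ m, a < 32) (h : encode32 l = encode32 m) : l = m := by
  induction l generalizing m with
  | nil => exact (List.length_eq_zero_iff.1 hlen.symm).symm
  | cons a l ih =>
    obtain _ | ⟨b, m⟩ := m
    · simp at hlen
    simp only [encode32, Nat.add_eq, Nat.mul_eq] at h
    have ha := hl a List.mem_cons_self
    have hb := hm b List.mem_cons_self
    rw [show a = b by omega, ih (by simpa using hlen)
      (fun c hc => hl c (List.mem_cons_of_mem _ hc)) (fun c hc => hm c (List.mem_cons_of_mem _ hc))
      (by omega)]

/-- The codes of the strictly inadmissible monomials for windows of `s` digits. -/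
def windowCodes (s : ℕ) : List ℕ :=
  (strictTable.filter fun e => Nat.beq e.1 s).map fun e => encode32 e.2.1

/-- Whether some consecutive digits of the exponents `l` form a strictly inadmissible monomial. -/
def hasWindow (l : List ℕ) : Bool :=
  [2, 3, 4].any fun s => (List.range 4).any fun r =>
    force (encode32 (l.map fun a => Nat.mod (Nat.div a (Nat.pow 2 r)) (Nat.pow 2 s))) fun c =>
      (windowCodes s).any fun d => Nat.beq c d

/-- Kameko's criterion with `u` the `r` lowest digits, `w` the window of the next `s` digits and `z`
all the remaining ones. -/
theorem inadmissible_of_hasWindow {x : Mon 4} (h : hasWindow (exps x) = true) :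
    Inadmissible x := by
  simp only [hasWindow, List.any_eq_true, force_eq, windowCodes, List.mem_map, List.mem_filter,
    Nat.beq_eq] at h
  obtain ⟨s, hs, r, _, _, ⟨e, ⟨he, rfl⟩, rfl⟩, hw⟩ := h
  have hx : lowDigits r x + 2 ^ r • (lowDigits e.1 (highDigits r x) +
      2 ^ e.1 • highDigits e.1 (highDigits r x)) = x := by
    rw [lowDigits_add, lowDigits_add]
  have hcheck := List.all_eq_true.1 strictCheck_strictTable e he
  have hpow : 2 ^ e.1 ≤ 32 := by
    simp only [List.mem_cons, List.not_mem_nil, or_false] at hs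
    rcases hs with h | h | h <;> simp [h]
  have hw' : exps (lowDigits e.1 (highDigits r x)) = e.2.1 := by
    rw [show exps (lowDigits e.1 (highDigits r x)) =
      (exps x).map fun a => Nat.mod (Nat.div a (Nat.pow 2 r)) (Nat.pow 2 e.1) by
        rw [exps, exps, List.map_ofFn]; rfl]
    simp only [strictCheck, Bool.and_eq_true, List.all_eq_true, Nat.blt_eq, beq_iff_eq] at hcheck
    refine encode32_injective ?_ ?_ (fun a ha => (hcheck.1.1.2 a ha).trans_le hpow) hw
    · rw [List.length_map, length_exps, hcheck.1.1.1]
    · intro a ha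
      obtain ⟨b, _, rfl⟩ := List.mem_map.1 ha
      exact (Nat.mod_lt _ (Nat.two_pow_pos _)).trans_le hpow
  obtain ⟨h1, h2⟩ := mem_span_of_strictCheck hcheck hw' (highDigits e.1 (highDigits r x))
  rw [← hx]
  exact inadmissible_of_window (lowDigits_lt r x) h1 h2

end Windows

/-! ### The maps `f_i` and admissibility -/

section Faces

variable {m : ℕ}

@[simp] theorem face_succAbove (i : Fin (m + 1)) (x : Mon m) (j : Fin m) :
    face i x (i.succAbove j) = x j :=
  Finsupp.mapDomain_apply Fin.succAbove_right_injective x j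

@[simp] theorem face_self (i : Fin (m + 1)) (x : Mon m) : face i x i = 0 :=
  Finsupp.mapDomain_of_notMem_range x i (by simp)

theorem weight_face (i : Fin (m + 1)) (x : Mon m) : weight (face i x) = weight x := by
  ext d
  rw [weight_apply, weight_apply, card_filter, card_filter, Fin.sum_univ_succAbove _ i]
  simp

theorem eq_face_of_apply_eq_zero {i : Fin (m + 1)} {y : Mon (m + 1)} (h : y i = 0) :
    ∃ x, y = face i x := by
  refine ⟨Finsupp.equivFunOnFinite.symm fun j => y (i.succAbove j), ?_⟩
  ext j
  rcases Fin.eq_self_or_eq_succAbove i j with rfl | ⟨j, rfl⟩ <;> simp [h]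

theorem face_less_face {i : Fin (m + 1)} {x y : Mon m} :
    (face i x).Less (face i y) ↔ x.Less y := by
  rw [less_iff, less_iff]
  simp only [WeightDrop, weight_face]
  refine or_congr Iff.rfl (and_congr Iff.rfl ⟨?_, ?_⟩)
  · rintro ⟨j, h1, h2⟩
    rcases Fin.eq_self_or_eq_succAbove i j with rfl | ⟨j, rfl⟩
    · simp at h2
    · refine ⟨j, fun d hd => ?_, by simpa using h2⟩
      simpa using h1 _ (Fin.succAbove_lt_succAbove_iff.2 hd)
  · rintro ⟨j, h1, h2⟩
    refine ⟨i.succAbove j, fun d hd => ?_, by simpa using h2⟩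
    rcases Fin.eq_self_or_eq_succAbove i d with rfl | ⟨d, rfl⟩
    · simp
    · simpa using h1 _ (Fin.succAbove_lt_succAbove_iff.1 hd)

/-- The inclusion `f_i`, as a homomorphism of algebras. -/
noncomputable def faceHom (i : Fin (m + 1)) : P m →ₐ[ZMod 2] P (m + 1) :=
  MvPolynomial.rename i.succAbove

theorem faceHom_toP (i : Fin (m + 1)) (x : Mon m) : faceHom i x.toP = (face i x).toP :=
  MvPolynomial.rename_monomial _ _ _

/-- The homomorphism that is left inverse to `f_i` and sends `x_i` to `0`. -/
noncomputable def degeneracyHom (i : Fin (m + 1)) : P (m + 1) →ₐ[ZMod 2] P m :=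
  MvPolynomial.aeval (i.insertNth (0 : P m) fun j => MvPolynomial.X j)

theorem degeneracyHom_face (i : Fin (m + 1)) (x : Mon m) :
    degeneracyHom i (face i x).toP = x.toP := by
  rw [← faceHom_toP, faceHom, degeneracyHom, MvPolynomial.aeval_rename]
  have : (i.insertNth (0 : P m) fun j => MvPolynomial.X j) ∘ i.succAbove =
      (MvPolynomial.X : Fin m → P m) := by
    funext j; simp
  rw [this]
  simp

theorem degeneracyHom_of_ne_zero {i : Fin (m + 1)} {y : Mon (m + 1)} (h : y i ≠ 0) :
    degeneracyHom i y.toP = 0 := by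
  rw [Mon.toP_eq_prod, map_prod]
  refine prod_eq_zero (mem_univ i) ?_
  simp [degeneracyHom, h]

theorem faceHom_mem_hit (i : Fin (m + 1)) {f : P m} (hf : f ∈ hit m) :
    faceHom i f ∈ hit (m + 1) := by
  refine map_mem_hit _ (fun j => ?_) hf
  simp [faceHom, totalSq_X]

theorem degeneracyHom_mem_hit (i : Fin (m + 1)) {f : P (m + 1)} (hf : f ∈ hit (m + 1)) :
    degeneracyHom i f ∈ hit m := by
  refine map_mem_hit _ (fun j => ?_) hf
  rcases Fin.eq_self_or_eq_succAbove i j with rfl | ⟨j, rfl⟩ <;>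
    simp [degeneracyHom, totalSq_X]

theorem toP_mem_of_inadmissible {n : ℕ} {x : Mon n} (h : Inadmissible x) :
    x.toP ∈ hit n ⊔ monSpan {y | y.Less x} := by
  obtain ⟨k, y, hy, hmem⟩ := h
  rw [← sub_add_cancel x.toP (∑ t, (y t).toP)]
  exact Submodule.add_mem_sup hmem (Submodule.sum_mem _ fun t _ => toP_mem_monSpan (hy t).2)

/-- Both `f_i` and its left inverse `x_i ↦ 0` commute with the squares. On monomials without `x_i`
they respect the order, because inserting a zero exponent changes neither weights nor comparisons;
monomials containing `x_i` go to zero. -/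
theorem inadmissible_face_iff {i : Fin (m + 1)} {x : Mon m} :
    Inadmissible (face i x) ↔ Inadmissible x := by
  constructor
  · intro h
    apply inadmissible_of_mem
    rw [← degeneracyHom_face i]
    have : hit (m + 1) ⊔ monSpan {y | y.Less (face i x)} ≤
        (hit m ⊔ monSpan {y | y.Less x}).comap (degeneracyHom i).toLinearMap := by
      refine sup_le (fun f hf => Submodule.mem_sup_left (degeneracyHom_mem_hit i hf)) ?_
      refine Submodule.span_le.2 ?_
      rintro _ ⟨y, hy, rfl⟩
      change degeneracyHom i y.toP ∈ hit m ⊔ monSpan _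
      by_cases h0 : y i = 0
      · obtain ⟨y, rfl⟩ := eq_face_of_apply_eq_zero h0
        rw [degeneracyHom_face]
        exact Submodule.mem_sup_right (toP_mem_monSpan (face_less_face.1 hy))
      · rw [degeneracyHom_of_ne_zero h0]
        exact Submodule.zero_mem _
    exact this (toP_mem_of_inadmissible h)
  · intro h
    apply inadmissible_of_mem
    rw [← faceHom_toP]
    have : hit m ⊔ monSpan {y | y.Less x} ≤
        (hit (m + 1) ⊔ monSpan {y | y.Less (face i x)}).comap (faceHom i).toLinearMap := by
      refine sup_le (fun f hf => Submodule.mem_sup_left (faceHom_mem_hit i hf)) ?_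
      refine Submodule.span_le.2 ?_
      rintro _ ⟨y, hy, rfl⟩
      change faceHom i y.toP ∈ hit (m + 1) ⊔ monSpan _
      rw [faceHom_toP]
      exact Submodule.mem_sup_right (toP_mem_monSpan (face_less_face.2 hy))
    exact this (toP_mem_of_inadmissible h)

theorem admissible_face_iff {i : Fin (m + 1)} {x : Mon m} :
    Admissible (face i x) ↔ Admissible x := not_congr inadmissible_face_iff

theorem exps_face (i : Fin (m + 1)) (x : Mon m) :
    exps (face i x) = (exps x).insertIdx i 0 := by
  refine List.ext_getElem ?_ fun j hj hj' => ?_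
  · rw [length_exps, List.length_insertIdx, length_exps, if_pos (by omega)]
  · have hj1 : j < m + 1 := by rwa [length_exps] at hj
    rw [List.getElem_insertIdx]
    have hl : (exps (face i x))[j] = face i x ⟨j, hj1⟩ := by
      simp only [exps, List.getElem_ofFn]
    rw [hl]
    rcases Fin.eq_self_or_eq_succAbove i ⟨j, hj1⟩ with h | ⟨k, h⟩
    · have hji : j = i := congrArg Fin.val h
      simp [hji]
    · rw [h, face_succAbove]
      have hv := congrArg Fin.val h
      rcases lt_or_ge k.castSucc i with hk | hk
      · rw [Fin.succAbove_of_castSucc_lt _ _ hk] at hv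
        have hk' := Fin.lt_def.1 hk
        simp only [Fin.val_castSucc] at hv hk'
        simp [hv, hk', exps]
      · rw [Fin.succAbove_of_le_castSucc _ _ hk] at hv
        have hk' := Fin.le_def.1 hk
        simp only [Fin.val_castSucc, Fin.val_succ] at hv hk'
        simp [hv, exps, show ¬ (k : ℕ) + 1 < i by omega, show (k : ℕ) + 1 ≠ i by omega]

end Faces

/-! ### Enumeration of monomials of a given degree, and table lookup -/

section Compositions

variable {n : ℕ}

/-- The lists of `n` natural numbers with the sum `d`. -/
def compositions : ℕ → ℕ → List (List ℕ)
  | 0, d => if d = 0 then [[]] else []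
  | n + 1, d => (List.range (d + 1)).flatMap fun a => (compositions n (d - a)).map (a :: ·)

theorem mem_compositions (l : List ℕ) : l ∈ compositions l.length l.sum := by
  induction l with
  | nil => simp [compositions]
  | cons a l ih =>
    simp only [List.length_cons, List.sum_cons, compositions, List.mem_flatMap, List.mem_map,
      List.mem_range]
    exact ⟨a, by omega, l, by rwa [Nat.add_sub_cancel_left], rfl⟩

theorem exps_mem_compositions (x : Mon n) : exps x ∈ compositions n x.degree := by
  have h := mem_compositions (exps x)
  have hs := sum_map_exps x id
  rw [List.map_id] at hs
  rw [length_exps, hs] at h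
  rwa [Finsupp.degree_eq_sum]

/-- Whether `y` occurs in a list of certificates. -/
def isKey (C : List (List ℕ × List ℕ)) (y : List ℕ) : Bool :=
  y.all (fun a => Nat.blt a 32) && force (encode32 y) fun c =>
    C.any fun p => Nat.beq c (encode32 p.1) &&
      (Nat.beq y.length p.1.length && p.1.all fun a => Nat.blt a 32)

theorem exists_of_isKey {C : List (List ℕ × List ℕ)} {y : List ℕ} (h : isKey C y = true) :
    ∃ p ∈ C, y = p.1 := by
  simp only [isKey, force_eq, Bool.and_eq_true, List.all_eq_true, List.any_eq_true, Nat.beq_eq,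
    Nat.blt_eq] at h
  obtain ⟨h1, p, hp, h2, h3, h4⟩ := h
  exact ⟨p, hp, encode32_injective h3 h1 h4 h2⟩

theorem admissible_of_isKey {ks : List ℕ} {r : ℕ} {C : List (List ℕ × List ℕ)}
    (h : certCheck ks r C = true) (hr : ∀ k ∈ ks, k ≤ r) (hks : ks.Pairwise (· ≥ ·))
    {y : Mon 5} (hy : isKey C (exps y) = true) :
    Admissible y ∧ ∀ d, weight y d = ks.getD d 0 := by
  obtain ⟨p, hp, hyp⟩ := exists_of_isKey hy
  exact admissible_of_certCheck h hr hks hp hyp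

end Compositions

/-! ### Admissible monomials of degree 25 in four variables -/

section DegreeTwentyFive

theorem not_isSumOfSpikes_one_twelve : ¬ IsSumOfSpikes 1 12 := by
  rintro ⟨j, m, h, hm⟩
  obtain rfl : m = 0 := hm
  have hj : j < 4 := by
    by_contra hj
    have := Nat.pow_le_pow_right (n := 2) (by norm_num) (not_lt.1 hj)
    omega
  interval_cases j <;> simp at h

theorem not_isSumOfSpikes_one_five : ¬ IsSumOfSpikes 1 5 := by
  rintro ⟨j, m, h, hm⟩
  obtain rfl : m = 0 := hm
  have hj : j < 3 := by
    by_contra hj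
    have := Nat.pow_le_pow_right (n := 2) (by norm_num) (not_lt.1 hj)
    omega
  interval_cases j <;> simp at h

/-- Whether the first three weights show that a monomial of degree `25` satisfies Wood's
criterion. -/
def woodCheck (w : List ℕ) : Bool :=
  Nat.beq (w.getD 0 0) 1 || (Nat.beq (w.getD 0 0) 3 && (Nat.beq (w.getD 1 0) 1 ||
    (Nat.beq (w.getD 1 0) 3 && Nat.beq (w.getD 2 0) 0)))

theorem inadmissible_of_woodCheck {n : ℕ} {x : Mon n} (hx : x.degree = 25)
    (h : woodCheck (weightList (exps x)) = true) : Inadmissible x := by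
  simp only [woodCheck, getD_weightList x (show 0 < 5 by omega),
    getD_weightList x (show 1 < 5 by omega), getD_weightList x (show 2 < 5 by omega),
    Bool.or_eq_true, Bool.and_eq_true, Nat.beq_eq] at h
  have d0 := degree_eq_weight_zero_add x
  have d1 := degree_eq_weight_zero_add (highDigits 1 x)
  rw [weight_add_highDigits] at d1
  have h0 : highDigits 0 x = x := by ext i; simp
  have h2 : highDigits 1 (highDigits 1 x) = highDigits 2 x := by
    ext i; simp [Nat.div_div_eq_div_mul]
  rw [h2, add_zero] at d1
  -- The three cases are `25 = 1 + 2 * 12`, `11 = 1 + 2 * 5` and `4 = 0 + 2 * 2`, where 11 and 4 are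
  -- the degrees left after removing one or two digit levels of weight 3. Neither 12 nor 5 is of the
  -- form `2^j - 1`, and 2 is not an empty sum.
  rcases h with h | ⟨h, h' | ⟨h', h''⟩⟩
  · exact inadmissible_of_not_isSumOfSpikes 0 h (k := 12) (by rw [h0, hx])
      not_isSumOfSpikes_one_twelve
  · exact inadmissible_of_not_isSumOfSpikes 1 h' (k := 5) (by omega) not_isSumOfSpikes_one_five
  · exact inadmissible_of_not_isSumOfSpikes 2 h'' (k := 2) (by omega)
      (by simp [IsSumOfSpikes])

/-- The upper bound: what neither criterion removes is in the table. Since the table entries are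
certified admissible, it is exactly the set of admissible monomials of degree 25. -/
theorem degree_twenty_five_check : (compositions 4 25).all (fun l =>
    woodCheck (weightList l) || (hasWindow l || isKey cert3321Four (l.insertIdx 4 0))) = true := by
  decide +kernel

/-- The exponents of the admissible monomials of degree `25` in four variables. -/
noncomputable def fourList : List (List ℕ) := cert3321Four.map fun p => p.1.take 4

theorem cert3321Four_shape : cert3321Four.all (fun p => p.1 == (p.1.take 4).insertIdx 4 0 &&
    p.1.length == 5) = true := by decide +kernel

theorem length_of_mem_fourList {l : List ℕ} (h : l ∈ fourList) : l.length = 4 := by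
  obtain ⟨p, hp, rfl⟩ := List.mem_map.1 h
  have := List.all_eq_true.1 cert3321Four_shape p hp
  rw [Bool.and_eq_true, beq_iff_eq, beq_iff_eq] at this
  simp [this.2]

theorem exps_mem_fourList {x : Mon 4} (hx : Admissible x) (hd : x.degree = 25) :
    exps x ∈ fourList := by
  have h := List.all_eq_true.1 degree_twenty_five_check _ (hd ▸ exps_mem_compositions x)
  rw [Bool.or_eq_true, Bool.or_eq_true] at h
  rcases h with h | h | h
  · exact absurd (inadmissible_of_woodCheck hd h) hx
  · exact absurd (inadmissible_of_hasWindow h) hx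
  · obtain ⟨p, hp, h⟩ := exists_of_isKey h
    refine List.mem_map.2 ⟨p, hp, ?_⟩
    rw [← h, List.take_insertIdx_eq_take_of_le _ _ _ _ le_rfl,
      List.take_of_length_le (length_exps x).le]

theorem omega3321_apply (d : ℕ) : omega3321 d = [3, 3, 2, 1].getD d 0 := by
  simp [omega3321]

/-- The certificates are for five variables with last exponent 0; admissibility is reflected by the
last face map. All entries have weight `(3,3,2,1)`, so no other weight vector of degree 25 occurs.
-/
theorem admissible_of_mem_fourList {x : Mon 4} (h : exps x ∈ fourList) :
    Admissible x ∧ weight x = omega3321 := by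
  obtain ⟨p, hp, h⟩ := List.mem_map.1 h
  have hshape := List.all_eq_true.1 cert3321Four_shape p hp
  rw [Bool.and_eq_true, beq_iff_eq, h] at hshape
  obtain ⟨h1, h2⟩ := admissible_of_certCheck certCheck_cert3321Four (by simp) (by simp) hp
    ((exps_face (Fin.last 4) x).trans hshape.1.symm)
  refine ⟨admissible_face_iff.1 h1, ?_⟩
  ext d
  rw [← weight_face (Fin.last 4), h2, omega3321_apply]

theorem weightDegree_omega3321 : weightDegree omega3321 = 25 := by
  rw [weightDegree, Finsupp.sum_of_support_subset (s := range 4)]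
  · simp [sum_range_succ, omega3321_apply]
  · intro d hd
    rw [Finsupp.mem_support_iff, omega3321_apply] at hd
    rw [mem_range]
    by_contra h
    exact hd (List.getD_eq_default _ _ (by simpa using h))
  · simp

theorem mem_B_omega3321_iff {x : Mon 4} : x ∈ B 4 omega3321 ↔ exps x ∈ fourList := by
  refine ⟨fun h => exps_mem_fourList h.1 ?_, admissible_of_mem_fourList⟩
  rw [← weightDegree_weight, h.2, weightDegree_omega3321]

end DegreeTwentyFive

/-! ### Computing the monomials `φ_{(i;I)}(x)` -/

section UpDown

/-- The conditions for `u`-compatibility with `(i; I)`, where `f` is the list of the exponents of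
`f_i(x)`. -/
def compatCheck (Is f : List ℕ) (u : ℕ) : Bool :=
  Nat.blt (Nat.pow 2 Is.length - 1) (f.getD (Is.getD u 0) 0) &&
    (List.range Is.length).all fun t =>
      bif Nat.blt t u then
        Nat.beq (f.getD (Is.getD t 0) 0) (Nat.pow 2 Is.length - 1) &&
          (f.getD (Is.getD u 0) 0).testBit (Is.length - (t + 1))
      else (f.getD (Is.getD t 0) 0).testBit (Is.length - (t + 1))

/-- The exponents of `φ_{(i;I)}(x)`. -/
def phiExps (i : ℕ) (Is f : List ℕ) (u : ℕ) : List ℕ :=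
  (List.range 5).map fun j => (bif Nat.beq i j then Nat.pow 2 Is.length - 1 else 0) + f.getD j 0 -
    ((List.range Is.length).map fun t =>
      bif Nat.beq (Is.getD (bif Nat.blt t u then u else t) 0) j then
        Nat.pow 2 (Is.length - (t + 1)) else 0).sum

/-- The pairs `(i; I)` with nonempty `I`, for `n = 5`. -/
def pairTable : List (ℕ × List ℕ) :=
  (List.range 5).flatMap fun i =>
    (((List.range' (i + 1) (4 - i)).sublists'.filter fun I => !I.isEmpty).map fun I => (i, I))

/-- The exponents of the monomials `φ_{(i;I)}(x)`, where `l` is the list of the exponents of `x`. -/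
def phiList (l : List ℕ) : List (List ℕ) :=
  pairTable.flatMap fun c => forceList (l.insertIdx c.1 0) fun f =>
    ((List.range c.2.length).filter (compatCheck c.2 f)).map (phiExps c.1 c.2 f)

theorem beq_eq_decide (a b : ℕ) : Nat.beq a b = decide (a = b) := by
  rw [Bool.eq_iff_iff, Nat.beq_eq, decide_eq_true_iff]

theorem blt_eq_decide (a b : ℕ) : Nat.blt a b = decide (a < b) := by
  rw [Bool.eq_iff_iff, Nat.blt_eq, decide_eq_true_iff]

/-- The sequence `I` as a list. -/
def Pair.toList {n : ℕ} (N : Pair n) : List ℕ := List.ofFn fun t => (N.I t : ℕ)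

theorem Pair.length_toList {n : ℕ} (N : Pair n) : N.toList.length = N.r := List.length_ofFn

theorem Pair.getD_toList {n : ℕ} (N : Pair n) (t : Fin N.r) : N.toList.getD t 0 = N.I t := by
  simp [Pair.toList]

theorem compatCheck_iff {m : ℕ} {N : Pair (m + 1)} {u : Fin N.r} {x : Mon m} :
    compatCheck N.toList (exps (face N.i x)) u = true ↔ Compatible N u x := by
  have key : ∀ t : Fin N.r, (exps (face N.i x)).getD (N.toList.getD t 0) 0 = face N.i x (N.I t) :=
    fun t => by rw [N.getD_toList, getD_exps]
  simp only [compatCheck, Bool.and_eq_true, List.all_eq_true, List.mem_range, N.length_toList,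
    Nat.blt_eq, key, Nat.pow_eq]
  have h2 : (∀ t < N.r, (bif Nat.blt t u then
        Nat.beq ((exps (face N.i x)).getD (N.toList.getD t 0) 0) (2 ^ N.r - 1) &&
          (face N.i x (N.I u)).testBit (N.r - (t + 1))
      else ((exps (face N.i x)).getD (N.toList.getD t 0) 0).testBit (N.r - (t + 1))) = true) ↔
      ∀ t : Fin N.r, (t < u → face N.i x (N.I t) = 2 ^ N.r - 1 ∧
        (face N.i x (N.I u)).testBit (N.r - (t.val + 1)) = true) ∧
        (¬ t < u → (face N.i x (N.I t)).testBit (N.r - (t.val + 1)) = true) := by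
    simp only [blt_eq_decide, beq_eq_decide]
    refine ⟨fun h t => ?_, fun h t ht => ?_⟩
    · have h' := h t t.2
      rw [key] at h'
      by_cases htu : t < u
      · simpa [htu, Fin.lt_def.1 htu] using h'
      · simpa [htu, mt Fin.lt_def.2 htu] using h'
    · have h' := h ⟨t, ht⟩
      rw [key ⟨t, ht⟩]
      by_cases htu : t < u
      · simpa [htu] using h'.1 htu
      · simpa [htu] using h'.2 htu
  rw [h2]
  constructor
  · rintro ⟨h1, h⟩
    refine ⟨fun t ht => ((h t).1 ht).1, h1, fun t ht => ?_, fun t ht => (h t).2 ht.le.not_gt⟩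
    rcases ht.lt_or_eq with ht | rfl
    · exact ((h t).1 ht).2
    · exact (h t).2 (lt_irrefl _)
  · rintro ⟨h1, h2, h3, h4⟩
    refine ⟨h2, fun t => ⟨fun ht => ⟨h1 t ht, h3 t ht.le⟩, fun ht => ?_⟩⟩
    rcases (not_lt.1 ht).lt_or_eq with ht | rfl
    · exact h4 t ht
    · exact h3 _ le_rfl

/-- Uniform description of both parts of the divisor: position `t` contributes its power of 2 to the
variable at position `max(t, u)` of `I`. -/
theorem divisor_apply {n : ℕ} (N : Pair n) (u : Fin N.r) (j : Fin n) :
    divisor N u j = ∑ t : Fin N.r,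
      if N.I (if t < u then u else t) = j then 2 ^ (N.r - (t.val + 1)) else 0 := by
  classical
  rw [← sum_filter_add_sum_filter_not univ (· ≤ u)]
  rw [divisor, Finsupp.add_apply, Finsupp.finsetSum_apply, Finsupp.single_apply]
  congr 1
  · rw [show univ.filter (· ≤ u) = Iic u by ext; simp]
    have hu : ∀ t ∈ Iic u, (if t < u then u else t) = u := fun t ht => by
      rcases (mem_Iic.1 ht).lt_or_eq with h | rfl
      · rw [if_pos h]
      · rw [if_neg (lt_irrefl _)]
    split_ifs with h
    · exact sum_congr rfl fun t ht => by rw [hu t ht, if_pos h]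
    · exact (sum_eq_zero fun t ht => by rw [hu t ht, if_neg h]).symm
  · rw [show univ.filter (fun t => ¬ t ≤ u) = Ioi u by ext; simp]
    refine sum_congr rfl fun t ht => ?_
    rw [if_neg (mem_Ioi.1 ht).le.not_gt, Finsupp.single_apply]

theorem phiExps_eq (N : Pair 5) (u : Fin N.r) (x : Mon 4) :
    phiExps N.i N.toList (exps (face N.i x)) u =
      exps ((Finsupp.single N.i (2 ^ N.r - 1) + face N.i x) - divisor N u) := by
  rw [phiExps, exps.eq_1 (_ - _), List.ofFn_eq_map,
    show List.range 5 = (List.finRange 5).map Fin.val by decide, List.map_map]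
  refine List.map_congr_left fun j _ => ?_
  rw [Function.comp_apply, Finsupp.tsub_apply, divisor_apply, Finsupp.add_apply, getD_exps,
    Finsupp.single_apply, N.length_toList]
  simp only [blt_eq_decide, beq_eq_decide, Nat.pow_eq, Bool.cond_decide]
  congr 2
  · exact if_congr Fin.val_inj rfl rfl
  · rw [← List.map_coe_finRange_eq_range, List.map_map]
    refine List.map_congr_left fun t _ => ?_
    have h1 : (if (t : ℕ) < u then (u : ℕ) else t) = ((if t < u then u else t : Fin N.r) : ℕ) := by
      by_cases htu : t < u
      · rw [if_pos htu, if_pos (Fin.lt_def.1 htu)]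
      · rw [if_neg htu, if_neg (mt Fin.lt_def.2 htu)]
    rw [Function.comp_apply, h1, N.getD_toList]
    exact if_congr Fin.val_inj rfl rfl

theorem Pair.mem_pairTable (N : Pair 5) (h : 0 < N.r) : ((N.i : ℕ), N.toList) ∈ pairTable := by
  simp only [pairTable, List.mem_flatMap, List.mem_range, List.mem_map, List.mem_filter,
    List.mem_sublists']
  refine ⟨N.i, N.i.2, N.toList, ⟨?_, ?_⟩, rfl⟩
  · have hs : N.toList.Pairwise (· < ·) := by
      rw [Pair.toList, List.pairwise_ofFn]
      exact fun i j hij => N.strictMono hij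
    refine List.sublist_of_subperm_of_pairwise (r := (· < ·))
      (List.subperm_of_subset (hs.imp fun h => h.ne) fun a ha => ?_) hs List.pairwise_lt_range'
    obtain ⟨t, rfl⟩ := List.mem_ofFn.1 ha
    have := Fin.lt_def.1 (N.lt t)
    have := (N.I t).2
    rw [List.mem_range'_1]
    omega
  · have := N.length_toList
    cases hN : N.toList with
    | nil => rw [hN] at this; simp at this; omega
    | cons a l => rfl

theorem exists_pair {c : ℕ × List ℕ} (h : c ∈ pairTable) :
    ∃ N : Pair 5, 0 < N.r ∧ c = ((N.i : ℕ), N.toList) := by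
  simp only [pairTable, List.mem_flatMap, List.mem_range, List.mem_map, List.mem_filter,
    List.mem_sublists'] at h
  obtain ⟨i, hi, I, ⟨hI, hne⟩, rfl⟩ := h
  have hs : I.Pairwise (· < ·) := List.Pairwise.sublist hI List.pairwise_lt_range'
  have hb : ∀ t : Fin I.length, i < I[t] ∧ I[t] < 5 := fun t => by
    have := List.mem_range'_1.1 (hI.subset (I.getElem_mem t.2))
    simp only [Fin.getElem_fin]
    omega
  refine ⟨⟨⟨i, hi⟩, I.length, fun t => ⟨I[t], (hb t).2⟩, fun a b hab => ?_, fun t => (hb t).1⟩,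
    ?_, ?_⟩
  · exact List.pairwise_iff_getElem.1 hs a b a.2 b.2 hab
  · cases I with
    | nil => simp at hne
    | cons a l => simp
  · simp [Pair.toList]

theorem mem_phiList_iff {x : Mon 4} {y : Mon 5} :
    exps y ∈ phiList (exps x) ↔ ∃ N : Pair 5, 0 < N.r ∧ IsPhi N x y := by
  simp only [phiList, List.mem_flatMap, forceList_eq, List.mem_map, List.mem_filter,
    List.mem_range]
  constructor
  · rintro ⟨c, hc, u, ⟨hu, hcomp⟩, hy⟩
    obtain ⟨N, hN, rfl⟩ := exists_pair hc
    rw [N.length_toList] at hu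
    rw [← exps_face] at hcomp hy
    refine ⟨N, hN, ⟨u, hu⟩, compatCheck_iff.1 hcomp, exps_injective ?_⟩
    rw [← hy, ← phiExps_eq]
  · rintro ⟨N, hN, u, hcomp, rfl⟩
    refine ⟨_, N.mem_pairTable hN, u, ?_, ?_⟩
    · rw [N.length_toList, ← exps_face]
      exact ⟨u.2, compatCheck_iff.2 hcomp⟩
    · rw [← exps_face, ← phiExps_eq]

end UpDown

/-! ### Counting monomials by their codes -/

section Counting

/-- The list without repetitions. -/
def nub : List ℕ → List ℕ
  | [] => []
  | a :: l => if l.any (fun b => Nat.beq a b) = true then nub l else a :: nub l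

theorem mem_nub {l : List ℕ} {a : ℕ} : a ∈ nub l ↔ a ∈ l := by
  induction l with
  | nil => rfl
  | cons b l ih =>
    rw [nub]
    split_ifs with h
    · simp only [List.any_eq_true, Nat.beq_eq] at h
      obtain ⟨c, hc, rfl⟩ := h
      rw [ih, List.mem_cons]
      exact ⟨Or.inr, fun h => h.elim (fun h => h ▸ hc) id⟩
    · rw [List.mem_cons, List.mem_cons, ih]

theorem nodup_nub (l : List ℕ) : (nub l).Nodup := by
  induction l with
  | nil => exact List.nodup_nil
  | cons b l ih =>
    rw [nub]
    split_ifs with h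
    · exact ih
    · refine List.nodup_cons.2 ⟨fun hb => h ?_, ih⟩
      exact List.any_eq_true.2 ⟨b, mem_nub.1 hb, Nat.beq_refl b⟩

/-- The number of different elements of a list of lists of numbers less than `32`. -/
def countDistinct (K : List (List ℕ)) : ℕ := forceList (K.map encode32) fun l => (nub l).length

theorem finite_setOf_exps_mem {n : ℕ} (K : List (List ℕ)) : {y : Mon n | exps y ∈ K}.Finite :=
  K.finite_toSet.preimage exps_injective.injOn

theorem ncard_setOf_exps_mem {n : ℕ} {K : List (List ℕ)}
    (h : ∀ l ∈ K, l.length = n ∧ ∀ a ∈ l, a < 32) :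
    {y : Mon n | exps y ∈ K}.ncard = countDistinct K := by
  have himg : (fun y : Mon n => encode32 (exps y)) '' {y | exps y ∈ K} =
      ((nub (K.map encode32)).toFinset : Set ℕ) := by
    ext c
    simp only [Set.mem_image, Set.mem_ofPred_eq, List.coe_toFinset, mem_nub, List.mem_map]
    constructor
    · rintro ⟨y, hy, rfl⟩
      exact ⟨_, hy, rfl⟩
    · rintro ⟨l, hl, rfl⟩
      have := exps_ofExps (h l hl).1
      exact ⟨ofExps n l, this.symm ▸ hl, by rw [this]⟩
  rw [countDistinct, forceList_eq, ← List.toFinset_card_of_nodup (nodup_nub _),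
    ← Set.ncard_coe_finset, ← himg,
    Set.InjOn.ncard_image]
  intro y hy z hz hyz
  exact exps_injective (encode32_injective (by rw [length_exps, length_exps]) (h _ hy).2
    (h _ hz).2 hyz)

end Counting

/-! ### The sets `Φ⁰`, `Φ⁺` and the final inclusions -/

section Phi

variable {m : ℕ}

theorem exists_of_mem_PhiZero {S : Set (Mon m)} {y : Mon (m + 1)} (h : y ∈ PhiZero S) :
    ∃ x ∈ S, ∃ i, y = face i x := by
  obtain ⟨i, x, hx, rfl⟩ := h
  exact ⟨x, hx, i, rfl⟩

theorem exists_of_mem_PhiPlus {S : Set (Mon 4)} {y : Mon 5} (h : y ∈ PhiPlus S) :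
    ∃ x ∈ S, exps y ∈ phiList (exps x) ∧ ∀ j, 0 < y j := by
  obtain ⟨⟨N, hN, x, hx, hy⟩, hpos⟩ := h
  exact ⟨x, hx, mem_phiList_iff.2 ⟨N, hN, hy⟩, hpos⟩

/-- Degree 10 is the case `s = 0`. An exact list of admissible monomials is not needed: for each
monomial without a forbidden window, every image under some `φ_{(i;I)}` either misses a variable or
is certified with the same weight vector as its source. -/
theorem degree_ten_check : (compositions 4 10).all (fun l => hasWindow l ||
    (phiList l).all fun y => y.any (Nat.beq 0) ||
      ((hasWeight [2, 2, 1] l && isKey cert221 y) ||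
      ((hasWeight [4, 1, 1] l && isKey cert411 y) ||
      (hasWeight [4, 3] l && isKey cert43 y)))) = true := by decide +kernel

theorem admissible_and_weight_eq {ks : List ℕ} {r : ℕ} {C : List (List ℕ × List ℕ)}
    (hC : certCheck ks r C = true) (hr : ∀ k ∈ ks, k ≤ r) (hks : ks.Pairwise (· ≥ ·))
    {x : Mon m} {y : Mon 5} (h : (hasWeight ks (exps x) && isKey C (exps y)) = true) :
    Admissible y ∧ weight y = weight x := by
  rw [Bool.and_eq_true] at h
  obtain ⟨h1, h2⟩ := admissible_of_isKey hC hr hks h.2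
  refine ⟨h1, ?_⟩
  ext d
  rw [h2, weight_of_hasWeight h.1]

theorem phiPlus_degree_ten {x : Mon 4} (hx : Admissible x) (hd : x.degree = 10) {y : Mon 5}
    (hy : exps y ∈ phiList (exps x)) (hpos : ∀ j, 0 < y j) :
    Admissible y ∧ weight y = weight x := by
  have h := List.all_eq_true.1 degree_ten_check _ (hd ▸ exps_mem_compositions x)
  rw [Bool.or_eq_true] at h
  have h := List.all_eq_true.1 (h.resolve_left fun h => hx (inadmissible_of_hasWindow h)) _ hy
  simp only [Bool.or_eq_true] at h
  rcases h with h | h | h | h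
  · simp only [List.any_eq_true, Nat.beq_eq] at h
    obtain ⟨a, ha, rfl⟩ := h
    obtain ⟨j, hj⟩ := List.mem_ofFn.1 ha
    exact absurd hj (hpos j).ne'
  · exact admissible_and_weight_eq certCheck_cert221 (by simp) (by simp) h
  · exact admissible_and_weight_eq certCheck_cert411 (by simp) (by simp) h
  · exact admissible_and_weight_eq certCheck_cert43 (by simp) (by simp) h

/-- The exponents of the elements of `Φ⁺(B_4(3,3,2,1))`. -/
noncomputable def plusList : List (List ℕ) :=
  (fourList.flatMap phiList).filter fun y => y.all (Nat.blt 0)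

/-- The exponents of the elements of `Φ⁰(B_4(3,3,2,1))`. -/
noncomputable def zeroList : List (List ℕ) :=
  fourList.flatMap fun l => (List.range 5).map fun i => l.insertIdx i 0

theorem plusList_check : plusList.all (isKey cert3321) = true := by decide +kernel

theorem countDistinct_plusList : countDistinct plusList = 361 := by decide +kernel

theorem zeroList_check : zeroList.all (fun y => y.all fun a => Nat.blt a 32) = true := by
  decide +kernel

theorem countDistinct_zeroList : countDistinct zeroList = 520 := by decide +kernel

theorem PhiPlus_omega3321 : PhiPlus (B 4 omega3321) = {y | exps y ∈ plusList} := by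
  ext y
  simp only [plusList, Set.mem_ofPred_eq, List.mem_filter, List.mem_flatMap, List.all_eq_true,
    Nat.blt_eq]
  constructor
  · intro h
    obtain ⟨x, hx, hy, hpos⟩ := exists_of_mem_PhiPlus h
    refine ⟨⟨_, mem_B_omega3321_iff.1 hx, hy⟩, fun a ha => ?_⟩
    obtain ⟨j, rfl⟩ := List.mem_ofFn.1 ha
    exact hpos j
  · rintro ⟨⟨l, hl, hy⟩, hpos⟩
    have hexps := exps_ofExps (length_of_mem_fourList hl)
    rw [← hexps] at hl hy
    obtain ⟨N, hN, hy⟩ := mem_phiList_iff.1 hy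
    exact ⟨⟨N, hN, _, mem_B_omega3321_iff.2 hl, hy⟩, fun j => hpos _ (List.mem_ofFn.2 ⟨j, rfl⟩)⟩

theorem PhiZero_omega3321 : PhiZero (B 4 omega3321) = {y | exps y ∈ zeroList} := by
  ext y
  simp only [zeroList, Set.mem_ofPred_eq, List.mem_flatMap, List.mem_map, List.mem_range]
  constructor
  · rintro ⟨i, x, hx, rfl⟩
    exact ⟨_, mem_B_omega3321_iff.1 hx, i, i.2, (exps_face i x).symm⟩
  · rintro ⟨l, hl, i, hi, hy⟩
    have hexps := exps_ofExps (length_of_mem_fourList hl)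
    rw [← hexps] at hl hy
    refine ⟨⟨i, hi⟩, _, mem_B_omega3321_iff.2 hl, exps_injective ?_⟩
    rw [← hy, exps_face]

theorem admissible_of_mem_plusList {y : Mon 5} (h : exps y ∈ plusList) :
    Admissible y ∧ weight y = omega3321 := by
  obtain ⟨h1, h2⟩ := admissible_of_isKey certCheck_cert3321 (by simp) (by simp)
    (List.all_eq_true.1 plusList_check _ h)
  refine ⟨h1, ?_⟩
  ext d
  rw [h2, omega3321_apply]

theorem ncard_PhiPlus_omega3321 : (PhiPlus (B 4 omega3321)).ncard = 361 := by
  rw [PhiPlus_omega3321, ncard_setOf_exps_mem, countDistinct_plusList]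
  intro l hl
  have hkey := List.all_eq_true.1 plusList_check _ hl
  rw [isKey, Bool.and_eq_true] at hkey
  refine ⟨?_, fun a ha => by simpa using List.all_eq_true.1 hkey.1 a ha⟩
  simp only [plusList, List.mem_filter, List.mem_flatMap, phiList, forceList_eq, List.mem_map] at hl
  obtain ⟨⟨_, _, _, _, _, _, rfl⟩, _⟩ := hl
  simp [phiExps]

theorem ncard_PhiZero_omega3321 : (PhiZero (B 4 omega3321)).ncard = 520 := by
  rw [PhiZero_omega3321, ncard_setOf_exps_mem, countDistinct_zeroList]
  intro l hl
  refine ⟨?_, fun a ha => by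
    simpa using List.all_eq_true.1 (List.all_eq_true.1 zeroList_check _ hl) a ha⟩
  simp only [zeroList, List.mem_flatMap, List.mem_map, List.mem_range] at hl
  obtain ⟨l, hl, i, hi, rfl⟩ := hl
  rw [List.length_insertIdx, length_of_mem_fourList hl, if_pos (by omega)]

theorem disjoint_PhiZero_PhiPlus (S : Set (Mon m)) : Disjoint (PhiZero S) (PhiPlus S) := by
  rw [Set.disjoint_left]
  rintro _ ⟨i, x, _, rfl⟩ ⟨_, hpos⟩
  exact (hpos i).ne' (face_self i x)

theorem ncard_Phi_omega3321 : (Phi (B 4 omega3321)).ncard = 881 := by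
  rw [Phi, Set.ncard_union_eq (disjoint_PhiZero_PhiPlus _)
    (PhiZero_omega3321 ▸ finite_setOf_exps_mem _) (PhiPlus_omega3321 ▸ finite_setOf_exps_mem _),
    ncard_PhiZero_omega3321, ncard_PhiPlus_omega3321]

/-- The common core of both inclusions in (a): the up-maps preserve admissibility and the weight
vector, hence also any bound on it. -/
theorem exists_of_mem_Phi {s : ℕ} {S : Set (Mon 4)}
    (hS : ∀ x ∈ S, Admissible x ∧ x.degree = 15 * 2 ^ s - 5) {y : Mon 5} (hy : y ∈ Phi S) :
    ∃ x ∈ S, Admissible y ∧ weight y = weight x := by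
  rcases hy with hy | hy
  · obtain ⟨x, hx, i, rfl⟩ := exists_of_mem_PhiZero hy
    exact ⟨x, hx, admissible_face_iff.2 (hS x hx).1, weight_face i x⟩
  · obtain ⟨x, hx, hphi, hpos⟩ := exists_of_mem_PhiPlus hy
    obtain ⟨hadm, hdeg⟩ := hS x hx
    refine ⟨x, hx, ?_⟩
    -- Degree 10, degree 25, and the remaining degrees, where there are no admissible monomials in
    -- four variables.
    obtain _ | _ | s := s
    · exact phiPlus_degree_ten hadm hdeg hphi hpos
    · have hx4 := exps_mem_fourList hadm hdeg
      rw [(admissible_of_mem_fourList hx4).2]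
      have hmem : y ∈ PhiPlus (B 4 omega3321) := by
        obtain ⟨N, hN, hy⟩ := mem_phiList_iff.1 hphi
        exact ⟨⟨N, hN, x, mem_B_omega3321_iff.2 hx4, hy⟩, hpos⟩
      rw [PhiPlus_omega3321] at hmem
      exact admissible_of_mem_plusList hmem
    · exact absurd (inadmissible_of_degree (by omega) hdeg) hadm

theorem Phi_B_subset {s : ℕ} {ω : ℕ →₀ ℕ} (hω : weightDegree ω = 15 * 2 ^ s - 5) :
    Phi (B 4 ω) ⊆ B 5 ω := by
  intro y hy
  obtain ⟨x, hx, hadm, hw⟩ := exists_of_mem_Phi (s := s)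
    (fun x hx => ⟨hx.1, by rw [← weightDegree_weight, hx.2, hω]⟩) hy
  exact ⟨hadm, hw.trans hx.2⟩

theorem Phi_BLe_subset {s : ℕ} {ω : ℕ →₀ ℕ} (hω : weightDegree ω = 15 * 2 ^ s - 5) :
    Phi (BLe 4 ω) ⊆ BLe 5 ω := by
  intro y hy
  obtain ⟨x, hx, hadm, hw⟩ := exists_of_mem_Phi (s := s)
    (fun x hx => ⟨hx.1.1, by rw [hx.1.2, hω]⟩) hy
  refine ⟨⟨hadm, ?_⟩, hw ▸ hx.2⟩
  rw [← weightDegree_weight, hw, weightDegree_weight, hx.1.2]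

theorem B_eq_empty_of_ne {ω : ℕ →₀ ℕ} (hω : weightDegree ω = 25) (hne : ω ≠ omega3321) :
    B 4 ω = ∅ := by
  refine Set.eq_empty_of_forall_notMem fun x hx => hne ?_
  have hd : x.degree = 25 := by rw [← weightDegree_weight, hx.2, hω]
  rw [← hx.2, (admissible_of_mem_fourList (exps_mem_fourList hx.1 hd)).2]

theorem B_eq_empty {s : ℕ} (hs : 1 < s) {ω : ℕ →₀ ℕ} (hω : weightDegree ω = 15 * 2 ^ s - 5) :
    B 4 ω = ∅ := by
  refine Set.eq_empty_of_forall_notMem fun x hx => hx.1 (inadmissible_of_degree hs ?_)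
  rw [← weightDegree_weight, hx.2, hω]

end Phi

end HitProblem

theorem mainTheorem10 :
    -- the inclusion in all degrees `15 · 2^s - 5`, for every weight vector of that degree
    (∀ (s : ℕ) (ω : ℕ →₀ ℕ), HitProblem.weightDegree ω = 15 * 2 ^ s - 5 →
      HitProblem.Phi (HitProblem.B 4 ω) ⊆ HitProblem.B 5 ω ∧
      HitProblem.Phi (HitProblem.BLe 4 ω) ⊆ HitProblem.BLe 5 ω) ∧
    -- the case `s = 1`, that is, degree 25
    (HitProblem.PhiPlus (HitProblem.B 4 HitProblem.omega3321)).ncard = 361 ∧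
    (HitProblem.Phi (HitProblem.B 4 HitProblem.omega3321)).ncard = 881 ∧
    HitProblem.Phi (HitProblem.B 4 HitProblem.omega3321) ⊆
      HitProblem.B 5 HitProblem.omega3321 ∧
    (∀ ω : ℕ →₀ ℕ, HitProblem.weightDegree ω = 25 → ω ≠ HitProblem.omega3321 →
      HitProblem.B 4 ω = ∅) ∧
    -- the case `s > 1`
    (∀ s : ℕ, 1 < s → HitProblem.BDeg 4 (15 * 2 ^ s - 5) = ∅ ∧
      ∀ ω : ℕ →₀ ℕ, HitProblem.weightDegree ω = 15 * 2 ^ s - 5 → HitProblem.B 4 ω = ∅) := by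
  refine ⟨fun s ω hω => ⟨HitProblem.Phi_B_subset hω, HitProblem.Phi_BLe_subset hω⟩,
    HitProblem.ncard_PhiPlus_omega3321, HitProblem.ncard_Phi_omega3321,
    HitProblem.Phi_B_subset (s := 1) HitProblem.weightDegree_omega3321,
    fun ω hω hne => HitProblem.B_eq_empty_of_ne hω hne,
    fun s hs => ⟨HitProblem.BDeg_eq_empty hs, fun ω hω => HitProblem.B_eq_empty hs hω⟩⟩
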